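/- All alphabets are finite. Let $(S_1,S_2)\sim p_{S_1,S_2}$ be a discrete memoryless source, let $p_{Y|X_1,X_2}$ be a discrete memoryless multiple access channel, and let $S_0$ be a common part of $S_1,S_2$, that is, $S_0=f_1(S_1)=f_2(S_2)$ with probability one for some functions $f_1,f_2$. An $n$-length code consists of encoders $x_k^n:\mathcal S_k^n\to\mathcal X_k^n$ and decoders $\hat s_k^n:\mathcal Y^n\to\mathcal S_k^n$, $k=1,2$. Lossless communication means that zero Hamming distortion is achievable: $p_{S_1,S_2}$ is admissible, $p_{S_1,S_2}\in\mathcal R$, if there is a sequence of $n$-length codes with $\limsup_{n\to\infty}\frac1n\sum_{t=1}^n\mathbb P(S_{k,t}\ne\hat S_{k,t})\le 0$ for $k=1,2$. Let $\mathcal R^{(i)}$ be the set of $p_{S_1,S_2}$ for which there exist a finite-alphabet $p_W$ and pmfs $p_{X_1|S_1,W}$, $p_{X_2|S_2,W}$ such that, for $(S_1,S_2,W,X_1,X_2,Y)\sim p_{S_1,S_2}\,p_W\,p_{X_1|S_1,W}\,p_{X_2|S_2,W}\,p_{Y|X_1,X_2}$, \begin{align*} H(S_1|S_2)&\le I(X_1;Y|X_2S_2W),\\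 H(S_2|S_1)&\le I(X_2;Y|X_1S_1W),\\ H(S_1S_2|S_0)&\le I(X_1X_2;Y|S_0W),\\ H(S_1S_2)&\le I(X_1X_2;Y). \end{align*} Let $\mathcal R^{(o)}$ be the set of $p_{S_1,S_2}$ such that for every finite-alphabet $p_{U|S_1,S_2}$ with $S_1\to(S_0,U)\to S_2$ and every $\varepsilon>0$ there exist $n\ge1$, a finite-alphabet $p_Q$ and pmfs $p_{X_1|S_1^n,Q}$, $p_{X_2|S_2^n,Q}$ such that, under $p_Q\prod_{i=1}^n p_{S_1,S_2}(s_{1,i},s_{2,i})\,p_{U|S_1,S_2}(u_i|s_{1,i},s_{2,i})\;p_{X_1|S_1^n,Q}\,p_{X_2|S_2^n,Q}\,p_{Y|X_1,X_2}$, \begin{align*} H(S_1S_2)&\le I(X_1X_2;Y|Q)+\varepsilon,\\ H(S_1|S_2)&\le I(X_1;Y|X_2S_2^nQ)+\varepsilon,\\ H(S_2|S_1)&\le I(X_2;Y|X_1S_1^nQ)+\varepsilon,\\ H(S_1S_2|S_0)&\le I(X_1X_2;Y|S_0^nQ)+\varepsilon,\\ H(S_1S_2|S_0U)&\le I(X_1X_2;Y|S_0^nU^nQ)+\varepsilon,\\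 H(S_1|S_2U)&\le I(X_1;Y|X_2S_2^nU^nQ)+\varepsilon,\\ H(S_2|S_1U)&\le I(X_2;Y|X_1S_1^nU^nQ)+\varepsilon. \end{align*} If $S_1\to S_0\to S_2$, then $$p_{S_1,S_2}\in\mathcal R\iff p_{S_1,S_2}\in\mathcal R^{(i)}\iff p_{S_1,S_2}\in\mathcal R^{(o)},$$ that is, for such sources the admissible source region, the inner bound and the outer bound all coincide with the region given by the four inequalities in the definition of $\mathcal R^{(i)}$. -/

import Mathlib

open Filter
open scoped ENNReal

/- Finite probability: a pmf on a finite type `Ω` is an element of `stdSimplex ℝ Ω`, a conditional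
pmf is a family of pmfs, a random variable is a function on `Ω`. Entropies are in nats; all the
inequalities below are homogeneous, so that the base of the logarithm is irrelevant. -/

namespace MacSource

noncomputable section

section Entropy

variable {Ω A B C : Type*} [Fintype Ω] [Fintype A] [Fintype B] [Fintype C]

/-- The conditional pmfs `p_{B|A}`. -/
def IsCondPMF {A B : Type*} [Fintype B] (K : A → B → ℝ) : Prop :=
  ∀ a, K a ∈ stdSimplex ℝ B

open Classical in
/-- The law of the random variable `X` under the pmf `P`: `law P X a = P(X = a)`. -/
def law {A : Type*} (P : Ω → ℝ) (X : Ω → A) (a : A) : ℝ :=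
  ∑ ω, if X ω = a then P ω else 0

/-- Shannon entropy `H(X)`. -/
def entropy (P : Ω → ℝ) (X : Ω → A) : ℝ :=
  ∑ a, Real.negMulLog (law P X a)

/-- Conditional entropy `H(X|Z) = H(X,Z) - H(Z)`. -/
def condEntropy (P : Ω → ℝ) (X : Ω → A) (Z : Ω → C) : ℝ :=
  entropy P (fun ω => (X ω, Z ω)) - entropy P Z

/-- Mutual information `I(X;Y) = H(X) - H(X|Y)`. -/
def mutualInfo (P : Ω → ℝ) (X : Ω → A) (Y : Ω → B) : ℝ :=
  entropy P X - condEntropy P X Y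

/-- Conditional mutual information `I(X;Y|Z) = H(X|Z) - H(X|Y,Z)`. -/
def condMutualInfo (P : Ω → ℝ) (X : Ω → A) (Y : Ω → B) (Z : Ω → C) : ℝ :=
  condEntropy P X Z - condEntropy P X (fun ω => (Y ω, Z ω))

/-- The Markov chain `X → Z → Y`: `P(x,z,y) P(z) = P(x,z) P(z,y)` for all values. -/
def IsMarkov {A B C : Type*} (P : Ω → ℝ) (X : Ω → A) (Z : Ω → C) (Y : Ω → B) : Prop :=
  ∀ x z y, law P (fun ω => (X ω, Z ω, Y ω)) (x, z, y) * law P Z z =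
    law P (fun ω => (X ω, Z ω)) (x, z) * law P (fun ω => (Z ω, Y ω)) (z, y)

end Entropy

/-- `S₀ = f₁(S₁) = f₂(S₂)` with probability one under the source pmf `p`. -/
def IsCommonPart {S₀ S₁ S₂ : Type*} (p : S₁ × S₂ → ℝ) (f₁ : S₁ → S₀) (f₂ : S₂ → S₀) : Prop :=
  ∀ s₁ s₂, p (s₁, s₂) ≠ 0 → f₁ s₁ = f₂ s₂

/-! ### Source-channel codes and achievable distortions -/

/-- An `n`-length source-channel code, with reconstruction alphabets `R₁`, `R₂`. -/
structure Code (S₁ S₂ X₁ X₂ Y R₁ R₂ : Type*) (n : ℕ) where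
  enc₁ : (Fin n → S₁) → (Fin n → X₁)
  enc₂ : (Fin n → S₂) → (Fin n → X₂)
  dec₁ : (Fin n → Y) → (Fin n → R₁)
  dec₂ : (Fin n → Y) → (Fin n → R₂)

section Operational

variable {S₁ S₂ X₁ X₂ Y R₁ R₂ : Type*} [Fintype S₁] [Fintype S₂] [Fintype Y]

/-- Joint pmf of `(S₁ⁿ, S₂ⁿ, Yⁿ)` when the memoryless source `p` is sent with the code `c` over the
memoryless multiple access channel `mac x₁ x₂ y = p_{Y|X₁,X₂}(y|x₁,x₂)`. -/
def blockLaw (mac : X₁ → X₂ → Y → ℝ) (p : S₁ × S₂ → ℝ) {n : ℕ} (c : Code S₁ S₂ X₁ X₂ Y R₁ R₂ n)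
    (s₁ : Fin n → S₁) (s₂ : Fin n → S₂) (y : Fin n → Y) : ℝ :=
  (∏ i, p (s₁ i, s₂ i)) * ∏ i, mac (c.enc₁ s₁ i) (c.enc₂ s₂ i) (y i)

/-- `(1/n) ∑ₜ E d₁(S₁ₜ, Ŝ₁ₜ)`. -/
def distortion₁ (mac : X₁ → X₂ → Y → ℝ) (p : S₁ × S₂ → ℝ) (d₁ : S₁ → R₁ → ℝ≥0∞) {n : ℕ}
    (c : Code S₁ S₂ X₁ X₂ Y R₁ R₂ n) : ℝ≥0∞ :=
  (n : ℝ≥0∞)⁻¹ * ∑ t, ∑ s₁, ∑ s₂, ∑ y,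
    ENNReal.ofReal (blockLaw mac p c s₁ s₂ y) * d₁ (s₁ t) (c.dec₁ y t)

/-- `(1/n) ∑ₜ E d₂(S₂ₜ, Ŝ₂ₜ)`. -/
def distortion₂ (mac : X₁ → X₂ → Y → ℝ) (p : S₁ × S₂ → ℝ) (d₂ : S₂ → R₂ → ℝ≥0∞) {n : ℕ}
    (c : Code S₁ S₂ X₁ X₂ Y R₁ R₂ n) : ℝ≥0∞ :=
  (n : ℝ≥0∞)⁻¹ * ∑ t, ∑ s₁, ∑ s₂, ∑ y,
    ENNReal.ofReal (blockLaw mac p c s₁ s₂ y) * d₂ (s₂ t) (c.dec₂ y t)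

/-- The distortion pair `(D₁, D₂)` is achievable for the source `p` over the channel `mac`. -/
def IsAchievable (mac : X₁ → X₂ → Y → ℝ) (p : S₁ × S₂ → ℝ)
    (d₁ : S₁ → R₁ → ℝ≥0∞) (d₂ : S₂ → R₂ → ℝ≥0∞) (D₁ D₂ : ℝ≥0∞) : Prop :=
  ∃ c : (n : ℕ) → Code S₁ S₂ X₁ X₂ Y R₁ R₂ n,
    limsup (fun n => distortion₁ mac p d₁ (c n)) atTop ≤ D₁ ∧
    limsup (fun n => distortion₂ mac p d₂ (c n)) atTop ≤ D₂

open Classical in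
/-- Hamming distortion. -/
def hamming {S : Type*} (s t : S) : ℝ≥0∞ := if s = t then 0 else 1

/-- The admissible source region `𝓡` of lossless communication: zero Hamming distortion is
achievable for both sources. -/
def admissibleRegion (S₁ S₂ : Type*) [Fintype S₁] [Fintype S₂] (mac : X₁ → X₂ → Y → ℝ) :
    Set (S₁ × S₂ → ℝ) :=
  {p | IsAchievable mac p (hamming (S := S₁)) (hamming (S := S₂)) 0 0}

end Operational

/-! ### The single-letter inner bound -/

section Inner

/-- Sample space of `(S₁, S₂, W, X₁, X₂, Y)`. -/
abbrev InnerSpace (S₁ S₂ 𝓦 X₁ X₂ Y : Type*) := S₁ × S₂ × 𝓦 × X₁ × X₂ × Y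

/-- The pmf `p_{S₁,S₂} p_W p_{X₁|S₁,W} p_{X₂|S₂,W} p_{Y|X₁,X₂}`. -/
def innerLaw {S₁ S₂ 𝓦 X₁ X₂ Y : Type*} (mac : X₁ → X₂ → Y → ℝ) (p : S₁ × S₂ → ℝ) (pW : 𝓦 → ℝ)
    (pX₁ : S₁ × 𝓦 → X₁ → ℝ) (pX₂ : S₂ × 𝓦 → X₂ → ℝ) : InnerSpace S₁ S₂ 𝓦 X₁ X₂ Y → ℝ :=
  fun (s₁, s₂, w, x₁, x₂, y) =>
    p (s₁, s₂) * pW w * pX₁ (s₁, w) x₁ * pX₂ (s₂, w) x₂ * mac x₁ x₂ y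

variable {S₀ S₁ S₂ X₁ X₂ Y : Type*} [Fintype S₀] [Fintype S₁] [Fintype S₂]
  [Fintype X₁] [Fintype X₂] [Fintype Y]

/-- The inner bound `𝓡⁽ⁱ⁾` for lossless communication, with common part `S₀ = f₁(S₁)`. -/
def innerBound (mac : X₁ → X₂ → Y → ℝ) (f₁ : S₁ → S₀) : Set (S₁ × S₂ → ℝ) :=
  {p | ∃ (m : ℕ) (pW : Fin m → ℝ) (pX₁ : S₁ × Fin m → X₁ → ℝ) (pX₂ : S₂ × Fin m → X₂ → ℝ),
    pW ∈ stdSimplex ℝ (Fin m) ∧ IsCondPMF pX₁ ∧ IsCondPMF pX₂ ∧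
    condEntropy p (fun (s₁, _) => s₁) (fun (_, s₂) => s₂) ≤
      condMutualInfo (innerLaw mac p pW pX₁ pX₂)
        (fun (_, _, _, x₁, _, _) => x₁) (fun (_, _, _, _, _, y) => y)
        (fun (_, s₂, w, _, x₂, _) => (x₂, s₂, w)) ∧
    condEntropy p (fun (_, s₂) => s₂) (fun (s₁, _) => s₁) ≤
      condMutualInfo (innerLaw mac p pW pX₁ pX₂)
        (fun (_, _, _, _, x₂, _) => x₂) (fun (_, _, _, _, _, y) => y)
        (fun (s₁, _, w, x₁, _, _) => (x₁, s₁, w)) ∧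
    condEntropy p (fun (s₁, s₂) => (s₁, s₂)) (fun (s₁, _) => f₁ s₁) ≤
      condMutualInfo (innerLaw mac p pW pX₁ pX₂)
        (fun (_, _, _, x₁, x₂, _) => (x₁, x₂)) (fun (_, _, _, _, _, y) => y)
        (fun (s₁, _, w, _, _, _) => (f₁ s₁, w)) ∧
    entropy p (fun (s₁, s₂) => (s₁, s₂)) ≤
      mutualInfo (innerLaw mac p pW pX₁ pX₂)
        (fun (_, _, _, x₁, x₂, _) => (x₁, x₂)) (fun (_, _, _, _, _, y) => y)}

end Inner

/-! ### The outer bound -/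

section Outer

/-- The pmf `p_{S₁,S₂} p_{U|S₁,S₂}` of `(S₁, S₂, U)`. -/
def sourceLaw {S₁ S₂ 𝓤 : Type*} (p : S₁ × S₂ → ℝ) (pU : S₁ × S₂ → 𝓤 → ℝ) : S₁ × S₂ × 𝓤 → ℝ :=
  fun (s₁, s₂, u) => p (s₁, s₂) * pU (s₁, s₂) u

/-- Sample space of `(Q, S₁ⁿ, S₂ⁿ, Uⁿ, X₁, X₂, Y)`. -/
abbrev OuterSpace (n : ℕ) (𝓠 S₁ S₂ 𝓤 X₁ X₂ Y : Type*) :=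
  𝓠 × (Fin n → S₁) × (Fin n → S₂) × (Fin n → 𝓤) × X₁ × X₂ × Y

/-- The pmf `p_Q ∏ᵢ p_{S₁,S₂}(s₁ᵢ,s₂ᵢ) p_{U|S₁,S₂}(uᵢ|s₁ᵢ,s₂ᵢ) p_{X₁|S₁ⁿ,Q} p_{X₂|S₂ⁿ,Q}
p_{Y|X₁,X₂}`. -/
def outerLaw {S₁ S₂ 𝓤 𝓠 X₁ X₂ Y : Type*} {n : ℕ} (mac : X₁ → X₂ → Y → ℝ) (p : S₁ × S₂ → ℝ)
    (pU : S₁ × S₂ → 𝓤 → ℝ) (pQ : 𝓠 → ℝ) (pX₁ : (Fin n → S₁) × 𝓠 → X₁ → ℝ)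
    (pX₂ : (Fin n → S₂) × 𝓠 → X₂ → ℝ) : OuterSpace n 𝓠 S₁ S₂ 𝓤 X₁ X₂ Y → ℝ :=
  fun (q, s₁, s₂, u, x₁, x₂, y) =>
    pQ q * (∏ i, sourceLaw p pU (s₁ i, s₂ i, u i)) * pX₁ (s₁, q) x₁ * pX₂ (s₂, q) x₂ * mac x₁ x₂ y

variable {S₀ S₁ S₂ X₁ X₂ Y : Type*} [Fintype S₀] [Fintype S₁] [Fintype S₂]
  [Fintype X₁] [Fintype X₂] [Fintype Y]

/-- The outer bound `𝓡⁽ᵒ⁾` for lossless communication, with common part `S₀ = f₁(S₁)`. The source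
block length `n` tends to infinity in the problem; accordingly the inequalities are required up to
an arbitrarily small slack `ε`, with `n` and the pmfs allowed to depend on `ε`. -/
def outerBound (mac : X₁ → X₂ → Y → ℝ) (f₁ : S₁ → S₀) : Set (S₁ × S₂ → ℝ) :=
  {p | ∀ (l : ℕ) (pU : S₁ × S₂ → Fin l → ℝ), IsCondPMF pU →
    IsMarkov (sourceLaw p pU)
      (fun (s₁, _, _) => s₁) (fun (s₁, _, u) => (f₁ s₁, u)) (fun (_, s₂, _) => s₂) →
    ∀ ε : ℝ, 0 < ε →
    ∃ (n m : ℕ) (pQ : Fin m → ℝ) (pX₁ : (Fin n → S₁) × Fin m → X₁ → ℝ)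
      (pX₂ : (Fin n → S₂) × Fin m → X₂ → ℝ),
    0 < n ∧ pQ ∈ stdSimplex ℝ (Fin m) ∧ IsCondPMF pX₁ ∧ IsCondPMF pX₂ ∧
    entropy (sourceLaw p pU) (fun (s₁, s₂, _) => (s₁, s₂)) ≤
      condMutualInfo (outerLaw mac p pU pQ pX₁ pX₂)
        (fun (_, _, _, _, x₁, x₂, _) => (x₁, x₂)) (fun (_, _, _, _, _, _, y) => y)
        (fun (q, _, _, _, _, _, _) => q) + ε ∧
    condEntropy (sourceLaw p pU) (fun (s₁, _, _) => s₁) (fun (_, s₂, _) => s₂) ≤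
      condMutualInfo (outerLaw mac p pU pQ pX₁ pX₂)
        (fun (_, _, _, _, x₁, _, _) => x₁) (fun (_, _, _, _, _, _, y) => y)
        (fun (q, _, s₂, _, _, x₂, _) => (x₂, s₂, q)) + ε ∧
    condEntropy (sourceLaw p pU) (fun (_, s₂, _) => s₂) (fun (s₁, _, _) => s₁) ≤
      condMutualInfo (outerLaw mac p pU pQ pX₁ pX₂)
        (fun (_, _, _, _, _, x₂, _) => x₂) (fun (_, _, _, _, _, _, y) => y)
        (fun (q, s₁, _, _, x₁, _, _) => (x₁, s₁, q)) + ε ∧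
    condEntropy (sourceLaw p pU) (fun (s₁, s₂, _) => (s₁, s₂)) (fun (s₁, _, _) => f₁ s₁) ≤
      condMutualInfo (outerLaw mac p pU pQ pX₁ pX₂)
        (fun (_, _, _, _, x₁, x₂, _) => (x₁, x₂)) (fun (_, _, _, _, _, _, y) => y)
        (fun (q, s₁, _, _, _, _, _) => (f₁ ∘ s₁, q)) + ε ∧
    condEntropy (sourceLaw p pU) (fun (s₁, s₂, _) => (s₁, s₂)) (fun (s₁, _, u) => (f₁ s₁, u)) ≤
      condMutualInfo (outerLaw mac p pU pQ pX₁ pX₂)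
        (fun (_, _, _, _, x₁, x₂, _) => (x₁, x₂)) (fun (_, _, _, _, _, _, y) => y)
        (fun (q, s₁, _, u, _, _, _) => (f₁ ∘ s₁, u, q)) + ε ∧
    condEntropy (sourceLaw p pU) (fun (s₁, _, _) => s₁) (fun (_, s₂, u) => (s₂, u)) ≤
      condMutualInfo (outerLaw mac p pU pQ pX₁ pX₂)
        (fun (_, _, _, _, x₁, _, _) => x₁) (fun (_, _, _, _, _, _, y) => y)
        (fun (q, _, s₂, u, _, x₂, _) => (x₂, s₂, u, q)) + ε ∧
    condEntropy (sourceLaw p pU) (fun (_, s₂, _) => s₂) (fun (s₁, _, u) => (s₁, u)) ≤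
      condMutualInfo (outerLaw mac p pU pQ pX₁ pX₂)
        (fun (_, _, _, _, _, x₂, _) => x₂) (fun (_, _, _, _, _, _, y) => y)
        (fun (q, s₁, _, u, x₁, _, _) => (x₁, s₁, u, q)) + ε}

end Outer

end

end MacSource

namespace MacSource

noncomputable section

/-! ### Laws and entropies of finite random variables -/

section Law

variable {Ω Ω' A B C : Type*} [Fintype Ω] [Fintype Ω']

/-! All three sets are compared with one condition, `EntropiesSupported`: the four source entropies
lie in the region `IsSupported` of a multiple access channel with common message, where an auxiliary
variable V is drawn and the two inputs are independent given V.

Inner bound. Since S₁ and S₂ are independent given S₀, the inputs X₁ and X₂ are independent given V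
= (S₀, W). As S₀ is a function of either source, it can be added to each conditioning at no cost,
and the four informations then depend only on the law of V and on the two input laws given V.
Conversely, any V can serve as W, with inputs that ignore the source. This is `mem_innerBound_iff`.

Outer bound. With U constant, the outer law is an inner law for the block source with W = Q. The
same computation applies with V = (S₀ⁿ, Q), and I(X₁X₂;Y|Q) ≤ I(X₁X₂;Y) because Q acts on Y only
through the inputs. What remains is a slack ε, which `isSupported_of_forall_pos` removes by
compactness: Carathéodory's theorem bounds the alphabet of V.

Converse. For a good code, Fano's inequality makes H(S₁ⁿS₂ⁿ|Yⁿ) at most nε. Taking Q to be a uniform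
time index single-letterizes all seven inequalities at once (`condEntropy_le_of_code`,
`mem_outerBound_of_mem_admissibleRegion`).

Achievability. Superposition random coding with a threshold decoder (`exists_code_error_le`) is
combined with exponential tail bounds (`exists_tail_le`). The entropy inequalities are not strict,
so only about (1 - η)n of the n source letters are encoded; this gains a factor on every nonzero
entropy, and the letters that are merely guessed cost about η in Hamming distortion. A zero entropy
gives no gain, but then the corresponding confusion has zero weight (`exists_blockCode_error_le`).
-/

theorem law_nonneg {P : Ω → ℝ} (hP : ∀ ω, 0 ≤ P ω) (X : Ω → A) (a : A) : 0 ≤ law P X a :=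
  Finset.sum_nonneg fun ω _ => by split_ifs <;> simp [hP]

theorem le_law {P : Ω → ℝ} (hP : ∀ ω, 0 ≤ P ω) (X : Ω → A) (ω : Ω) : P ω ≤ law P X (X ω) := by
  classical
  have := Finset.single_le_sum (f := fun ω' => if X ω' = X ω then P ω' else 0)
    (fun ω' _ => by positivity [hP ω']) (Finset.mem_univ ω)
  simpa [law] using this

theorem law_pos {P : Ω → ℝ} (hP : ∀ ω, 0 ≤ P ω) (X : Ω → A) {ω : Ω} (h : P ω ≠ 0) :
    0 < law P X (X ω) :=
  lt_of_lt_of_le (lt_of_le_of_ne (hP ω) h.symm) (le_law hP X ω)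

theorem exists_of_law_ne_zero {P : Ω → ℝ} {X : Ω → A} {a : A} (h : law P X a ≠ 0) :
    ∃ ω, X ω = a ∧ P ω ≠ 0 := by
  classical
  obtain ⟨ω, -, hω⟩ := Finset.exists_ne_zero_of_sum_ne_zero h
  exact ⟨ω, by simpa using hω⟩

theorem sum_law_mul [Fintype A] (P : Ω → ℝ) (X : Ω → A) (g : A → ℝ) :
    ∑ a, law P X a * g a = ∑ ω, P ω * g (X ω) := by
  classical
  simp only [law, Finset.sum_mul]
  rw [Finset.sum_comm]
  simp [ite_mul]

theorem sum_law [Fintype A] (P : Ω → ℝ) (X : Ω → A) : ∑ a, law P X a = ∑ ω, P ω := by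
  simpa using sum_law_mul P X fun _ => 1

theorem law_mem_stdSimplex [Fintype A] {P : Ω → ℝ} (hP : P ∈ stdSimplex ℝ Ω) (X : Ω → A) :
    law P X ∈ stdSimplex ℝ A :=
  ⟨law_nonneg hP.1 X, (sum_law P X).trans hP.2⟩

theorem law_law [Fintype A] (P : Ω → ℝ) (X : Ω → A) (Y : A → B) :
    law (law P X) Y = law P (fun ω => Y (X ω)) := by
  classical
  ext b
  have := sum_law_mul P X fun a => if Y a = b then 1 else 0
  simpa [law] using this

theorem law_eq_law_of_iff {P : Ω → ℝ} {X : Ω → A} {Y : Ω → B} {a : A} {b : B}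
    (h : ∀ ω, P ω ≠ 0 → (X ω = a ↔ Y ω = b)) : law P X a = law P Y b := by
  classical
  refine Finset.sum_congr rfl fun ω _ => ?_
  by_cases h0 : P ω = 0
  · simp [h0]
  · simp [h ω h0]

theorem law_le_law_of_imp {P : Ω → ℝ} (hP : ∀ ω, 0 ≤ P ω) {X : Ω → A} {Y : Ω → B} {a : A} {b : B}
    (h : ∀ ω, P ω ≠ 0 → X ω = a → Y ω = b) : law P X a ≤ law P Y b := by
  classical
  refine Finset.sum_le_sum fun ω _ => ?_
  by_cases h0 : P ω = 0
  · simp [h0]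
  · by_cases h1 : X ω = a
    · simp [h1, h ω h0 h1]
    · simp only [h1, if_false]
      positivity [hP ω]

theorem law_prod_fst [Fintype B] (P : Ω → ℝ) (X : Ω → A) (Y : Ω → B) (a : A) :
    ∑ b, law P (fun ω => (X ω, Y ω)) (a, b) = law P X a := by
  classical
  simp only [law]
  rw [Finset.sum_comm]
  refine Finset.sum_congr rfl fun ω _ => ?_
  by_cases h : X ω = a <;> simp [h]

theorem law_prod_snd [Fintype A] (P : Ω → ℝ) (X : Ω → A) (Y : Ω → B) (b : B) :
    ∑ a, law P (fun ω => (X ω, Y ω)) (a, b) = law P Y b := by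
  classical
  simp only [law]
  rw [Finset.sum_comm]
  refine Finset.sum_congr rfl fun ω _ => ?_
  by_cases h : Y ω = b <;> simp [h]

end Law

/-! ### Entropy identities and inequalities on a finite sample space. -/

section Entropy

variable {Ω Ω' A A' B B' C C' : Type*} [Fintype Ω] [Fintype Ω'] [Fintype A] [Fintype A'] [Fintype B]
  [Fintype B'] [Fintype C] [Fintype C']

theorem entropy_eq_sum (P : Ω → ℝ) (X : Ω → A) :
    entropy P X = ∑ ω, P ω * -Real.log (law P X (X ω)) := by
  rw [← sum_law_mul P X fun a => -Real.log (law P X a)]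
  simp [entropy, Real.negMulLog]

/-- Entropy is the mean of -log of the mass of the fibre through ω, so only the partition induced on
the support matters. This allows conditioning variables to be reshuffled, or enlarged by almost
surely determined components. -/
theorem entropy_congr {P : Ω → ℝ} {X : Ω → A} {Y : Ω → B}
    (h : ∀ ω ω', P ω ≠ 0 → P ω' ≠ 0 → (X ω = X ω' ↔ Y ω = Y ω')) : entropy P X = entropy P Y := by
  rw [entropy_eq_sum, entropy_eq_sum]
  refine Finset.sum_congr rfl fun ω _ => ?_
  by_cases h0 : P ω = 0
  · simp [h0]
  · rw [law_eq_law_of_iff fun ω' h' => h ω' ω h' h0]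

theorem entropy_le_entropy {P : Ω → ℝ} (hP : ∀ ω, 0 ≤ P ω) {X : Ω → A} {Y : Ω → B}
    (h : ∀ ω ω', P ω ≠ 0 → P ω' ≠ 0 → Y ω = Y ω' → X ω = X ω') : entropy P X ≤ entropy P Y := by
  rw [entropy_eq_sum, entropy_eq_sum]
  refine Finset.sum_le_sum fun ω _ => ?_
  by_cases h0 : P ω = 0
  · simp [h0]
  · exact mul_le_mul_of_nonneg_left (neg_le_neg (Real.log_le_log (law_pos hP Y h0)
      (law_le_law_of_imp hP fun ω' h' => h ω' ω h' h0))) (hP ω)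

theorem entropy_law (P : Ω → ℝ) (φ : Ω → Ω') (X : Ω' → A) :
    entropy (law P φ) X = entropy P fun ω => X (φ ω) := by
  simp only [entropy, law_law]

theorem condEntropy_law (P : Ω → ℝ) (φ : Ω → Ω') (X : Ω' → A) (Z : Ω' → C) :
    condEntropy (law P φ) X Z = condEntropy P (fun ω => X (φ ω)) fun ω => Z (φ ω) := by
  simp only [condEntropy, entropy_law]

theorem condMutualInfo_law (P : Ω → ℝ) (φ : Ω → Ω') (X : Ω' → A) (Y : Ω' → B) (Z : Ω' → C) :
    condMutualInfo (law P φ) X Y Z =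
      condMutualInfo P (fun ω => X (φ ω)) (fun ω => Y (φ ω)) fun ω => Z (φ ω) := by
  simp only [condMutualInfo, condEntropy_law]

theorem condEntropy_congr {P : Ω → ℝ} {X : Ω → A} {X' : Ω → A'} {Z : Ω → C} {Z' : Ω → C'}
    (hX : ∀ ω ω', P ω ≠ 0 → P ω' ≠ 0 → ((X ω, Z ω) = (X ω', Z ω') ↔ (X' ω, Z' ω) = (X' ω', Z' ω')))
    (hZ : ∀ ω ω', P ω ≠ 0 → P ω' ≠ 0 → (Z ω = Z ω' ↔ Z' ω = Z' ω')) :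
    condEntropy P X Z = condEntropy P X' Z' := by
  rw [condEntropy, condEntropy, entropy_congr hX, entropy_congr hZ]

theorem condMutualInfo_eq (P : Ω → ℝ) (X : Ω → A) (Y : Ω → B) (Z : Ω → C) :
    condMutualInfo P X Y Z =
      condEntropy P Y Z - condEntropy P Y fun ω => (X ω, Z ω) := by
  have h : entropy P (fun ω => (X ω, Y ω, Z ω)) = entropy P fun ω => (Y ω, X ω, Z ω) :=
    entropy_congr fun ω ω' _ _ => by simp only [Prod.mk.injEq]; tauto
  simp only [condMutualInfo, condEntropy, h]
  ring

theorem mutualInfo_eq (P : Ω → ℝ) (X : Ω → A) (Y : Ω → B) :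
    mutualInfo P X Y = entropy P Y - condEntropy P Y X := by
  have h : entropy P (fun ω => (X ω, Y ω)) = entropy P fun ω => (Y ω, X ω) :=
    entropy_congr fun ω ω' _ _ => by simp only [Prod.mk.injEq]; tauto
  simp only [mutualInfo, condEntropy, h]
  ring

theorem condEntropy_eq_sum (P : Ω → ℝ) (X : Ω → A) (Z : Ω → C) :
    condEntropy P X Z =
      ∑ ω, P ω * (Real.log (law P Z (Z ω)) - Real.log (law P (fun ω => (X ω, Z ω)) (X ω, Z ω))) := by
  rw [condEntropy, entropy_eq_sum, entropy_eq_sum, ← Finset.sum_sub_distrib]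
  exact Finset.sum_congr rfl fun ω _ => by ring

theorem condEntropy_eq_of_law_eq_mul {P : Ω → ℝ} (hP : ∀ ω, 0 ≤ P ω) {X : Ω → A} {Z : Ω → C}
    {K : C → A → ℝ}
    (hK : ∀ x z, law P (fun ω => (X ω, Z ω)) (x, z) = law P Z z * K z x) :
    condEntropy P X Z = ∑ ω, P ω * -Real.log (K (Z ω) (X ω)) := by
  rw [condEntropy_eq_sum]
  refine Finset.sum_congr rfl fun ω _ => ?_
  by_cases h0 : P ω = 0
  · simp [h0]
  have h1 := law_pos hP Z h0
  have h2 := law_pos hP (fun ω => (X ω, Z ω)) h0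
  rw [hK] at h2 ⊢
  rw [Real.log_mul h1.ne' (pos_of_mul_pos_right h2 h1.le).ne']
  ring

theorem condEntropy_eq_sum_negMulLog {P : Ω → ℝ} (hP : ∀ ω, 0 ≤ P ω) {X : Ω → A} {Z : Ω → C}
    {K : C → A → ℝ}
    (hK : ∀ x z, law P (fun ω => (X ω, Z ω)) (x, z) = law P Z z * K z x) :
    condEntropy P X Z = ∑ ω, P ω * ∑ x, Real.negMulLog (K (Z ω) x) := by
  rw [condEntropy_eq_of_law_eq_mul hP hK,
    ← sum_law_mul P (fun ω => (X ω, Z ω)) fun xz => -Real.log (K xz.2 xz.1),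
    ← sum_law_mul P Z fun z => ∑ x, Real.negMulLog (K z x), Fintype.sum_prod_type_right]
  refine Finset.sum_congr rfl fun z _ => ?_
  simp only [hK, Finset.mul_sum]
  exact Finset.sum_congr rfl fun x _ => by rw [Real.negMulLog]; ring

/-- Gibbs' inequality. -/
theorem condEntropy_le_sum {P : Ω → ℝ} (hP : ∀ ω, 0 ≤ P ω) {X : Ω → A} {Z : Ω → C}
    {K : C → A → ℝ} (hK : ∀ z x, 0 ≤ K z x) (hK1 : ∀ z, ∑ x, K z x ≤ 1)
    (hpos : ∀ ω, P ω ≠ 0 → 0 < K (Z ω) (X ω)) :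
    condEntropy P X Z ≤ ∑ ω, P ω * -Real.log (K (Z ω) (X ω)) := by
  classical
  set L : A × C → ℝ := law P fun ω => (X ω, Z ω) with hL
  have hL0 : ∀ a, 0 ≤ L a := law_nonneg hP _
  -- This is log t ≤ t - 1 at t = P(z) K(z,x) / P(x,z), weighted by `P ω`. Off the support both
  -- sides vanish.
  have key : ∀ ω, P ω * (Real.log (law P Z (Z ω)) - Real.log (L (X ω, Z ω))) -
      P ω * -Real.log (K (Z ω) (X ω)) ≤
      P ω * (law P Z (Z ω) * K (Z ω) (X ω) * (L (X ω, Z ω))⁻¹ ) - P ω := by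
    intro ω
    by_cases h0 : P ω = 0
    · simp [h0]
    have h1 := law_pos hP Z h0
    have h2 : 0 < L (X ω, Z ω) := law_pos hP (fun ω => (X ω, Z ω)) h0
    have h3 := hpos ω h0
    have := Real.log_le_sub_one_of_pos (x := law P Z (Z ω) * K (Z ω) (X ω) * (L (X ω, Z ω))⁻¹)
      (by positivity)
    rw [Real.log_mul (by positivity) (by positivity), Real.log_mul (by positivity) (by positivity),
      Real.log_inv] at this
    nlinarith [mul_le_mul_of_nonneg_left this (hP ω)]
  have h1 := Finset.sum_le_sum fun ω (_ : ω ∈ Finset.univ) => key ω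
  rw [Finset.sum_sub_distrib, Finset.sum_sub_distrib, ← condEntropy_eq_sum] at h1
  have h2 : ∑ ω, P ω * (law P Z (Z ω) * K (Z ω) (X ω) * (L (X ω, Z ω))⁻¹) ≤ ∑ ω, P ω := by
    rw [← sum_law_mul P (fun ω => (X ω, Z ω)) fun xz => law P Z xz.2 * K xz.2 xz.1 * (L xz)⁻¹,
      ← sum_law P Z, Fintype.sum_prod_type_right]
    refine Finset.sum_le_sum fun z _ => ?_
    have hz := law_nonneg hP Z z
    calc ∑ x, L (x, z) * (law P Z z * K z x * (L (x, z))⁻¹)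
        ≤ ∑ x, law P Z z * K z x := by
          refine Finset.sum_le_sum fun x _ => ?_
          have := mul_nonneg hz (hK z x)
          rcases (hL0 (x, z)).eq_or_lt with h | h
          · simpa [← h] using this
          · rw [mul_comm, mul_assoc, inv_mul_cancel₀ h.ne', mul_one]
      _ ≤ law P Z z := by
          rw [← Finset.mul_sum]
          exact mul_le_of_le_one_right hz (hK1 z)
  linarith

/-- A version of the conditional pmf of `X` given `Z`. -/
def condLaw (P : Ω → ℝ) (X : Ω → A) (Z : Ω → C) (z : C) (x : A) : ℝ :=
  law P (fun ω => (X ω, Z ω)) (x, z) / law P Z z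

omit [Fintype A] [Fintype C] in
theorem condLaw_nonneg {P : Ω → ℝ} (hP : ∀ ω, 0 ≤ P ω) (X : Ω → A) (Z : Ω → C) (z : C) (x : A) :
    0 ≤ condLaw P X Z z x :=
  div_nonneg (law_nonneg hP _ _) (law_nonneg hP _ _)

omit [Fintype C] in
theorem sum_condLaw (P : Ω → ℝ) (X : Ω → A) (Z : Ω → C) (z : C) :
    ∑ x, condLaw P X Z z x = law P Z z / law P Z z := by
  simp only [condLaw]
  rw [← Finset.sum_div, law_prod_snd]

omit [Fintype A] [Fintype C] in
theorem law_eq_mul_condLaw {P : Ω → ℝ} (hP : ∀ ω, 0 ≤ P ω) (X : Ω → A) (Z : Ω → C) (x : A) (z : C) :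
    law P (fun ω => (X ω, Z ω)) (x, z) = law P Z z * condLaw P X Z z x := by
  rw [condLaw]
  by_cases h : law P Z z = 0
  · have := law_le_law_of_imp (X := fun ω => (X ω, Z ω)) (Y := Z) (a := (x, z)) (b := z) hP
      fun ω _ h => (Prod.mk.inj h).2
    rw [h, zero_mul]
    exact le_antisymm (h ▸ this) (law_nonneg hP _ _)
  · rw [mul_div_cancel₀ _ h]

omit [Fintype A] [Fintype C] in
theorem condLaw_pos {P : Ω → ℝ} (hP : ∀ ω, 0 ≤ P ω) (X : Ω → A) (Z : Ω → C) {ω : Ω} (h : P ω ≠ 0) :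
    0 < condLaw P X Z (Z ω) (X ω) :=
  div_pos (law_pos hP (fun ω => (X ω, Z ω)) h) (law_pos hP Z h)

omit [Fintype C] in
-- On null values of Z the division by zero makes the row vanish, so the rows are only
-- substochastic. Gibbs' inequality `condEntropy_le_sum` is stated for such kernels.
theorem sum_condLaw_le_one (P : Ω → ℝ) (X : Ω → A) (Z : Ω → C) (z : C) :
    ∑ x, condLaw P X Z z x ≤ 1 := by
  rw [sum_condLaw]
  exact div_self_le_one _

theorem condEntropy_eq_sum_condLaw {P : Ω → ℝ} (hP : ∀ ω, 0 ≤ P ω) (X : Ω → A) (Z : Ω → C) :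
    condEntropy P X Z = ∑ ω, P ω * -Real.log (condLaw P X Z (Z ω) (X ω)) :=
  condEntropy_eq_of_law_eq_mul hP (law_eq_mul_condLaw hP X Z)

/-- Conditioning reduces entropy. -/
theorem condEntropy_le_of_imp {P : Ω → ℝ} (hP : ∀ ω, 0 ≤ P ω) (X : Ω → A) (Z : Ω → C) (g : C → B) :
    condEntropy P X Z ≤ condEntropy P X fun ω => g (Z ω) := by
  rw [condEntropy_eq_sum_condLaw hP X fun ω => g (Z ω)]
  exact condEntropy_le_sum (K := fun z => condLaw P X (fun ω => g (Z ω)) (g z)) hP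
    (fun _ _ => condLaw_nonneg hP _ _ _ _) (fun _ => sum_condLaw_le_one _ _ _ _)
    fun ω h => condLaw_pos hP X (fun ω => g (Z ω)) h

theorem condEntropy_le_entropy {P : Ω → ℝ} (hP : P ∈ stdSimplex ℝ Ω) (X : Ω → A) (Z : Ω → C) :
    condEntropy P X Z ≤ entropy P X := by
  rw [entropy_eq_sum]
  exact condEntropy_le_sum (K := fun _ => law P X) hP.1 (fun _ _ => law_nonneg hP.1 _ _)
    (fun _ => ((sum_law P X).trans hP.2).le) fun ω h => law_pos hP.1 X h

end Entropy

/-! ### Sums of products over function spaces -/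

section Pi

variable {ι A B : Type*} [Fintype ι] [Fintype A] [Fintype B]

theorem sum_prod_eq_prod_sum [DecidableEq ι] (q : ι → A → ℝ) :
    ∑ c : ι → A, ∏ i, q i (c i) = ∏ i, ∑ x, q i x := by
  rw [Finset.prod_univ_sum, Fintype.piFinset_univ]

theorem sum_prod_eq_one {q : ι → A → ℝ} [DecidableEq ι] (hq : ∀ i, ∑ x, q i x = 1) :
    ∑ c : ι → A, ∏ i, q i (c i) = 1 := by
  rw [sum_prod_eq_prod_sum]
  simp [hq]

theorem sum_prod_mul_apply [DecidableEq ι] {q : ι → A → ℝ} (hq : ∀ i, ∑ x, q i x = 1) (i₀ : ι)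
    (g : A → ℝ) : ∑ c : ι → A, (∏ i, q i (c i)) * g (c i₀) = ∑ x, q i₀ x * g x := by
  have h : ∀ c : ι → A, (∏ i, q i (c i)) * g (c i₀) =
      ∏ i, (q i (c i) * if i = i₀ then g (c i) else 1) := fun c => by
    rw [Finset.prod_mul_distrib]
    congr 1
    rw [Fintype.prod_ite_eq']
  simp only [h]
  rw [sum_prod_eq_prod_sum (fun i x => q i x * if i = i₀ then g x else 1),
    Finset.prod_eq_single i₀ (fun i _ hi => by simp [hi, hq]) (by simp)]
  simp

/-- Distinct coordinates of a product pmf are independent. In random coding this makes the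
transmitted codeword independent of a competing one. -/
theorem sum_prod_mul_apply₂ [DecidableEq ι] {q : ι → A → ℝ} (hq : ∀ i, ∑ x, q i x = 1) {i₀ i₁ : ι}
    (hi : i₀ ≠ i₁) (g : A → A → ℝ) :
    ∑ c : ι → A, (∏ i, q i (c i)) * g (c i₀) (c i₁) =
      ∑ x, ∑ x', q i₀ x * q i₁ x' * g x x' := by
  classical
  -- Splitting according to the value x of the coordinate `i₀` turns a function of two coordinates
  -- into products of functions of one coordinate.
  have h : ∀ c : ι → A, (∏ i, q i (c i)) * g (c i₀) (c i₁) =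
      ∑ x, g x (c i₁) * ∏ i, (q i (c i) * if i = i₀ then (if c i = x then 1 else 0) else 1) :=
    fun c => by
      simp only [Finset.prod_mul_distrib, Fintype.prod_ite_eq']
      simp [mul_comm]
  simp only [h]
  rw [Finset.sum_comm]
  refine Finset.sum_congr rfl fun x _ => ?_
  have h2 : ∀ c : ι → A,
      g x (c i₁) * ∏ i, (q i (c i) * if i = i₀ then (if c i = x then 1 else 0) else 1) =
      ∏ i, (q i (c i) * (if i = i₀ then (if c i = x then 1 else 0) else 1) *
        if i = i₁ then g x (c i) else 1) := fun c => by
    rw [Finset.prod_mul_distrib (g := fun i => if i = i₁ then g x (c i) else 1), mul_comm]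
    congr 1
    rw [Fintype.prod_ite_eq']
  simp only [h2]
  rw [sum_prod_eq_prod_sum (fun i y => q i y * (if i = i₀ then (if y = x then 1 else 0) else 1) *
        if i = i₁ then g x y else 1), Finset.prod_eq_mul i₀ i₁ hi
        (fun i _ hi => by simp [hi.1, hi.2, hq]) (by simp) (by simp)]
  simp [hi, hi.symm, Finset.mul_sum, mul_assoc]

end Pi

/-! ### The single-letter region of a multiple access channel with common message -/

theorem sum_sum_sum_rotate {A B C : Type*} [Fintype A] [Fintype B] [Fintype C] (f : A → B → C → ℝ) :
    ∑ a, ∑ b, ∑ c, f a b c = ∑ c, ∑ a, ∑ b, f a b c := by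
  rw [Finset.sum_comm (s := (Finset.univ : Finset C))]
  exact Finset.sum_congr rfl fun a _ => Finset.sum_comm

theorem sum_sum_comm_sum_sum {A B C D : Type*} [Fintype A] [Fintype B] [Fintype C] [Fintype D]
    (f : A → B → C → D → ℝ) :
    ∑ a, ∑ b, ∑ c, ∑ d, f a b c d = ∑ c, ∑ d, ∑ a, ∑ b, f a b c d := by
  rw [sum_sum_sum_rotate]
  refine Finset.sum_congr rfl fun c _ => ?_
  rw [sum_sum_sum_rotate]

/-! ### Conditional entropies of laws given by a factorization. -/

section Conditional

variable {Ω A C D : Type*} [Fintype Ω] [Fintype A] [Fintype C] [Fintype D]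

/-- Here z is observed, d is hidden and x is the outcome: given z, the outcome follows the mixture
of `κ z d` with weights `μ z`. The equivalence `e` lets the coordinates of the sample space appear
in any order. -/
theorem condEntropy_eq_of_factor {P : Ω → ℝ} (e : C × D × A ≃ Ω) (ν : C → ℝ) (μ : C → D → ℝ)
    (κ : C → D → A → ℝ) (hν : ∀ z, 0 ≤ ν z) (hμ : ∀ z, μ z ∈ stdSimplex ℝ D)
    (hκ : ∀ z d, κ z d ∈ stdSimplex ℝ A)
    (hP : ∀ z d x, P (e (z, d, x)) = ν z * (μ z d * κ z d x)) :
    condEntropy P (fun ω => (e.symm ω).2.2) (fun ω => (e.symm ω).1) =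
      ∑ z, ν z * ∑ x, Real.negMulLog (∑ d, μ z d * κ z d x) := by
  classical
  have hP0 : ∀ ω, 0 ≤ P ω := fun ω => by
    obtain ⟨⟨z, d, x⟩, rfl⟩ := e.surjective ω
    rw [hP]
    exact mul_nonneg (hν z) (mul_nonneg ((hμ z).1 d) ((hκ z d).1 x))
  have h1 : ∀ z, law P (fun ω => (e.symm ω).1) z = ν z := fun z => by
    rw [law, ← e.sum_comp]
    simp [Fintype.sum_prod_type, hP, ← Finset.mul_sum, (hκ _ _).2, (hμ _).2]
  have h2 : ∀ x z, law P (fun ω => ((e.symm ω).2.2, (e.symm ω).1)) (x, z) =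
      law P (fun ω => (e.symm ω).1) z * ∑ d, μ z d * κ z d x := fun x z => by
    rw [h1, law, ← e.sum_comp]
    simp [Fintype.sum_prod_type, hP, ite_and, Finset.mul_sum]
  rw [condEntropy_eq_sum_negMulLog hP0 h2,
    ← sum_law_mul P (fun ω => (e.symm ω).1) fun z =>
      ∑ x, Real.negMulLog (∑ d, μ z d * κ z d x)]
  simp only [h1]

/-- The conditioning `ζ` may record any part of d that determines the channel row. Anything else it
records does not change the value. -/
theorem condEntropy_eq_of_channel {P : Ω → ℝ} (e : D × A ≃ Ω) (ν : D → ℝ) (ζ : D → C)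
    (K : C → A → ℝ) (hν : ∀ d, 0 ≤ ν d) (hK : ∀ z, K z ∈ stdSimplex ℝ A)
    (hP : ∀ d x, P (e (d, x)) = ν d * K (ζ d) x) :
    condEntropy P (fun ω => (e.symm ω).2) (fun ω => ζ (e.symm ω).1) =
      ∑ d, ν d * ∑ x, Real.negMulLog (K (ζ d) x) := by
  classical
  have hP0 : ∀ ω, 0 ≤ P ω := fun ω => by
    obtain ⟨⟨d, x⟩, rfl⟩ := e.surjective ω
    rw [hP]
    exact mul_nonneg (hν d) ((hK _).1 x)
  have h1 : ∀ z, law P (fun ω => ζ (e.symm ω).1) z = law ν ζ z := fun z => by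
    rw [law, ← e.sum_comp, law]
    simp only [Fintype.sum_prod_type, hP, Equiv.symm_apply_apply]
    refine Finset.sum_congr rfl fun d _ => ?_
    split_ifs
    · rw [← Finset.mul_sum, (hK _).2, mul_one]
    · simp
  have h2 : ∀ x z, law P (fun ω => ((e.symm ω).2, ζ (e.symm ω).1)) (x, z) =
      law P (fun ω => ζ (e.symm ω).1) z * K z x := fun x z => by
    rw [h1, law, ← e.sum_comp, law, Finset.sum_mul]
    simp only [Fintype.sum_prod_type, hP, Equiv.symm_apply_apply, Prod.mk.injEq, ite_and]
    refine Finset.sum_congr rfl fun d _ => ?_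
    by_cases h : ζ d = z
    · simp [h]
    · simp [h]
  rw [condEntropy_eq_sum_negMulLog hP0 h2,
    ← sum_law_mul P (fun ω => ζ (e.symm ω).1) fun z => ∑ x, Real.negMulLog (K z x)]
  simp only [h1]
  rw [sum_law_mul ν ζ fun z => ∑ x, Real.negMulLog (K z x)]

end Conditional

section Region

variable {X₁ X₂ Y : Type*} [Fintype X₁] [Fintype X₂] [Fintype Y]

/-- The law of the channel output for independent inputs. -/
def outputLaw (mac : X₁ → X₂ → Y → ℝ) (a : X₁ → ℝ) (b : X₂ → ℝ) (y : Y) : ℝ :=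
  ∑ x₁, ∑ x₂, a x₁ * b x₂ * mac x₁ x₂ y

/-- `H(Y|X₁X₂)` for independent inputs. -/
def noiseEntropy (mac : X₁ → X₂ → Y → ℝ) (a : X₁ → ℝ) (b : X₂ → ℝ) : ℝ :=
  ∑ x₁, ∑ x₂, a x₁ * b x₂ * ∑ y, Real.negMulLog (mac x₁ x₂ y)

/-- `I(X₁;Y|X₂)` for independent inputs. -/
def inputInfo₁ (mac : X₁ → X₂ → Y → ℝ) (a : X₁ → ℝ) (b : X₂ → ℝ) : ℝ :=
  (∑ x₂, b x₂ * ∑ y, Real.negMulLog (∑ x₁, a x₁ * mac x₁ x₂ y)) - noiseEntropy mac a b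

/-- `I(X₂;Y|X₁)` for independent inputs. -/
def inputInfo₂ (mac : X₁ → X₂ → Y → ℝ) (a : X₁ → ℝ) (b : X₂ → ℝ) : ℝ :=
  (∑ x₁, a x₁ * ∑ y, Real.negMulLog (∑ x₂, b x₂ * mac x₁ x₂ y)) - noiseEntropy mac a b

/-- `I(X₁X₂;Y)` for independent inputs. -/
def inputInfo₁₂ (mac : X₁ → X₂ → Y → ℝ) (a : X₁ → ℝ) (b : X₂ → ℝ) : ℝ :=
  (∑ y, Real.negMulLog (outputLaw mac a b y)) - noiseEntropy mac a b

/-- `I(X₁X₂;Y)` for inputs that are conditionally independent given an auxiliary variable of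
law `w`. -/
def mixedInfo {V : Type*} [Fintype V] (mac : X₁ → X₂ → Y → ℝ) (w : V → ℝ) (a : V → X₁ → ℝ)
    (b : V → X₂ → ℝ) : ℝ :=
  (∑ y, Real.negMulLog (∑ v, w v * outputLaw mac (a v) (b v) y)) -
    ∑ v, w v * noiseEntropy mac (a v) (b v)

/-- The rates `h₁`, `h₂`, `h₃`, `h₄` are supported by the auxiliary variable `w` and the inputs
`a`, `b`. -/
structure SupportsRates {V : Type*} [Fintype V] (mac : X₁ → X₂ → Y → ℝ) (w : V → ℝ)
    (a : V → X₁ → ℝ) (b : V → X₂ → ℝ) (h₁ h₂ h₃ h₄ : ℝ) : Prop where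
  mem : w ∈ stdSimplex ℝ V
  isCond₁ : IsCondPMF a
  isCond₂ : IsCondPMF b
  le₁ : h₁ ≤ ∑ v, w v * inputInfo₁ mac (a v) (b v)
  le₂ : h₂ ≤ ∑ v, w v * inputInfo₂ mac (a v) (b v)
  le₁₂ : h₃ ≤ ∑ v, w v * inputInfo₁₂ mac (a v) (b v)
  le_mixed : h₄ ≤ mixedInfo mac w a b

/-- The region of the multiple access channel with common message. -/
def IsSupported (mac : X₁ → X₂ → Y → ℝ) (h₁ h₂ h₃ h₄ : ℝ) : Prop :=
  ∃ (m : ℕ) (w : Fin m → ℝ) (a : Fin m → X₁ → ℝ) (b : Fin m → X₂ → ℝ),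
    SupportsRates mac w a b h₁ h₂ h₃ h₄

theorem SupportsRates.isSupported {V : Type*} [Fintype V] {mac : X₁ → X₂ → Y → ℝ} {w : V → ℝ}
    {a : V → X₁ → ℝ} {b : V → X₂ → ℝ} {h₁ h₂ h₃ h₄ : ℝ}
    (h : SupportsRates mac w a b h₁ h₂ h₃ h₄) : IsSupported mac h₁ h₂ h₃ h₄ := by
  let e := (Fintype.equivFin V).symm
  refine ⟨_, fun v => w (e v), fun v => a (e v), fun v => b (e v), ⟨fun v => h.mem.1 _, ?_⟩,
    fun v => h.isCond₁ _, fun v => h.isCond₂ _, ?_, ?_, ?_, ?_⟩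
  · rw [← h.mem.2]
    exact e.sum_comp w
  · rw [e.sum_comp fun v => w v * inputInfo₁ mac (a v) (b v)]
    exact h.le₁
  · rw [e.sum_comp fun v => w v * inputInfo₂ mac (a v) (b v)]
    exact h.le₂
  · rw [e.sum_comp fun v => w v * inputInfo₁₂ mac (a v) (b v)]
    exact h.le₁₂
  · have h4 := h.le_mixed
    rw [mixedInfo] at h4 ⊢
    rw [e.sum_comp fun v => w v * noiseEntropy mac (a v) (b v)]
    simpa only [fun y => e.sum_comp fun v => w v * outputLaw mac (a v) (b v) y] using h4

end Region

/-! ### Sources whose components are conditionally independent given the common part -/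

/-- The pmf `P` is that of a pair which is conditionally independent given the common part
`F₁ = F₂`, whose law is `π`. -/
structure IsCondIndepSource {S₀ S₁ S₂ : Type*} [Fintype S₀] [Fintype S₁] [Fintype S₂]
    (P : S₁ × S₂ → ℝ) (F₁ : S₁ → S₀) (F₂ : S₂ → S₀) (π : S₀ → ℝ) (κ₁ : S₀ → S₁ → ℝ)
    (κ₂ : S₀ → S₂ → ℝ) : Prop where
  mem : π ∈ stdSimplex ℝ S₀
  isCond₁ : IsCondPMF κ₁
  isCond₂ : IsCondPMF κ₂
  eq_sum : ∀ s₁ s₂, P (s₁, s₂) = ∑ s₀, π s₀ * (κ₁ s₀ s₁ * κ₂ s₀ s₂)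
  eq₁ : ∀ s₀ s₁, π s₀ ≠ 0 → κ₁ s₀ s₁ ≠ 0 → F₁ s₁ = s₀
  eq₂ : ∀ s₀ s₂, π s₀ ≠ 0 → κ₂ s₀ s₂ ≠ 0 → F₂ s₂ = s₀

section InnerLaw

variable {S₀ S₁ S₂ 𝓦 X₁ X₂ Y : Type*} [Fintype S₀] [Fintype S₁] [Fintype S₂] [Fintype 𝓦]
  [Fintype X₁] [Fintype X₂] [Fintype Y]

/-- The joint pmf of the common part and of the variables of the inner bound. -/
def commonLaw (mac : X₁ → X₂ → Y → ℝ) (π : S₀ → ℝ) (κ₁ : S₀ → S₁ → ℝ)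
    (κ₂ : S₀ → S₂ → ℝ) (pW : 𝓦 → ℝ) (pX₁ : S₁ × 𝓦 → X₁ → ℝ) (pX₂ : S₂ × 𝓦 → X₂ → ℝ) :
    S₀ × S₁ × S₂ × 𝓦 × X₁ × X₂ × Y → ℝ :=
  fun (s₀, s₁, s₂, w, x₁, x₂, y) =>
    π s₀ * κ₁ s₀ s₁ * κ₂ s₀ s₂ * pW w * pX₁ (s₁, w) x₁ * pX₂ (s₂, w) x₂ * mac x₁ x₂ y

/-- The law of the input given the common part and the auxiliary variable. -/
def inputLaw {X : Type*} {S : Type*} [Fintype S] (κ : S₀ → S → ℝ) (pX : S × 𝓦 → X → ℝ)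
    (v : S₀ × 𝓦) (x : X) : ℝ :=
  ∑ s, κ v.1 s * pX (s, v.2) x

omit [Fintype S₀] [Fintype 𝓦] in
theorem isCondPMF_inputLaw {X : Type*} [Fintype X] {S : Type*} [Fintype S] {κ : S₀ → S → ℝ}
    {pX : S × 𝓦 → X → ℝ} (hκ : IsCondPMF κ) (hX : IsCondPMF pX) : IsCondPMF (inputLaw κ pX) := by
  refine fun v => ⟨fun x => Finset.sum_nonneg fun s _ => mul_nonneg ((hκ _).1 s) ((hX _).1 x), ?_⟩
  simp only [inputLaw]
  rw [Finset.sum_comm]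
  simp [← Finset.mul_sum, (hX _).2, (hκ _).2]

variable {mac : X₁ → X₂ → Y → ℝ} {P : S₁ × S₂ → ℝ} {F₁ : S₁ → S₀} {F₂ : S₂ → S₀} {π : S₀ → ℝ}
  {κ₁ : S₀ → S₁ → ℝ} {κ₂ : S₀ → S₂ → ℝ} {pW : 𝓦 → ℝ} {pX₁ : S₁ × 𝓦 → X₁ → ℝ}
  {pX₂ : S₂ × 𝓦 → X₂ → ℝ}

/-- With S₀ as an explicit coordinate the law is a product of kernels; summing S₀ out returns the
inner law. -/
theorem law_commonLaw (hP : IsCondIndepSource P F₁ F₂ π κ₁ κ₂) :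
    law (commonLaw mac π κ₁ κ₂ pW pX₁ pX₂) (fun ω => ω.2) = innerLaw mac P pW pX₁ pX₂ := by
  classical
  ext ⟨s₁, s₂, w, x₁, x₂, y⟩
  rw [law, Fintype.sum_prod_type]
  simp only [innerLaw, hP.eq_sum, Finset.sum_mul]
  refine Finset.sum_congr rfl fun s₀ _ => ?_
  refine (Finset.sum_eq_single (s₁, s₂, w, x₁, x₂, y) (fun _ _ h => if_neg h) (by simp)).trans ?_
  rw [if_pos rfl, commonLaw]
  ring

omit [Fintype 𝓦] [Fintype X₁] [Fintype X₂] [Fintype Y] in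
-- On the support S₀ is a function of each source, hence it may be inserted into or removed from a
-- conditioning that contains S₁ or S₂.
theorem commonLaw_support (hP : IsCondIndepSource P F₁ F₂ π κ₁ κ₂)
    (ω : S₀ × S₁ × S₂ × 𝓦 × X₁ × X₂ × Y) (h : commonLaw mac π κ₁ κ₂ pW pX₁ pX₂ ω ≠ 0) :
    F₁ ω.2.1 = ω.1 ∧ F₂ ω.2.2.1 = ω.1 := by
  obtain ⟨s₀, s₁, s₂, w, x₁, x₂, y⟩ := ω
  simp only [commonLaw, ne_eq, mul_eq_zero, not_or] at h
  exact ⟨hP.eq₁ _ _ h.1.1.1.1.1.1 h.1.1.1.1.1.2, hP.eq₂ _ _ h.1.1.1.1.1.1 h.1.1.1.1.2⟩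

/-- Once both inputs are known, the output depends on nothing else, so further conditioning by `ζ`
is irrelevant. All four informations therefore share the same noise term. -/
theorem condEntropy_commonLaw_of_inputs {C : Type*} [Fintype C]
    (hmac : ∀ x₁ x₂, mac x₁ x₂ ∈ stdSimplex ℝ Y)
    (hP : IsCondIndepSource P F₁ F₂ π κ₁ κ₂) (hW : pW ∈ stdSimplex ℝ 𝓦) (hX₁ : IsCondPMF pX₁)
    (hX₂ : IsCondPMF pX₂) (ζ : S₀ × S₁ × S₂ × 𝓦 × X₁ × X₂ → C) :
    condEntropy (commonLaw mac π κ₁ κ₂ pW pX₁ pX₂) (fun ω => ω.2.2.2.2.2.2)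
      (fun ω => (ω.2.2.2.2.1, ω.2.2.2.2.2.1,
        ζ (ω.1, ω.2.1, ω.2.2.1, ω.2.2.2.1, ω.2.2.2.2.1, ω.2.2.2.2.2.1))) =
      ∑ v : S₀ × 𝓦, π v.1 * pW v.2 * noiseEntropy mac (inputLaw κ₁ pX₁ v) (inputLaw κ₂ pX₂ v) := by
  let e : (S₀ × S₁ × S₂ × 𝓦 × X₁ × X₂) × Y ≃ S₀ × S₁ × S₂ × 𝓦 × X₁ × X₂ × Y :=
    ⟨fun d => (d.1.1, d.1.2.1, d.1.2.2.1, d.1.2.2.2.1, d.1.2.2.2.2.1, d.1.2.2.2.2.2, d.2),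
      fun ω => ((ω.1, ω.2.1, ω.2.2.1, ω.2.2.2.1, ω.2.2.2.2.1, ω.2.2.2.2.2.1), ω.2.2.2.2.2.2),
      fun _ => rfl, fun _ => rfl⟩
  have h := condEntropy_eq_of_channel (P := commonLaw mac π κ₁ κ₂ pW pX₁ pX₂) (e := e)
    (ν := fun d => π d.1 * κ₁ d.1 d.2.1 * κ₂ d.1 d.2.2.1 * pW d.2.2.2.1 *
      pX₁ (d.2.1, d.2.2.2.1) d.2.2.2.2.1 * pX₂ (d.2.2.1, d.2.2.2.1) d.2.2.2.2.2)
    (ζ := fun d => (d.2.2.2.2.1, d.2.2.2.2.2, ζ d))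
    (K := fun z y => mac z.1 z.2.1 y)
    (fun d => by
      have h1 := hP.mem.1 d.1
      have h2 := (hP.isCond₁ d.1).1 d.2.1
      have h3 := (hP.isCond₂ d.1).1 d.2.2.1
      have h4 := hW.1 d.2.2.2.1
      have h5 := (hX₁ (d.2.1, d.2.2.2.1)).1 d.2.2.2.2.1
      have h6 := (hX₂ (d.2.2.1, d.2.2.2.1)).1 d.2.2.2.2.2
      positivity)
    (fun z => hmac _ _) (fun _ _ => rfl)
  refine h.trans ?_
  simp only [Fintype.sum_prod_type, noiseEntropy, inputLaw]
  refine Finset.sum_congr rfl fun s₀ _ => ?_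
  rw [sum_sum_sum_rotate]
  refine Finset.sum_congr rfl fun w _ => ?_
  rw [sum_sum_comm_sum_sum, Finset.mul_sum]
  refine Finset.sum_congr rfl fun x₁ _ => ?_
  rw [Finset.mul_sum]
  refine Finset.sum_congr rfl fun x₂ _ => ?_
  rw [Finset.sum_mul_sum, Finset.sum_mul, Finset.mul_sum]
  refine Finset.sum_congr rfl fun s₁ _ => ?_
  rw [Finset.sum_mul, Finset.mul_sum]
  exact Finset.sum_congr rfl fun s₂ _ => by ring

/-- Given (S₀, W), the input X₁ is independent of (S₂, X₂). Observing S₂ therefore leaves `inputLaw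
κ₁ pX₁` as the law of X₁, and averaging over S₂ turns the weights into those of X₂. -/
theorem condEntropy_commonLaw₁ (hmac : ∀ x₁ x₂, mac x₁ x₂ ∈ stdSimplex ℝ Y)
    (hP : IsCondIndepSource P F₁ F₂ π κ₁ κ₂) (hW : pW ∈ stdSimplex ℝ 𝓦) (hX₁ : IsCondPMF pX₁)
    (hX₂ : IsCondPMF pX₂) :
    condEntropy (commonLaw mac π κ₁ κ₂ pW pX₁ pX₂) (fun ω => ω.2.2.2.2.2.2)
      (fun ω => (ω.2.2.2.2.2.1, ω.2.2.1, ω.2.2.2.1, ω.1)) =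
      ∑ v : S₀ × 𝓦, π v.1 * pW v.2 * ∑ x₂, inputLaw κ₂ pX₂ v x₂ *
        ∑ y, Real.negMulLog (∑ x₁, inputLaw κ₁ pX₁ v x₁ * mac x₁ x₂ y) := by
  let e : (X₂ × S₂ × 𝓦 × S₀) × (S₁ × X₁) × Y ≃ S₀ × S₁ × S₂ × 𝓦 × X₁ × X₂ × Y :=
    ⟨fun d => (d.1.2.2.2, d.2.1.1, d.1.2.1, d.1.2.2.1, d.2.1.2, d.1.1, d.2.2),
      fun ω => ((ω.2.2.2.2.2.1, ω.2.2.1, ω.2.2.2.1, ω.1), (ω.2.1, ω.2.2.2.2.1), ω.2.2.2.2.2.2),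
      fun _ => rfl, fun _ => rfl⟩
  refine (condEntropy_eq_of_factor (P := commonLaw mac π κ₁ κ₂ pW pX₁ pX₂) (e := e)
    (ν := fun z => π z.2.2.2 * κ₂ z.2.2.2 z.2.1 * pW z.2.2.1 * pX₂ (z.2.1, z.2.2.1) z.1)
    (μ := fun z d => κ₁ z.2.2.2 d.1 * pX₁ (d.1, z.2.2.1) d.2)
    (κ := fun z d y => mac d.2 z.1 y)
    (fun z => mul_nonneg (mul_nonneg (mul_nonneg (hP.mem.1 _) ((hP.isCond₂ _).1 _)) (hW.1 _))
      ((hX₂ _).1 _))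
    (fun z => ⟨fun d => mul_nonneg ((hP.isCond₁ _).1 _) ((hX₁ _).1 _), by
      simp [Fintype.sum_prod_type, ← Finset.mul_sum, (hX₁ _).2, (hP.isCond₁ _).2]⟩)
    (fun z d => hmac _ _) (fun z d y => by
      change π z.2.2.2 * κ₁ z.2.2.2 d.1 * κ₂ z.2.2.2 z.2.1 * pW z.2.2.1 * pX₁ (d.1, z.2.2.1) d.2 *
        pX₂ (z.2.1, z.2.2.1) z.1 * mac d.2 z.1 y = _
      ring)).trans ?_
  have h : ∀ (z : X₂ × S₂ × 𝓦 × S₀) (y : Y),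
      ∑ d : S₁ × X₁, κ₁ z.2.2.2 d.1 * pX₁ (d.1, z.2.2.1) d.2 * mac d.2 z.1 y =
      ∑ x₁, inputLaw κ₁ pX₁ (z.2.2.2, z.2.2.1) x₁ * mac x₁ z.1 y := fun z y => by
    rw [Fintype.sum_prod_type_right]
    simp only [inputLaw, Finset.sum_mul]
  simp only [h]
  simp only [Fintype.sum_prod_type]
  rw [sum_sum_comm_sum_sum, Finset.sum_comm]
  refine Finset.sum_congr rfl fun s₀ _ => Finset.sum_congr rfl fun w _ => ?_
  rw [Finset.mul_sum]
  refine Finset.sum_congr rfl fun x₂ _ => ?_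
  rw [← Finset.sum_mul, ← mul_assoc]
  congr 1
  rw [inputLaw, Finset.mul_sum]
  exact Finset.sum_congr rfl fun s₂ _ => by ring

theorem condEntropy_commonLaw₂ (hmac : ∀ x₁ x₂, mac x₁ x₂ ∈ stdSimplex ℝ Y)
    (hP : IsCondIndepSource P F₁ F₂ π κ₁ κ₂) (hW : pW ∈ stdSimplex ℝ 𝓦) (hX₁ : IsCondPMF pX₁)
    (hX₂ : IsCondPMF pX₂) :
    condEntropy (commonLaw mac π κ₁ κ₂ pW pX₁ pX₂) (fun ω => ω.2.2.2.2.2.2)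
      (fun ω => (ω.2.2.2.2.1, ω.2.1, ω.2.2.2.1, ω.1)) =
      ∑ v : S₀ × 𝓦, π v.1 * pW v.2 * ∑ x₁, inputLaw κ₁ pX₁ v x₁ *
        ∑ y, Real.negMulLog (∑ x₂, inputLaw κ₂ pX₂ v x₂ * mac x₁ x₂ y) := by
  let e : (X₁ × S₁ × 𝓦 × S₀) × (S₂ × X₂) × Y ≃ S₀ × S₁ × S₂ × 𝓦 × X₁ × X₂ × Y :=
    ⟨fun d => (d.1.2.2.2, d.1.2.1, d.2.1.1, d.1.2.2.1, d.1.1, d.2.1.2, d.2.2),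
      fun ω => ((ω.2.2.2.2.1, ω.2.1, ω.2.2.2.1, ω.1), (ω.2.2.1, ω.2.2.2.2.2.1), ω.2.2.2.2.2.2),
      fun _ => rfl, fun _ => rfl⟩
  refine (condEntropy_eq_of_factor (P := commonLaw mac π κ₁ κ₂ pW pX₁ pX₂) (e := e)
    (ν := fun z => π z.2.2.2 * κ₁ z.2.2.2 z.2.1 * pW z.2.2.1 * pX₁ (z.2.1, z.2.2.1) z.1)
    (μ := fun z d => κ₂ z.2.2.2 d.1 * pX₂ (d.1, z.2.2.1) d.2)
    (κ := fun z d y => mac z.1 d.2 y)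
    (fun z => mul_nonneg (mul_nonneg (mul_nonneg (hP.mem.1 _) ((hP.isCond₁ _).1 _)) (hW.1 _))
      ((hX₁ _).1 _))
    (fun z => ⟨fun d => mul_nonneg ((hP.isCond₂ _).1 _) ((hX₂ _).1 _), by
      simp [Fintype.sum_prod_type, ← Finset.mul_sum, (hX₂ _).2, (hP.isCond₂ _).2]⟩)
    (fun z d => hmac _ _) (fun z d y => by
      change π z.2.2.2 * κ₁ z.2.2.2 z.2.1 * κ₂ z.2.2.2 d.1 * pW z.2.2.1 *
        pX₁ (z.2.1, z.2.2.1) z.1 * pX₂ (d.1, z.2.2.1) d.2 * mac z.1 d.2 y = _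
      ring)).trans ?_
  have h : ∀ (z : X₁ × S₁ × 𝓦 × S₀) (y : Y),
      ∑ d : S₂ × X₂, κ₂ z.2.2.2 d.1 * pX₂ (d.1, z.2.2.1) d.2 * mac z.1 d.2 y =
      ∑ x₂, inputLaw κ₂ pX₂ (z.2.2.2, z.2.2.1) x₂ * mac z.1 x₂ y := fun z y => by
    rw [Fintype.sum_prod_type_right]
    simp only [inputLaw, Finset.sum_mul]
  simp only [h]
  simp only [Fintype.sum_prod_type]
  rw [sum_sum_comm_sum_sum, Finset.sum_comm]
  refine Finset.sum_congr rfl fun s₀ _ => Finset.sum_congr rfl fun w _ => ?_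
  rw [Finset.mul_sum]
  refine Finset.sum_congr rfl fun x₁ _ => ?_
  rw [← Finset.sum_mul, ← mul_assoc]
  congr 1
  rw [inputLaw, Finset.mul_sum]
  exact Finset.sum_congr rfl fun s₁ _ => by ring

theorem condEntropy_commonLaw₀ (hmac : ∀ x₁ x₂, mac x₁ x₂ ∈ stdSimplex ℝ Y)
    (hP : IsCondIndepSource P F₁ F₂ π κ₁ κ₂) (hW : pW ∈ stdSimplex ℝ 𝓦) (hX₁ : IsCondPMF pX₁)
    (hX₂ : IsCondPMF pX₂) :
    condEntropy (commonLaw mac π κ₁ κ₂ pW pX₁ pX₂) (fun ω => ω.2.2.2.2.2.2)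
      (fun ω => (ω.1, ω.2.2.2.1)) =
      ∑ v : S₀ × 𝓦, π v.1 * pW v.2 *
        ∑ y, Real.negMulLog (outputLaw mac (inputLaw κ₁ pX₁ v) (inputLaw κ₂ pX₂ v) y) := by
  let e : (S₀ × 𝓦) × (S₁ × S₂ × X₁ × X₂) × Y ≃ S₀ × S₁ × S₂ × 𝓦 × X₁ × X₂ × Y :=
    ⟨fun d => (d.1.1, d.2.1.1, d.2.1.2.1, d.1.2, d.2.1.2.2.1, d.2.1.2.2.2, d.2.2),
      fun ω => ((ω.1, ω.2.2.2.1), (ω.2.1, ω.2.2.1, ω.2.2.2.2.1, ω.2.2.2.2.2.1), ω.2.2.2.2.2.2),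
      fun _ => rfl, fun _ => rfl⟩
  have h : ∀ (z : S₀ × 𝓦) (g : X₁ → X₂ → ℝ),
      ∑ d : S₁ × S₂ × X₁ × X₂, κ₁ z.1 d.1 * κ₂ z.1 d.2.1 * pX₁ (d.1, z.2) d.2.2.1 *
        pX₂ (d.2.1, z.2) d.2.2.2 * g d.2.2.1 d.2.2.2 =
      ∑ x₁, ∑ x₂, inputLaw κ₁ pX₁ z x₁ * inputLaw κ₂ pX₂ z x₂ * g x₁ x₂ := fun z g => by
    simp only [Fintype.sum_prod_type]
    rw [sum_sum_comm_sum_sum]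
    refine Finset.sum_congr rfl fun x₁ _ => Finset.sum_congr rfl fun x₂ _ => ?_
    rw [inputLaw, inputLaw, Finset.sum_mul_sum, Finset.sum_mul]
    refine Finset.sum_congr rfl fun s₁ _ => ?_
    rw [Finset.sum_mul]
    exact Finset.sum_congr rfl fun s₂ _ => by ring
  refine (condEntropy_eq_of_factor (P := commonLaw mac π κ₁ κ₂ pW pX₁ pX₂) (e := e)
    (ν := fun z => π z.1 * pW z.2)
    (μ := fun z d => κ₁ z.1 d.1 * κ₂ z.1 d.2.1 * pX₁ (d.1, z.2) d.2.2.1 *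
        pX₂ (d.2.1, z.2) d.2.2.2)
    (κ := fun z d y => mac d.2.2.1 d.2.2.2 y)
    (fun z => mul_nonneg (hP.mem.1 _) (hW.1 _))
    (fun z => ⟨fun d => mul_nonneg (mul_nonneg (mul_nonneg ((hP.isCond₁ _).1 _)
      ((hP.isCond₂ _).1 _)) ((hX₁ _).1 _)) ((hX₂ _).1 _), by
        have := h z fun _ _ => 1
        simp only [mul_one] at this
        rw [this]
        simp [← Finset.mul_sum, (isCondPMF_inputLaw hP.isCond₁ hX₁ z).2,
          (isCondPMF_inputLaw hP.isCond₂ hX₂ z).2]⟩)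
    (fun z d => hmac _ _) (fun z d y => by
      change π z.1 * κ₁ z.1 d.1 * κ₂ z.1 d.2.1 * pW z.2 *
        pX₁ (d.1, z.2) d.2.2.1 * pX₂ (d.2.1, z.2) d.2.2.2 * mac d.2.2.1 d.2.2.2 y = _
      ring)).trans ?_
  refine Finset.sum_congr rfl fun z _ => ?_
  congr 1
  refine Finset.sum_congr rfl fun y _ => ?_
  rw [h z fun x₁ x₂ => mac x₁ x₂ y, outputLaw]

theorem law_commonLaw_output :
    law (commonLaw mac π κ₁ κ₂ pW pX₁ pX₂) (fun ω => ω.2.2.2.2.2.2) = fun y =>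
      ∑ v : S₀ × 𝓦, π v.1 * pW v.2 * outputLaw mac (inputLaw κ₁ pX₁ v) (inputLaw κ₂ pX₂ v) y := by
  classical
  ext y
  simp only [law, Fintype.sum_prod_type, commonLaw, outputLaw, inputLaw]
  refine Finset.sum_congr rfl fun s₀ _ => ?_
  rw [sum_sum_sum_rotate]
  refine Finset.sum_congr rfl fun w _ => ?_
  rw [sum_sum_comm_sum_sum, Finset.mul_sum]
  refine Finset.sum_congr rfl fun x₁ _ => ?_
  rw [Finset.mul_sum]
  refine Finset.sum_congr rfl fun x₂ _ => ?_
  rw [Finset.sum_mul_sum, Finset.sum_mul, Finset.mul_sum]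
  refine Finset.sum_congr rfl fun s₁ _ => ?_
  rw [Finset.sum_mul, Finset.mul_sum]
  refine Finset.sum_congr rfl fun s₂ _ => ?_
  rw [Finset.sum_ite_eq' Finset.univ y]
  simp
  ring

end InnerLaw
end
end MacSource

namespace MacSource

noncomputable section

/-! ### The four informations of the inner bound in terms of the auxiliary variable (S₀, W). -/

section InnerLaw

variable {S₀ S₁ S₂ 𝓦 X₁ X₂ Y : Type*} [Fintype S₀] [Fintype S₁] [Fintype S₂] [Fintype 𝓦]
  [Fintype X₁] [Fintype X₂] [Fintype Y]
  {mac : X₁ → X₂ → Y → ℝ} {P : S₁ × S₂ → ℝ} {F₁ : S₁ → S₀} {F₂ : S₂ → S₀} {π : S₀ → ℝ}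
  {κ₁ : S₀ → S₁ → ℝ} {κ₂ : S₀ → S₂ → ℝ} {pW : 𝓦 → ℝ} {pX₁ : S₁ × 𝓦 → X₁ → ℝ}
  {pX₂ : S₂ × 𝓦 → X₂ → ℝ}

theorem condMutualInfo_innerLaw₁ (hmac : ∀ x₁ x₂, mac x₁ x₂ ∈ stdSimplex ℝ Y)
    (hP : IsCondIndepSource P F₁ F₂ π κ₁ κ₂) (hW : pW ∈ stdSimplex ℝ 𝓦) (hX₁ : IsCondPMF pX₁)
    (hX₂ : IsCondPMF pX₂) :
    condMutualInfo (innerLaw mac P pW pX₁ pX₂) (fun (_, _, _, x₁, _, _) => x₁)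
      (fun (_, _, _, _, _, y) => y) (fun (_, s₂, w, _, x₂, _) => (x₂, s₂, w)) =
      ∑ v : S₀ × 𝓦, π v.1 * pW v.2 *
        inputInfo₁ mac (inputLaw κ₁ pX₁ v) (inputLaw κ₂ pX₂ v) := by
  rw [← law_commonLaw hP, condMutualInfo_law, condMutualInfo_eq]
  simp only [inputInfo₁, mul_sub, Finset.sum_sub_distrib]
  rw [← condEntropy_commonLaw₁ hmac hP hW hX₁ hX₂,
    ← condEntropy_commonLaw_of_inputs hmac hP hW hX₁ hX₂ fun d => (d.2.2.1, d.2.2.2.1)]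
  have hs := commonLaw_support (mac := mac) (pW := pW) (pX₁ := pX₁) (pX₂ := pX₂) hP
  congr 1
  refine condEntropy_congr (fun ω ω' h h' => ?_) fun ω ω' h h' => ?_ <;>
  · have h1 := (hs ω h).2
    have h2 := (hs ω' h').2
    simp only [Prod.mk.injEq]
    grind

theorem condMutualInfo_innerLaw₂ (hmac : ∀ x₁ x₂, mac x₁ x₂ ∈ stdSimplex ℝ Y)
    (hP : IsCondIndepSource P F₁ F₂ π κ₁ κ₂) (hW : pW ∈ stdSimplex ℝ 𝓦) (hX₁ : IsCondPMF pX₁)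
    (hX₂ : IsCondPMF pX₂) :
    condMutualInfo (innerLaw mac P pW pX₁ pX₂) (fun (_, _, _, _, x₂, _) => x₂)
      (fun (_, _, _, _, _, y) => y) (fun (s₁, _, w, x₁, _, _) => (x₁, s₁, w)) =
      ∑ v : S₀ × 𝓦, π v.1 * pW v.2 *
        inputInfo₂ mac (inputLaw κ₁ pX₁ v) (inputLaw κ₂ pX₂ v) := by
  rw [← law_commonLaw hP, condMutualInfo_law, condMutualInfo_eq]
  simp only [inputInfo₂, mul_sub, Finset.sum_sub_distrib]
  rw [← condEntropy_commonLaw₂ hmac hP hW hX₁ hX₂,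
    ← condEntropy_commonLaw_of_inputs hmac hP hW hX₁ hX₂ fun d => (d.2.1, d.2.2.2.1)]
  have hs := commonLaw_support (mac := mac) (pW := pW) (pX₁ := pX₁) (pX₂ := pX₂) hP
  congr 1 <;>
  refine condEntropy_congr (fun ω ω' h h' => ?_) fun ω ω' h h' => ?_ <;>
  · have h1 := (hs ω h).1
    have h2 := (hs ω' h').1
    simp only [Prod.mk.injEq]
    grind

theorem condMutualInfo_innerLaw₁₂ (hmac : ∀ x₁ x₂, mac x₁ x₂ ∈ stdSimplex ℝ Y)
    (hP : IsCondIndepSource P F₁ F₂ π κ₁ κ₂) (hW : pW ∈ stdSimplex ℝ 𝓦) (hX₁ : IsCondPMF pX₁)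
    (hX₂ : IsCondPMF pX₂) :
    condMutualInfo (innerLaw mac P pW pX₁ pX₂) (fun (_, _, _, x₁, x₂, _) => (x₁, x₂))
      (fun (_, _, _, _, _, y) => y) (fun (s₁, _, w, _, _, _) => (F₁ s₁, w)) =
      ∑ v : S₀ × 𝓦, π v.1 * pW v.2 *
        inputInfo₁₂ mac (inputLaw κ₁ pX₁ v) (inputLaw κ₂ pX₂ v) := by
  rw [← law_commonLaw hP, condMutualInfo_law, condMutualInfo_eq]
  simp only [inputInfo₁₂, mul_sub, Finset.sum_sub_distrib]
  rw [← condEntropy_commonLaw₀ hmac hP hW hX₁ hX₂,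
    ← condEntropy_commonLaw_of_inputs hmac hP hW hX₁ hX₂ fun d => (F₁ d.2.1, d.2.2.2.1)]
  have hs := commonLaw_support (mac := mac) (pW := pW) (pX₁ := pX₁) (pX₂ := pX₂) hP
  congr 1 <;>
  refine condEntropy_congr (fun ω ω' h h' => ?_) fun ω ω' h h' => ?_ <;>
  · have h1 := (hs ω h).1
    have h2 := (hs ω' h').1
    simp only [Prod.mk.injEq]
    grind

theorem mutualInfo_innerLaw (hmac : ∀ x₁ x₂, mac x₁ x₂ ∈ stdSimplex ℝ Y)
    (hP : IsCondIndepSource P F₁ F₂ π κ₁ κ₂) (hW : pW ∈ stdSimplex ℝ 𝓦) (hX₁ : IsCondPMF pX₁)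
    (hX₂ : IsCondPMF pX₂) :
    mutualInfo (innerLaw mac P pW pX₁ pX₂) (fun (_, _, _, x₁, x₂, _) => (x₁, x₂))
      (fun (_, _, _, _, _, y) => y) =
      mixedInfo mac (fun v : S₀ × 𝓦 => π v.1 * pW v.2) (inputLaw κ₁ pX₁) (inputLaw κ₂ pX₂) := by
  rw [← law_commonLaw hP, mutualInfo_eq, entropy_law, condEntropy_law, mixedInfo]
  congr 1
  · have := law_commonLaw_output (mac := mac) (π := π) (κ₁ := κ₁) (κ₂ := κ₂) (pW := pW)
      (pX₁ := pX₁) (pX₂ := pX₂)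
    exact Finset.sum_congr rfl fun y _ => congrArg _ (congrFun this y)
  · rw [← condEntropy_commonLaw_of_inputs hmac hP hW hX₁ hX₂ fun _ => ()]
    exact condEntropy_congr (fun ω ω' _ _ => by simp) fun ω ω' _ _ => by simp

theorem innerLaw_mem (hmac : ∀ x₁ x₂, mac x₁ x₂ ∈ stdSimplex ℝ Y) (hP : P ∈ stdSimplex ℝ (S₁ × S₂))
    (hW : pW ∈ stdSimplex ℝ 𝓦) (hX₁ : IsCondPMF pX₁) (hX₂ : IsCondPMF pX₂) :
    innerLaw mac P pW pX₁ pX₂ ∈ stdSimplex ℝ (InnerSpace S₁ S₂ 𝓦 X₁ X₂ Y) := by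
  constructor
  · rintro ⟨s₁, s₂, w, x₁, x₂, y⟩
    exact mul_nonneg (mul_nonneg (mul_nonneg (mul_nonneg (hP.1 _) (hW.1 _)) ((hX₁ _).1 _))
      ((hX₂ _).1 _)) ((hmac _ _).1 _)
  · have := hP.2
    rw [Fintype.sum_prod_type] at this
    simp only [Fintype.sum_prod_type, innerLaw, ← Finset.mul_sum, (hmac _ _).2, (hX₁ _).2,
      (hX₂ _).2, hW.2, mul_one, this]

/-- Conditioning on W lowers the output entropy and leaves the noise term unchanged, because W acts
on Y only through the inputs. The outer bound conditions its sum rate on Q, whereas the region does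
not; this bridges the two. -/
theorem condMutualInfo_innerLaw_le_mutualInfo (hmac : ∀ x₁ x₂, mac x₁ x₂ ∈ stdSimplex ℝ Y)
    (hPm : P ∈ stdSimplex ℝ (S₁ × S₂))
    (hP : IsCondIndepSource P F₁ F₂ π κ₁ κ₂) (hW : pW ∈ stdSimplex ℝ 𝓦) (hX₁ : IsCondPMF pX₁)
    (hX₂ : IsCondPMF pX₂) :
    condMutualInfo (innerLaw mac P pW pX₁ pX₂) (fun (_, _, _, x₁, x₂, _) => (x₁, x₂))
      (fun (_, _, _, _, _, y) => y) (fun (_, _, w, _, _, _) => w) ≤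
    mutualInfo (innerLaw mac P pW pX₁ pX₂) (fun (_, _, _, x₁, x₂, _) => (x₁, x₂))
      (fun (_, _, _, _, _, y) => y) := by
  rw [condMutualInfo_eq, mutualInfo_eq]
  have h1 := condEntropy_le_entropy (innerLaw_mem hmac hPm hW hX₁ hX₂)
    (fun (_, _, _, _, _, y) => y) (fun (_, _, w, _, _, _) => w)
  refine sub_le_sub h1 (le_of_eq ?_)
  rw [← law_commonLaw hP, condEntropy_law, condEntropy_law]
  have e1 := condEntropy_commonLaw_of_inputs hmac hP hW hX₁ hX₂ fun _ => ()
  have e2 := condEntropy_commonLaw_of_inputs hmac hP hW hX₁ hX₂ fun d => d.2.2.2.1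
  rw [← e2] at e1
  refine Eq.trans ?_ (e1.trans ?_) <;>
  exact condEntropy_congr (fun ω ω' _ _ => by simp [and_assoc]) fun ω ω' _ _ => by simp [and_assoc]

end InnerLaw

/-! ### Conditionally independent sources from the Markov condition -/

section Source

variable {S₀ S₁ S₂ : Type*} [Fintype S₀] [Fintype S₁] [Fintype S₂]

theorem law_id {Ω : Type*} [Fintype Ω] (P : Ω → ℝ) : law P (fun ω => ω) = P := by
  classical
  ext a
  exact (Finset.sum_eq_single a (fun _ _ h => if_neg h) (by simp)).trans (if_pos rfl)

open Classical in
-- On null values of Z the marginal of X is used as a default, so that every row is a genuine pmf.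
theorem isCondPMF_ite_condLaw {Ω A C : Type*} [Fintype Ω] [Fintype A] {P : Ω → ℝ}
    (hP : P ∈ stdSimplex ℝ Ω) (X : Ω → A) (Z : Ω → C) :
    IsCondPMF fun z x => if law P Z z = 0 then law P X x else condLaw P X Z z x := by
  intro z
  by_cases h : law P Z z = 0
  · simp only [h, if_true]
    exact law_mem_stdSimplex hP X
  · simp only [h, if_false]
    exact ⟨fun _ => condLaw_nonneg hP.1 _ _ _ _, by rw [sum_condLaw, div_self h]⟩

theorem exists_isCondIndepSource {p : S₁ × S₂ → ℝ} (hp : p ∈ stdSimplex ℝ (S₁ × S₂))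
    {f₁ : S₁ → S₀} {f₂ : S₂ → S₀} (hS₀ : IsCommonPart p f₁ f₂)
    (hM : IsMarkov p (fun (s₁, _) => s₁) (fun (s₁, _) => f₁ s₁) (fun (_, s₂) => s₂)) :
    ∃ π κ₁ κ₂, IsCondIndepSource p f₁ f₂ π κ₁ κ₂ := by
  classical
  let T₀ : S₁ × S₂ → S₀ := fun s => f₁ s.1
  have hM' : ∀ s₁ s₀ s₂, law p (fun s => (s.1, T₀ s, s.2)) (s₁, s₀, s₂) * law p T₀ s₀ =
      law p (fun s => (s.1, T₀ s)) (s₁, s₀) * law p (fun s => (s.2, T₀ s)) (s₂, s₀) := by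
    intro s₁ s₀ s₂
    refine (hM s₁ s₀ s₂).trans ?_
    congr 1
    exact law_eq_law_of_iff fun ω _ => by simp [T₀, and_comm]
  refine ⟨law p T₀, _, _, law_mem_stdSimplex hp _, isCondPMF_ite_condLaw hp Prod.fst T₀,
    isCondPMF_ite_condLaw hp Prod.snd T₀, ?_, ?_, ?_⟩
  · intro s₁ s₂
    -- The Markov identity divided by P(S₀ = s₀) gives the joint law of (S₁, S₂, S₀). For a null s₀
    -- both sides are zero, whatever the default rows are.
    have h1 : ∀ s₀, law p T₀ s₀ *
        ((if law p T₀ s₀ = 0 then law p Prod.fst s₁ else condLaw p Prod.fst T₀ s₀ s₁) *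
          if law p T₀ s₀ = 0 then law p Prod.snd s₂ else condLaw p Prod.snd T₀ s₀ s₂) =
        law p (fun s => (s, T₀ s)) ((s₁, s₂), s₀) := by
      intro s₀
      have h2 : law p (fun s => (s, T₀ s)) ((s₁, s₂), s₀) =
          law p (fun s => (s.1, T₀ s, s.2)) (s₁, s₀, s₂) :=
        law_eq_law_of_iff fun ω _ => by
          simp only [Prod.ext_iff]
          tauto
      by_cases h : law p T₀ s₀ = 0
      · have := law_le_law_of_imp (X := fun s => (s, T₀ s)) (Y := T₀) (a := ((s₁, s₂), s₀))
          (b := s₀) hp.1 fun ω _ h => (Prod.mk.inj h).2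
        rw [h, zero_mul]
        exact le_antisymm (law_nonneg hp.1 _ _) (h ▸ this)
      · rw [if_neg h, if_neg h, h2, condLaw, condLaw]
        have := hM' s₁ s₀ s₂
        field_simp
        linarith
    simp only [h1]
    rw [law_prod_fst]
    exact (congrFun (law_id p) _).symm
  · intro s₀ s₁ h0 h1
    rw [if_neg h0] at h1
    obtain ⟨ω, h2, -⟩ := exists_of_law_ne_zero (div_ne_zero_iff.1 h1).1
    obtain ⟨rfl, rfl⟩ := Prod.mk.inj h2
    rfl
  · intro s₀ s₂ h0 h1
    rw [if_neg h0] at h1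
    obtain ⟨ω, h2, h3⟩ := exists_of_law_ne_zero (div_ne_zero_iff.1 h1).1
    obtain ⟨rfl, rfl⟩ := Prod.mk.inj h2
    exact (hS₀ ω.1 ω.2 h3).symm

/-- The pmf of a block of independent copies of the source `p`. -/
def blockSource {S₁ S₂ : Type*} (p : S₁ × S₂ → ℝ) (ι : Type*) [Fintype ι] :
    (ι → S₁) × (ι → S₂) → ℝ :=
  fun s => ∏ i, p (s.1 i, s.2 i)

theorem sum_blockSource_mul {ι : Type*} [Fintype ι] [DecidableEq ι] (p : S₁ × S₂ → ℝ)
    (g : (ι → S₁) × (ι → S₂) → ℝ) :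
    ∑ s, blockSource p ι s * g s =
      ∑ s : ι → S₁ × S₂, (∏ i, p (s i)) * g (fun i => (s i).1, fun i => (s i).2) := by
  rw [← (Equiv.arrowProdEquivProdArrow ι (fun _ => S₁) (fun _ => S₂)).sum_comp]
  rfl

theorem blockSource_mem {ι : Type*} [Fintype ι] [DecidableEq ι] {p : S₁ × S₂ → ℝ}
    (hp : p ∈ stdSimplex ℝ (S₁ × S₂)) :
    blockSource p ι ∈ stdSimplex ℝ ((ι → S₁) × (ι → S₂)) := by
  refine ⟨fun s => Finset.prod_nonneg fun i _ => hp.1 _, ?_⟩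
  have := sum_blockSource_mul (ι := ι) p fun _ => 1
  simp only [mul_one] at this
  rw [this, sum_prod_eq_one fun _ => hp.2]

theorem isCondPMF_pi {ι A B : Type*} [Fintype ι] [DecidableEq ι] [Fintype B] {K : A → B → ℝ}
    (hK : IsCondPMF K) : IsCondPMF fun (a : ι → A) (b : ι → B) => ∏ i, K (a i) (b i) :=
  fun a => ⟨fun _ => Finset.prod_nonneg fun i _ => (hK (a i)).1 _,
    sum_prod_eq_one (q := fun i b => K (a i) b) fun i => (hK (a i)).2⟩

theorem pi_mem_stdSimplex {ι B : Type*} [Fintype ι] [DecidableEq ι] [Fintype B] {q : B → ℝ}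
    (hq : q ∈ stdSimplex ℝ B) : (fun b : ι → B => ∏ i, q (b i)) ∈ stdSimplex ℝ (ι → B) :=
  ⟨fun _ => Finset.prod_nonneg fun _ _ => hq.1 _, sum_prod_eq_one fun _ => hq.2⟩

/-- A block of independent copies is again a conditionally independent source, with common part S₀ⁿ.
The computations made for the inner law thus apply to the block source of the outer bound. -/
theorem IsCondIndepSource.pi {ι : Type*} [Fintype ι] [DecidableEq ι] {p : S₁ × S₂ → ℝ}
    {f₁ : S₁ → S₀} {f₂ : S₂ → S₀} {π : S₀ → ℝ} {κ₁ : S₀ → S₁ → ℝ} {κ₂ : S₀ → S₂ → ℝ}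
    (h : IsCondIndepSource p f₁ f₂ π κ₁ κ₂) :
    IsCondIndepSource (blockSource p ι) (fun s => f₁ ∘ s) (fun s => f₂ ∘ s)
      (fun s => ∏ i, π (s i)) (fun s₀ s₁ => ∏ i, κ₁ (s₀ i) (s₁ i))
      (fun s₀ s₂ => ∏ i, κ₂ (s₀ i) (s₂ i)) where
  mem := pi_mem_stdSimplex h.mem
  isCond₁ := isCondPMF_pi h.isCond₁
  isCond₂ := isCondPMF_pi h.isCond₂
  eq_sum s₁ s₂ := by
    simp only [blockSource, h.eq_sum, ← Finset.prod_mul_distrib]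
    exact (sum_prod_eq_prod_sum fun i s₀ => π s₀ * (κ₁ s₀ (s₁ i) * κ₂ s₀ (s₂ i))).symm
  eq₁ s₀ s₁ h0 h1 := funext fun i => h.eq₁ _ _ (Finset.prod_ne_zero_iff.1 h0 i (Finset.mem_univ i))
    (Finset.prod_ne_zero_iff.1 h1 i (Finset.mem_univ i))
  eq₂ s₀ s₂ h0 h1 := funext fun i => h.eq₂ _ _ (Finset.prod_ne_zero_iff.1 h0 i (Finset.mem_univ i))
    (Finset.prod_ne_zero_iff.1 h1 i (Finset.mem_univ i))

end Source

/-! ### Compactness of the region -/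

section Compact

/-- By Carathéodory's theorem dim + 1 points suffice, so the hull is the continuous image of the
compact product of a simplex and a power of `s`. -/
theorem isCompact_convexHull_of_finiteDimensional {E : Type*} [NormedAddCommGroup E]
    [NormedSpace ℝ E] [FiniteDimensional ℝ E] {s : Set E} (hs : IsCompact s) :
    IsCompact (convexHull ℝ s) := by
  rcases s.eq_empty_or_nonempty with rfl | ⟨x₀, hx₀⟩
  · simp
  let N := Module.finrank ℝ E + 1
  have hc : IsCompact ((fun q : (Fin N → ℝ) × (Fin N → E) => ∑ i, q.1 i • q.2 i) ''
      (stdSimplex ℝ (Fin N) ×ˢ Set.univ.pi fun _ => s)) :=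
    ((isCompact_stdSimplex ℝ (Fin N)).prod (isCompact_univ_pi fun _ => hs)).image (by fun_prop)
  convert hc
  ext x
  constructor
  · intro hx
    obtain ⟨ι, _, z, w, hz, hi, hw, hw1, hx⟩ := eq_pos_convex_span_of_mem_convexHull hx
    obtain ⟨e⟩ : Nonempty (ι ↪ Fin N) :=
      Function.Embedding.nonempty_of_card_le (by
      simpa [N] using hi.card_le_finrank_succ.trans (Nat.succ_le_succ (Submodule.finrank_le _)))
    -- Carathéodory may give fewer than N points; the remaining indices carry weight 0 and the dummy
    -- point `x₀`.
    have hext : ∀ j, j ∉ Set.range e → Function.extend e w 0 j = 0 := fun j hj =>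
      Function.extend_apply' _ _ _ hj
    refine ⟨(Function.extend e w 0, Function.extend e z fun _ => x₀), ⟨⟨fun j => ?_, ?_⟩, fun j _ => ?_⟩, ?_⟩
    · by_cases hj : j ∈ Set.range e
      · obtain ⟨i, rfl⟩ := hj
        simpa [e.injective.extend_apply] using (hw i).le
      · exact (hext j hj).ge
    · rw [← hw1]
      exact (Fintype.sum_of_injective e e.injective _ _ hext
        fun i => (e.injective.extend_apply _ _ _).symm).symm
    · by_cases hj : j ∈ Set.range e
      · obtain ⟨i, rfl⟩ := hj
        simpa [e.injective.extend_apply] using hz ⟨i, rfl⟩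
      · simpa [Function.extend_apply' _ _ _ hj] using hx₀
    · rw [← hx]
      refine (Fintype.sum_of_injective e e.injective _ _ (fun j hj => ?_) fun i => ?_).symm
      · simp [hext j hj]
      · simp [e.injective.extend_apply]
  · rintro ⟨⟨w, z⟩, ⟨hw, hz⟩, rfl⟩
    exact mem_convexHull_of_exists_fintype w z hw.1 hw.2 (fun i => hz i (Set.mem_univ i)) rfl

variable {X₁ X₂ Y : Type*} [Fintype X₁] [Fintype X₂] [Fintype Y]

/-- The auxiliary alphabet may grow as ε tends to 0, so a limit of auxiliary laws is not directly
available. Each such law is instead replaced by one point of the compact convex hull of the values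
attained by single input pairs. -/
theorem isSupported_of_forall_pos {mac : X₁ → X₂ → Y → ℝ} {h₁ h₂ h₃ h₄ : ℝ}
    (h : ∀ ε > 0, IsSupported mac (h₁ - ε) (h₂ - ε) (h₃ - ε) (h₄ - ε)) :
    IsSupported mac h₁ h₂ h₃ h₄ := by
  have hneg : Continuous Real.negMulLog := Real.continuous_negMulLog
  -- The first three informations are linear in the auxiliary law, but the mixed one is not. It is
  -- recovered from the output law and the noise entropy, which are linear.
  let Ψ : (X₁ → ℝ) × (X₂ → ℝ) → ℝ × ℝ × ℝ × (Y → ℝ) × ℝ := fun q =>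
    (inputInfo₁ mac q.1 q.2, inputInfo₂ mac q.1 q.2, inputInfo₁₂ mac q.1 q.2,
      fun y => outputLaw mac q.1 q.2 y, noiseEntropy mac q.1 q.2)
  have hΨ : Continuous Ψ := by
    simp only [Ψ, inputInfo₁, inputInfo₂, inputInfo₁₂, outputLaw, noiseEntropy]
    fun_prop
  have hK := isCompact_convexHull_of_finiteDimensional
    (((isCompact_stdSimplex ℝ X₁).prod (isCompact_stdSimplex ℝ X₂)).image hΨ)
  set K := convexHull ℝ (Ψ '' (stdSimplex ℝ X₁ ×ˢ stdSimplex ℝ X₂))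
  -- The smallest slack in the four inequalities. It is continuous and reaches at least -ε for every
  -- ε, so its maximum over the compact hull is nonnegative.
  let F : ℝ × ℝ × ℝ × (Y → ℝ) × ℝ → ℝ := fun t =>
    min (min (t.1 - h₁) (t.2.1 - h₂))
      (min (t.2.2.1 - h₃) ((∑ y, Real.negMulLog (t.2.2.2.1 y)) - t.2.2.2.2 - h₄))
  have hF : Continuous F := by
    simp only [F]
    fun_prop
  have hsum : ∀ {V : Type _} [Fintype V] (w : V → ℝ) (q : V → (X₁ → ℝ) × (X₂ → ℝ)),
      ∑ v, w v • Ψ (q v) = (∑ v, w v * inputInfo₁ mac (q v).1 (q v).2,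
        ∑ v, w v * inputInfo₂ mac (q v).1 (q v).2, ∑ v, w v * inputInfo₁₂ mac (q v).1 (q v).2,
        (fun y => ∑ v, w v * outputLaw mac (q v).1 (q v).2 y),
        ∑ v, w v * noiseEntropy mac (q v).1 (q v).2) := by
    intro V _ w q
    ext <;> simp [Ψ, Prod.fst_sum, Prod.snd_sum]
  have hmem : ∀ ε > 0, ∃ t ∈ K, -ε ≤ F t := by
    intro ε hε
    obtain ⟨m, w, a, b, hs⟩ := h ε hε
    refine ⟨_, mem_convexHull_of_exists_fintype w (fun v => Ψ (a v, b v)) hs.mem.1 hs.mem.2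
      (fun v => ⟨_, ⟨hs.isCond₁ v, hs.isCond₂ v⟩, rfl⟩) rfl, ?_⟩
    rw [hsum w fun v => (a v, b v)]
    have h1 := hs.le₁
    have h2 := hs.le₂
    have h3 := hs.le₁₂
    have h4 := hs.le_mixed
    rw [mixedInfo] at h4
    simp only [F, le_min_iff]
    refine ⟨⟨?_, ?_⟩, ?_, ?_⟩ <;> linarith
  obtain ⟨t₁, ht₁, -⟩ := hmem 1 one_pos
  obtain ⟨t₀, ht₀, hmax⟩ := hK.exists_isMaxOn ⟨t₁, ht₁⟩ hF.continuousOn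
  have hF0 : 0 ≤ F t₀ := by
    refine le_of_forall_pos_le_add fun ε hε => ?_
    obtain ⟨t, ht, hε⟩ := hmem ε hε
    have := hmax ht
    simp only [Set.mem_ofPred_eq] at this
    linarith
  obtain ⟨V, _, w, z, hw, hw1, hz, hx⟩ := mem_convexHull_iff_exists_fintype.1 ht₀
  choose q hq hqz using hz
  have hx' : ∑ v, w v • Ψ (q v) = t₀ := by rw [← hx]; simp only [hqz]
  rw [hsum] at hx'
  rw [← hx'] at hF0
  simp only [F, le_min_iff] at hF0
  refine SupportsRates.isSupported (w := w) (a := fun v => (q v).1) (b := fun v => (q v).2)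
    ⟨⟨hw, hw1⟩, fun v => (hq v).1, fun v => (hq v).2, ?_, ?_, ?_, ?_⟩
  · linarith [hF0.1.1]
  · linarith [hF0.1.2]
  · linarith [hF0.2.1]
  · rw [mixedInfo]
    linarith [hF0.2.2]

end Compact

/-! ### The inner and the outer bound in terms of the region -/

section Bounds

variable {S₀ S₁ S₂ X₁ X₂ Y : Type*} [Fintype S₀] [Fintype S₁] [Fintype S₂]
    [Fintype X₁] [Fintype X₂] [Fintype Y]
    {mac : X₁ → X₂ → Y → ℝ} {p : S₁ × S₂ → ℝ} {f₁ : S₁ → S₀} {f₂ : S₂ → S₀}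

/-- The source entropies lie in the region of the multiple access channel with common message. -/
def EntropiesSupported (mac : X₁ → X₂ → Y → ℝ) (p : S₁ × S₂ → ℝ) (f₁ : S₁ → S₀) : Prop :=
  IsSupported mac (condEntropy p (fun (s₁, _) => s₁) (fun (_, s₂) => s₂))
    (condEntropy p (fun (_, s₂) => s₂) (fun (s₁, _) => s₁))
    (condEntropy p (fun (s₁, s₂) => (s₁, s₂)) (fun (s₁, _) => f₁ s₁))
    (entropy p (fun (s₁, s₂) => (s₁, s₂)))

/-- From left to right the auxiliary variable is (S₀, W). From right to left W is the given
auxiliary variable and the inputs ignore the source, so that averaging over S₀ has no effect. -/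
theorem mem_innerBound_iff (hmac : ∀ x₁ x₂, mac x₁ x₂ ∈ stdSimplex ℝ Y)
    (hp : p ∈ stdSimplex ℝ (S₁ × S₂)) (hS₀ : IsCommonPart p f₁ f₂)
    (hM : IsMarkov p (fun (s₁, _) => s₁) (fun (s₁, _) => f₁ s₁) (fun (_, s₂) => s₂)) :
    p ∈ innerBound mac f₁ ↔ EntropiesSupported mac p f₁ := by
  obtain ⟨π, κ₁, κ₂, hP⟩ := exists_isCondIndepSource hp hS₀ hM
  constructor
  · rintro ⟨m, pW, pX₁, pX₂, hW, hX₁, hX₂, h1, h2, h3, h4⟩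
    rw [condMutualInfo_innerLaw₁ hmac hP hW hX₁ hX₂] at h1
    rw [condMutualInfo_innerLaw₂ hmac hP hW hX₁ hX₂] at h2
    rw [condMutualInfo_innerLaw₁₂ hmac hP hW hX₁ hX₂] at h3
    rw [mutualInfo_innerLaw hmac hP hW hX₁ hX₂] at h4
    refine SupportsRates.isSupported (w := fun v : S₀ × Fin m => π v.1 * pW v.2)
      ⟨⟨fun v => mul_nonneg (hP.mem.1 _) (hW.1 _), ?_⟩, isCondPMF_inputLaw hP.isCond₁ hX₁,
        isCondPMF_inputLaw hP.isCond₂ hX₂, h1, h2, h3, h4⟩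
    simp [Fintype.sum_prod_type, ← Finset.mul_sum, hW.2, hP.mem.2]
  · rintro ⟨m, w, a, b, h⟩
    have hX₁ : IsCondPMF fun (v : S₁ × Fin m) => a v.2 := fun v => h.isCond₁ _
    have hX₂ : IsCondPMF fun (v : S₂ × Fin m) => b v.2 := fun v => h.isCond₂ _
    have e1 : inputLaw κ₁ (fun (v : S₁ × Fin m) => a v.2) = fun v => a v.2 := by
      ext v x
      simp [inputLaw, ← Finset.sum_mul, (hP.isCond₁ _).2]
    have e2 : inputLaw κ₂ (fun (v : S₂ × Fin m) => b v.2) = fun v => b v.2 := by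
      ext v x
      simp [inputLaw, ← Finset.sum_mul, (hP.isCond₂ _).2]
    have e3 : ∀ g : Fin m → ℝ, ∑ v : S₀ × Fin m, π v.1 * w v.2 * g v.2 = ∑ v, w v * g v := by
      intro g
      simp only [Fintype.sum_prod_type, mul_assoc, ← Finset.mul_sum]
      rw [← Finset.sum_mul, hP.mem.2, one_mul]
    refine ⟨m, w, fun v => a v.2, fun v => b v.2, h.mem, hX₁, hX₂, ?_, ?_, ?_, ?_⟩
    · rw [condMutualInfo_innerLaw₁ hmac hP h.mem hX₁ hX₂, e1, e2,
        e3 fun v => inputInfo₁ mac (a v) (b v)]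
      exact h.le₁
    · rw [condMutualInfo_innerLaw₂ hmac hP h.mem hX₁ hX₂, e1, e2,
        e3 fun v => inputInfo₂ mac (a v) (b v)]
      exact h.le₂
    · rw [condMutualInfo_innerLaw₁₂ hmac hP h.mem hX₁ hX₂, e1, e2,
        e3 fun v => inputInfo₁₂ mac (a v) (b v)]
      exact h.le₁₂
    · rw [mutualInfo_innerLaw hmac hP h.mem hX₁ hX₂, e1, e2, mixedInfo,
        e3 fun v => noiseEntropy mac (a v) (b v)]
      simp only [fun y => e3 fun v => outputLaw mac (a v) (b v) y]
      exact h.le_mixed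

theorem sourceLaw_one (p : S₁ × S₂ → ℝ) :
    sourceLaw p (fun _ (_ : Fin 1) => 1) = law p fun s => (s.1, s.2, 0) := by
  classical
  ext ⟨s₁, s₂, u⟩
  rw [law, Finset.sum_eq_single (s₁, s₂)]
  · simp [sourceLaw, Subsingleton.elim u 0]
  · rintro ⟨t₁, t₂⟩ - h
    refine if_neg fun h' => h ?_
    simp only [Prod.mk.injEq] at h' ⊢
    exact ⟨h'.1, h'.2.1⟩
  · simp

/-- When U is constant, forgetting Uⁿ identifies the outer law with an inner law of the block
source, Q playing the part of W. -/
theorem law_outerLaw_one {𝓠 : Type*} [Fintype 𝓠] {n : ℕ} (mac : X₁ → X₂ → Y → ℝ)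
    (p : S₁ × S₂ → ℝ) (pQ : 𝓠 → ℝ) (pX₁ : (Fin n → S₁) × 𝓠 → X₁ → ℝ)
    (pX₂ : (Fin n → S₂) × 𝓠 → X₂ → ℝ) :
    innerLaw mac (blockSource p (Fin n)) pQ pX₁ pX₂ =
      law (outerLaw mac p (fun _ (_ : Fin 1) => 1) pQ pX₁ pX₂) fun ω =>
        (ω.2.1, ω.2.2.1, ω.1, ω.2.2.2.2.1, ω.2.2.2.2.2.1, ω.2.2.2.2.2.2) := by
  classical
  ext ⟨s₁, s₂, w, x₁, x₂, y⟩
  rw [law, Finset.sum_eq_single (w, s₁, s₂, fun _ => 0, x₁, x₂, y)]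
  · simp only [innerLaw, outerLaw, blockSource, sourceLaw, if_true, mul_one]
    ring
  · rintro ⟨w', s₁', s₂', u', x₁', x₂', y'⟩ - h
    refine if_neg fun h' => h ?_
    simp only [Prod.mk.injEq] at h' ⊢
    obtain ⟨rfl, rfl, rfl, rfl, rfl, rfl⟩ := h'
    exact ⟨rfl, rfl, rfl, Subsingleton.elim _ _, rfl, rfl, rfl⟩
  · simp

theorem entropiesSupported_of_mem_outerBound (hmac : ∀ x₁ x₂, mac x₁ x₂ ∈ stdSimplex ℝ Y)
    (hp : p ∈ stdSimplex ℝ (S₁ × S₂)) (hS₀ : IsCommonPart p f₁ f₂)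
    (hM : IsMarkov p (fun (s₁, _) => s₁) (fun (s₁, _) => f₁ s₁) (fun (_, s₂) => s₂))
    (h : p ∈ outerBound mac f₁) : EntropiesSupported mac p f₁ := by
  obtain ⟨π, κ₁, κ₂, hP'⟩ := exists_isCondIndepSource hp hS₀ hM
  refine isSupported_of_forall_pos fun ε hε => ?_
  have hmar : IsMarkov (sourceLaw p fun _ (_ : Fin 1) => 1)
      (fun (s₁, _, _) => s₁) (fun (s₁, _, u) => (f₁ s₁, u)) (fun (_, s₂, _) => s₂) := by
    rintro s₁ ⟨s₀, u⟩ s₂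
    rw [sourceLaw_one]
    simp only [law_law]
    obtain rfl : u = 0 := Subsingleton.elim _ _
    have := hM s₁ s₀ s₂
    convert this using 2 <;> exact law_eq_law_of_iff fun ω _ => by simp
  -- For constant U the first four inequalities suffice; the sum rate comes first among them. The
  -- auxiliary variable is then (S₀ⁿ, Q), and the block length disappears because the source
  -- entropies on the left are already per letter.
  obtain ⟨n, m, pQ, pX₁, pX₂, hn, hQ, hX₁, hX₂, h4, h1, h2, h3, -⟩ := h 1 (fun _ _ => 1)
    (fun _ => ⟨fun _ => zero_le_one, by simp⟩) hmar ε hε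
  rw [sourceLaw_one, entropy_law] at h4
  rw [sourceLaw_one, condEntropy_law] at h1 h2 h3
  have hP := hP'.pi (ι := Fin n)
  have i1 := condMutualInfo_innerLaw₁ hmac hP hQ hX₁ hX₂
  have i2 := condMutualInfo_innerLaw₂ hmac hP hQ hX₁ hX₂
  have i3 := condMutualInfo_innerLaw₁₂ hmac hP hQ hX₁ hX₂
  have i4 := mutualInfo_innerLaw hmac hP hQ hX₁ hX₂
  have i5 := condMutualInfo_innerLaw_le_mutualInfo hmac (blockSource_mem hp) hP hQ hX₁ hX₂
  rw [i4] at i5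
  rw [law_outerLaw_one, condMutualInfo_law] at i1 i2 i3 i5
  refine SupportsRates.isSupported (w := fun v : (Fin n → S₀) × Fin m => (∏ i, π (v.1 i)) * pQ v.2)
      ⟨⟨fun v => mul_nonneg (hP.mem.1 _) (hQ.1 _), ?_⟩, isCondPMF_inputLaw hP.isCond₁ hX₁,
        isCondPMF_inputLaw hP.isCond₂ hX₂, ?_, ?_, ?_, ?_⟩
  · simp only [Fintype.sum_prod_type, ← Finset.mul_sum, hQ.2, mul_one]
    exact hP.mem.2
  · rw [← i1]
    exact sub_le_iff_le_add.2 h1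
  · rw [← i2]
    exact sub_le_iff_le_add.2 h2
  · rw [← i3]
    exact sub_le_iff_le_add.2 h3
  · refine le_trans ?_ i5
    exact sub_le_iff_le_add.2 h4

end Bounds

/-! ### Blocks of independent variables -/

section Block

variable {ι S A B : Type*} [Fintype ι] [DecidableEq ι] [Fintype S] [Fintype A] [Fintype B]

/-- The pmf of independent copies of `r`. -/
def piLaw (ι : Type*) [Fintype ι] (r : S → ℝ) (s : ι → S) : ℝ := ∏ i, r (s i)

theorem piLaw_mem {r : S → ℝ} (hr : r ∈ stdSimplex ℝ S) : piLaw ι r ∈ stdSimplex ℝ (ι → S) :=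
  pi_mem_stdSimplex hr

omit [Fintype A] in
theorem law_piLaw (r : S → ℝ) (γ : S → A) :
    law (piLaw ι r) (fun s i => γ (s i)) = piLaw ι (law r γ) := by
  classical
  ext g
  simp only [law, piLaw]
  rw [← sum_prod_eq_prod_sum fun i s => if γ s = g i then r s else 0]
  refine Finset.sum_congr rfl fun s _ => ?_
  rw [Fintype.prod_ite_zero]
  simp only [funext_iff]

theorem sum_piLaw_mul_sum {r : S → ℝ} (hr : r ∈ stdSimplex ℝ S) (g : S → ℝ) :
    ∑ s, piLaw ι r s * ∑ i, g (s i) = Fintype.card ι * ∑ s, r s * g s := by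
  simp only [Finset.mul_sum]
  rw [Finset.sum_comm]
  have h : ∀ i : ι, ∑ s : ι → S, piLaw ι r s * g (s i) = ∑ s, r s * g s := fun i =>
    sum_prod_mul_apply (fun _ => hr.2) i g
  simp [h, Finset.mul_sum]

theorem entropy_piLaw {r : S → ℝ} (hr : r ∈ stdSimplex ℝ S) (γ : S → A) :
    entropy (piLaw ι r) (fun s i => γ (s i)) = Fintype.card ι * entropy r γ := by
  rw [entropy_eq_sum, entropy_eq_sum, ← sum_piLaw_mul_sum hr]
  refine Finset.sum_congr rfl fun s _ => ?_
  by_cases h0 : piLaw ι r s = 0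
  · simp [h0]
  congr 1
  rw [law_piLaw, piLaw, Real.log_prod, Finset.sum_neg_distrib]
  exact fun i hi => (law_pos hr.1 γ (Finset.prod_ne_zero_iff.1 h0 i hi)).ne'

theorem condEntropy_piLaw {r : S → ℝ} (hr : r ∈ stdSimplex ℝ S) (α : S → A) (β : S → B) :
    condEntropy (piLaw ι r) (fun s i => α (s i)) (fun s i => β (s i)) =
      Fintype.card ι * condEntropy r α β := by
  have h : entropy (piLaw ι r) (fun s => (fun i => α (s i), fun i => β (s i))) =
      entropy (piLaw ι r) fun s i => (α (s i), β (s i)) :=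
    entropy_congr fun s s' _ _ => by
      simp only [Prod.mk.injEq, funext_iff]
      exact forall_and.symm
  rw [condEntropy, condEntropy, h, entropy_piLaw hr, entropy_piLaw hr fun s => (α s, β s)]
  ring

end Block

/-! ### Channel noise as the mean of a log-likelihood. -/

section Channel

variable {A C D : Type*} [Fintype A] [Fintype C] [Fintype D]

theorem condEntropy_channel_log {P : D × A → ℝ} {ν : D → ℝ} {ζ : D → C} {K : C → A → ℝ}
    (hν : ∀ d, 0 ≤ ν d) (hK : ∀ z, K z ∈ stdSimplex ℝ A) (hP : ∀ d x, P (d, x) = ν d * K (ζ d) x) :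
    condEntropy P (fun ω => ω.2) (fun ω => ζ ω.1) =
      ∑ ω, P ω * -Real.log (K (ζ ω.1) ω.2) := by
  classical
  have hP0 : ∀ ω, 0 ≤ P ω := fun ⟨d, x⟩ => by
    rw [hP]
    exact mul_nonneg (hν d) ((hK _).1 x)
  refine condEntropy_eq_of_law_eq_mul hP0 fun x z => ?_
  have h1 : law P (fun ω => ζ ω.1) z = law ν ζ z := by
    rw [law, law]
    simp only [Fintype.sum_prod_type, hP]
    refine Finset.sum_congr rfl fun d _ => ?_
    split_ifs
    · rw [← Finset.mul_sum, (hK _).2, mul_one]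
    · simp
  rw [h1, law, law, Finset.sum_mul]
  simp only [Fintype.sum_prod_type, hP, Prod.mk.injEq, ite_and]
  refine Finset.sum_congr rfl fun d _ => ?_
  by_cases h : ζ d = z
  · simp [h]
  · simp [h]

end Channel

/-! ### The converse -/

section Converse

variable {S₁ S₂ 𝓤 X₁ X₂ Y : Type*} [Fintype S₁] [Fintype S₂] [Fintype 𝓤] [Fintype X₁] [Fintype X₂]
  [Fintype Y] {n : ℕ}

/-- The channel seen by a source block when a code is used. -/
def codeChannel (mac : X₁ → X₂ → Y → ℝ) (c : Code S₁ S₂ X₁ X₂ Y S₁ S₂ n)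
    (s : (Fin n → S₁) × (Fin n → S₂)) (y : Fin n → Y) : ℝ :=
  ∏ i, mac (c.enc₁ s.1 i) (c.enc₂ s.2 i) (y i)

/-- The source blocks. -/
def sourceBlocks (s : Fin n → S₁ × S₂ × 𝓤) : (Fin n → S₁) × (Fin n → S₂) :=
  (fun i => (s i).1, fun i => (s i).2.1)

/-- The joint pmf of the source block with side information `r` and the channel output. -/
def codeLaw (mac : X₁ → X₂ → Y → ℝ) (c : Code S₁ S₂ X₁ X₂ Y S₁ S₂ n) (r : S₁ × S₂ × 𝓤 → ℝ) :
    (Fin n → S₁ × S₂ × 𝓤) × (Fin n → Y) → ℝ :=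
  fun ω => piLaw (Fin n) r ω.1 * codeChannel mac c (sourceBlocks ω.1) ω.2

/-- `codeLaw` together with a uniform time index. -/
def timeLaw (mac : X₁ → X₂ → Y → ℝ) (c : Code S₁ S₂ X₁ X₂ Y S₁ S₂ n) (r : S₁ × S₂ × 𝓤 → ℝ) :
    Fin n × (Fin n → S₁ × S₂ × 𝓤) × (Fin n → Y) → ℝ :=
  fun ω => (n : ℝ)⁻¹ * codeLaw mac c r ω.2

variable {mac : X₁ → X₂ → Y → ℝ} {c : Code S₁ S₂ X₁ X₂ Y S₁ S₂ n} {r : S₁ × S₂ × 𝓤 → ℝ}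

omit [Fintype S₁] [Fintype S₂] [Fintype X₁] [Fintype X₂] in
theorem isCondPMF_codeChannel (hmac : ∀ x₁ x₂, mac x₁ x₂ ∈ stdSimplex ℝ Y) :
    IsCondPMF (codeChannel mac c) := fun s =>
  ⟨fun _ => Finset.prod_nonneg fun _ _ => (hmac _ _).1 _,
    sum_prod_eq_one (q := fun i => mac (c.enc₁ s.1 i) (c.enc₂ s.2 i)) fun _ => (hmac _ _).2⟩

omit [Fintype X₁] [Fintype X₂] in
theorem codeLaw_nonneg (hmac : ∀ x₁ x₂, mac x₁ x₂ ∈ stdSimplex ℝ Y)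
    (hr : r ∈ stdSimplex ℝ (S₁ × S₂ × 𝓤)) (ω) : 0 ≤ codeLaw mac c r ω :=
  mul_nonneg ((piLaw_mem hr).1 _) ((isCondPMF_codeChannel hmac _).1 _)

omit [Fintype X₁] [Fintype X₂] in
theorem timeLaw_nonneg (hmac : ∀ x₁ x₂, mac x₁ x₂ ∈ stdSimplex ℝ Y)
    (hr : r ∈ stdSimplex ℝ (S₁ × S₂ × 𝓤)) (ω) : 0 ≤ timeLaw mac c r ω :=
  mul_nonneg (by positivity) (codeLaw_nonneg hmac hr _)

omit [Fintype X₁] [Fintype X₂] in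
theorem sum_timeLaw_mul (hn : 0 < n)
    (g : Fin n → (Fin n → S₁ × S₂ × 𝓤) × (Fin n → Y) → ℝ) :
    n * ∑ ω, timeLaw mac c r ω * g ω.1 ω.2 = ∑ ω, codeLaw mac c r ω * ∑ t, g t ω := by
  rw [Fintype.sum_prod_type]
  simp only [Finset.mul_sum, timeLaw]
  rw [Finset.sum_comm]
  refine Finset.sum_congr rfl fun ω _ => Finset.sum_congr rfl fun t _ => ?_
  have : (n : ℝ) ≠ 0 := by positivity
  field_simp

omit [Fintype X₁] [Fintype X₂] in
theorem law_codeLaw_fst (hmac : ∀ x₁ x₂, mac x₁ x₂ ∈ stdSimplex ℝ Y) :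
    law (codeLaw mac c r) (fun ω => ω.1) = piLaw (Fin n) r := by
  classical
  ext s
  rw [law, Fintype.sum_prod_type, Finset.sum_eq_single s]
  · simp [codeLaw, ← Finset.mul_sum, (isCondPMF_codeChannel hmac _).2]
  · intro s' _ h
    simp [h]
  · simp

omit [Fintype X₁] [Fintype X₂] in
-- Summing out the outputs at all other times leaves a single use of the channel, fed with the code
-- symbols at the chosen time.
theorem law_timeLaw (hmac : ∀ x₁ x₂, mac x₁ x₂ ∈ stdSimplex ℝ Y)
    (d : Fin n × (Fin n → S₁ × S₂ × 𝓤)) (y : Y) :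
    law (timeLaw mac c r) (fun ω => ((ω.1, ω.2.1), ω.2.2 ω.1)) (d, y) =
      (n : ℝ)⁻¹ * piLaw (Fin n) r d.2 *
        mac (c.enc₁ (sourceBlocks d.2).1 d.1) (c.enc₂ (sourceBlocks d.2).2 d.1) y := by
  classical
  obtain ⟨t, s⟩ := d
  rw [law, Fintype.sum_prod_type, Finset.sum_eq_single t _ (by simp)]
  swap
  · intro t' _ h
    simp [h]
  rw [Fintype.sum_prod_type, Finset.sum_eq_single s _ (by simp)]
  swap
  · intro s' _ h
    simp [h]
  have := sum_prod_mul_apply (q := fun i =>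
    mac (c.enc₁ (sourceBlocks s).1 i) (c.enc₂ (sourceBlocks s).2 i)) (fun _ => (hmac _ _).2) t
    fun y' => if y' = y then 1 else 0
  simp only [mul_ite, mul_one, mul_zero, Finset.sum_ite_eq', Finset.mem_univ, if_true] at this
  rw [← this, Finset.mul_sum]
  refine Finset.sum_congr rfl fun y' _ => ?_
  by_cases h : y' t = y
  · simp [h, timeLaw, codeLaw, codeChannel]
    ring
  · simp [h]

/-! ### Single-letterization with a uniform time index. -/

section Letters

variable {A B C C' : Type*} [Fintype A] [Fintype B] [Fintype C] [Fintype C']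

omit [Fintype X₁] [Fintype X₂] in
theorem condEntropy_codeLaw_source (hmac : ∀ x₁ x₂, mac x₁ x₂ ∈ stdSimplex ℝ Y)
    (hr : r ∈ stdSimplex ℝ (S₁ × S₂ × 𝓤)) (α : S₁ × S₂ × 𝓤 → A) (β : S₁ × S₂ × 𝓤 → B) :
    condEntropy (codeLaw mac c r) (fun ω i => α (ω.1 i)) (fun ω i => β (ω.1 i)) =
      n * condEntropy r α β := by
  have := condEntropy_law (codeLaw mac c r) (fun ω => ω.1) (fun s i => α (s i)) fun s i => β (s i)
  rw [← this, law_codeLaw_fst hmac, condEntropy_piLaw hr, Fintype.card_fin]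

omit [Fintype X₁] [Fintype X₂] in
-- This is H(Yⁿ|βⁿ) ≤ ∑ₜ H(Yₜ|βⁿ), the right side being n times the conditional entropy at the
-- uniform time T given (T, βⁿ). Gibbs' inequality with the product of the per-letter conditional
-- laws gives it without a chain rule.
theorem condEntropy_codeLaw_output_le (hn : 0 < n) (hmac : ∀ x₁ x₂, mac x₁ x₂ ∈ stdSimplex ℝ Y)
    (hr : r ∈ stdSimplex ℝ (S₁ × S₂ × 𝓤)) (β : S₁ × S₂ × 𝓤 → B) :
    condEntropy (codeLaw mac c r) (fun ω => ω.2) (fun ω i => β (ω.1 i)) ≤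
      n * condEntropy (timeLaw mac c r) (fun ω => ω.2.2 ω.1)
        (fun ω => (ω.1, fun i => β (ω.2.1 i))) := by
  have hJ := codeLaw_nonneg (c := c) hmac hr
  have hT := timeLaw_nonneg (c := c) hmac hr
  set q := condLaw (timeLaw mac c r) (fun ω => ω.2.2 ω.1) (fun ω => (ω.1, fun i => β (ω.2.1 i)))
    with hq
  have hpos : ∀ ω, codeLaw mac c r ω ≠ 0 → ∀ t, 0 < q (t, fun i => β (ω.1 i)) (ω.2 t) := by
    intro ω h t
    exact condLaw_pos hT (fun ω => ω.2.2 ω.1) (fun ω => (ω.1, fun i => β (ω.2.1 i))) (ω := (t, ω))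
      (mul_ne_zero (by positivity) h)
  rw [condEntropy_eq_sum_condLaw hT,
    sum_timeLaw_mul hn fun t ω => -Real.log (q (t, fun i => β (ω.1 i)) (ω.2 t))]
  refine (condEntropy_le_sum (K := fun b y => ∏ t, q (t, b) (y t)) hJ
    (fun b y => Finset.prod_nonneg fun t _ => condLaw_nonneg hT _ _ _ _) (fun b => ?_)
    fun ω h => Finset.prod_pos fun t _ => hpos ω h t).trans (le_of_eq ?_)
  · rw [sum_prod_eq_prod_sum fun t => q (t, b)]
    exact Finset.prod_le_one (fun t _ => Finset.sum_nonneg fun y _ => condLaw_nonneg hT _ _ _ _)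
      fun t _ => sum_condLaw_le_one _ _ _ _
  · refine Finset.sum_congr rfl fun ω _ => ?_
    by_cases h : codeLaw mac c r ω = 0
    · simp [h]
    · rw [Real.log_prod fun t _ => (hpos ω h t).ne', Finset.sum_neg_distrib]

/-- If θ determines both source blocks, it determines both codewords; the channel being memoryless,
its log-likelihood is a sum over time of single-letter terms. -/
theorem condEntropy_codeLaw_noise (hn : 0 < n) (hmac : ∀ x₁ x₂, mac x₁ x₂ ∈ stdSimplex ℝ Y)
    (hr : r ∈ stdSimplex ℝ (S₁ × S₂ × 𝓤)) (θ : (Fin n → S₁ × S₂ × 𝓤) → C')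
    (hθ : Function.FactorsThrough sourceBlocks θ) :
    condEntropy (codeLaw mac c r) (fun ω => ω.2) (fun ω => θ ω.1) =
      n * condEntropy (timeLaw mac c r) (fun ω => ω.2.2 ω.1) (fun ω =>
        (c.enc₁ (sourceBlocks ω.2.1).1 ω.1, c.enc₂ (sourceBlocks ω.2.1).2 ω.1)) := by
  obtain ⟨s₀, -, -⟩ := Finset.exists_ne_zero_of_sum_ne_zero (hr.2.trans_ne one_ne_zero)
  -- A left inverse recovering the source blocks from θ. Off the range of θ it returns a constant
  -- block, so that the channel row is defined everywhere.
  let d := Function.extend θ sourceBlocks fun _ => (fun _ => s₀.1, fun _ => s₀.2.1)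
  have hd : ∀ s, d (θ s) = sourceBlocks s := fun s => hθ.extend_apply _ s
  rw [condEntropy_channel_log (P := codeLaw mac c r) (ζ := θ)
    (K := fun z => codeChannel mac c (d z)) (piLaw_mem hr).1
    (fun z => isCondPMF_codeChannel hmac _) fun s y => by rw [hd, codeLaw]]
  have h1 := condEntropy_law (timeLaw mac c r) (fun ω => ((ω.1, ω.2.1), ω.2.2 ω.1))
    (fun ω => ω.2) fun ω =>
      (c.enc₁ (sourceBlocks ω.1.2).1 ω.1.1, c.enc₂ (sourceBlocks ω.1.2).2 ω.1.1)
  rw [← h1, condEntropy_channel_log (K := fun z : X₁ × X₂ => mac z.1 z.2)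
    (ζ := fun d : Fin n × (Fin n → S₁ × S₂ × 𝓤) =>
      (c.enc₁ (sourceBlocks d.2).1 d.1, c.enc₂ (sourceBlocks d.2).2 d.1))

    (fun d => mul_nonneg (a := (n : ℝ)⁻¹) (by positivity) ((piLaw_mem hr).1 d.2))
    (fun z => hmac _ _) (fun d y => by rw [law_timeLaw hmac]), sum_law_mul,
    sum_timeLaw_mul hn fun t ω => -Real.log
      (mac (c.enc₁ (sourceBlocks ω.1).1 t) (c.enc₂ (sourceBlocks ω.1).2 t) (ω.2 t))]
  refine Finset.sum_congr rfl fun ω _ => ?_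
  by_cases h : codeLaw mac c r ω = 0
  · simp [h]
  · have h2 := right_ne_zero_of_mul h
    rw [hd, codeChannel, Real.log_prod (Finset.prod_ne_zero_iff.1 h2), Finset.sum_neg_distrib]

/-- Single-letterization of the information inequality of a code. -/
theorem condEntropy_le_of_code (hn : 0 < n) (hmac : ∀ x₁ x₂, mac x₁ x₂ ∈ stdSimplex ℝ Y)
    (hr : r ∈ stdSimplex ℝ (S₁ × S₂ × 𝓤)) (α : S₁ × S₂ × 𝓤 → A) (β : S₁ × S₂ × 𝓤 → B)
    (hα : ∀ s s', s.1 = s'.1 → s.2.1 = s'.2.1 → α s = α s')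
    (hαβ : ∀ s s', (α s, β s) = (α s', β s') → s.1 = s'.1 ∧ s.2.1 = s'.2.1)
    (ξ : Fin n × (Fin n → S₁ × S₂ × 𝓤) × (Fin n → Y) → C)
    (hξ : ∀ ω ω', ξ ω = ξ ω' ↔ ω.1 = ω'.1 ∧ ∀ i, β (ω.2.1 i) = β (ω'.2.1 i)) :
    n * condEntropy r α β ≤
      n * (condEntropy (timeLaw mac c r) (fun ω => ω.2.2 ω.1) ξ -
        condEntropy (timeLaw mac c r) (fun ω => ω.2.2 ω.1) (fun ω =>
          (c.enc₁ (sourceBlocks ω.2.1).1 ω.1, c.enc₂ (sourceBlocks ω.2.1).2 ω.1))) +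
      condEntropy (codeLaw mac c r) (fun ω => sourceBlocks ω.1) (fun ω => ω.2) := by
  have hJ := codeLaw_nonneg (c := c) hmac hr
  have h1 := condEntropy_codeLaw_source (c := c) hmac hr α β
  have h2 := condEntropy_codeLaw_output_le (c := c) hn hmac hr β
  have h2' : condEntropy (timeLaw mac c r) (fun ω => ω.2.2 ω.1)
      (fun ω => (ω.1, fun i => β (ω.2.1 i))) =
      condEntropy (timeLaw mac c r) (fun ω => ω.2.2 ω.1) ξ :=
    condEntropy_congr (fun ω ω' _ _ => by simp only [Prod.mk.injEq, hξ, funext_iff])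
      fun ω ω' _ _ => by simp only [Prod.mk.injEq, hξ, funext_iff]
  have hab : ∀ s s' : Fin n → S₁ × S₂ × 𝓤, (fun i => α (s i), fun i => β (s i)) =
      ((fun i => α (s' i), fun i => β (s' i)) : (Fin n → A) × (Fin n → B)) →
      sourceBlocks s = sourceBlocks s' := fun s s' h => by
    simp only [Prod.mk.injEq, funext_iff] at h
    simp only [sourceBlocks, Prod.mk.injEq, funext_iff, ← forall_and]
    exact fun i => hαβ _ _ (Prod.ext (h.1 i) (h.2 i))
  have hsb : ∀ s s' : Fin n → S₁ × S₂ × 𝓤, sourceBlocks s = sourceBlocks s' →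
      (fun i => α (s i)) = fun i => α (s' i) := fun s s' h => by
    simp only [sourceBlocks, Prod.mk.injEq, funext_iff] at h
    exact funext fun i => hα _ _ (h.1 i) (h.2 i)
  have h3 := condEntropy_codeLaw_noise (c := c) hn hmac hr
    (fun s => ((fun i => α (s i), fun i => β (s i)) : (Fin n → A) × (Fin n → B)))
    (fun s s' => hab s s')
  -- Dropping βⁿ from the conditioning and passing from αⁿ to the source blocks that determine it
  -- can only increase the entropy. This is the term controlled by Fano's inequality.
  have h5 : condEntropy (codeLaw mac c r) (fun ω i => α (ω.1 i))
      (fun ω => (ω.2, fun i => β (ω.1 i))) ≤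
      condEntropy (codeLaw mac c r) (fun ω => sourceBlocks ω.1) (fun ω => ω.2) := by
    refine (condEntropy_le_of_imp hJ _ _ fun z => z.1).trans ?_
    refine sub_le_sub_right (entropy_le_entropy hJ fun ω ω' _ _ h => ?_) _
    simp only [Prod.mk.injEq] at h ⊢
    exact ⟨hsb _ _ h.1, h.2⟩
  -- The two expansions of I(αⁿ;Yⁿ|βⁿ): one contains H(αⁿ|βⁿ), which is n times the letter entropy,
  -- and the other the output and noise terms.
  have h6 := condMutualInfo_eq (codeLaw mac c r) (fun ω i => α (ω.1 i)) (fun ω => ω.2)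
    (fun ω i => β (ω.1 i))
  rw [condMutualInfo] at h6
  rw [h2'] at h2
  linarith

end Letters

/-! ### Fano's inequality for letterwise errors. -/

section Fano

/-- A kernel that keeps its input with probability `1 - δ` and is uniform otherwise. -/
def fanoKernel {S : Type*} [Fintype S] (δ : ℝ) (t s : S) : ℝ :=
  open Classical in (1 - δ) * (if s = t then 1 else 0) + δ / Fintype.card S

theorem fanoKernel_pos {S : Type*} [Fintype S] {δ : ℝ} (h0 : 0 < δ) (h1 : δ < 1) (t s : S) :
    0 < fanoKernel δ t s := by
  have : Nonempty S := ⟨t⟩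
  have h2 : 0 < δ / Fintype.card S := by positivity
  rw [fanoKernel]
  split_ifs <;> linarith

theorem sum_fanoKernel {S : Type*} [Fintype S] (δ : ℝ) (t : S) : ∑ s, fanoKernel δ t s = 1 := by
  classical
  have : Nonempty S := ⟨t⟩
  have h : (Fintype.card S : ℝ) ≠ 0 := by positivity
  simp only [fanoKernel, Finset.sum_add_distrib, ← Finset.mul_sum]
  simp
  field_simp
  ring

open Classical in
-- A correct letter costs at most -log(1 - δ), and a wrong one at most log(|S|/δ) more. The uniform
-- part keeps the kernel positive, as Gibbs' inequality requires, and makes the bound linear in the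
-- number of errors.
theorem neg_log_fanoKernel_le {S : Type*} [Fintype S] {δ : ℝ} (h0 : 0 < δ) (h1 : δ < 1) (t s : S) :
    -Real.log (fanoKernel δ t s) ≤
      -Real.log (1 - δ) + Real.log (Fintype.card S / δ) * if s = t then 0 else 1 := by
  have : Nonempty S := ⟨t⟩
  have h2 : 0 < δ / Fintype.card S := by positivity
  have h3 : 0 < 1 - δ := by linarith
  split_ifs with h
  · rw [mul_zero, add_zero]
    refine neg_le_neg (Real.log_le_log h3 ?_)
    rw [fanoKernel, if_pos h]
    linarith
  · rw [fanoKernel, if_neg h, mul_zero, zero_add, ← Real.log_inv, inv_div, mul_one]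
    have := Real.log_nonpos h3.le (by linarith)
    linarith

open Classical in
/-- The expected number of errors in the first source block. -/
def errorCount₁ (mac : X₁ → X₂ → Y → ℝ) (c : Code S₁ S₂ X₁ X₂ Y S₁ S₂ n) (r : S₁ × S₂ × 𝓤 → ℝ) : ℝ :=
  ∑ ω, codeLaw mac c r ω * ∑ t, if (ω.1 t).1 = c.dec₁ ω.2 t then 0 else 1

open Classical in
/-- The expected number of errors in the second source block. -/
def errorCount₂ (mac : X₁ → X₂ → Y → ℝ) (c : Code S₁ S₂ X₁ X₂ Y S₁ S₂ n) (r : S₁ × S₂ × 𝓤 → ℝ) : ℝ :=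
  ∑ ω, codeLaw mac c r ω * ∑ t, if (ω.1 t).2.1 = c.dec₂ ω.2 t then 0 else 1

omit [Fintype X₁] [Fintype X₂] in
theorem sum_codeLaw (hmac : ∀ x₁ x₂, mac x₁ x₂ ∈ stdSimplex ℝ Y)
    (hr : r ∈ stdSimplex ℝ (S₁ × S₂ × 𝓤)) : ∑ ω, codeLaw mac c r ω = 1 := by
  rw [← sum_law (codeLaw mac c r) fun ω => ω.1, law_codeLaw_fst hmac]
  exact (piLaw_mem hr).2

omit [Fintype X₁] [Fintype X₂] in
/-- Fano's inequality for the source blocks. -/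
theorem condEntropy_sourceBlocks_le (hmac : ∀ x₁ x₂, mac x₁ x₂ ∈ stdSimplex ℝ Y)
    (hr : r ∈ stdSimplex ℝ (S₁ × S₂ × 𝓤)) {δ : ℝ} (h0 : 0 < δ) (h1 : δ < 1) :
    condEntropy (codeLaw mac c r) (fun ω => sourceBlocks ω.1) (fun ω => ω.2) ≤
      n * (2 * -Real.log (1 - δ)) + Real.log (Fintype.card S₁ / δ) * errorCount₁ mac c r +
        Real.log (Fintype.card S₂ / δ) * errorCount₂ mac c r := by
  classical
  have hJ := codeLaw_nonneg (c := c) hmac hr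
  have hf₁ := fun t s => (fanoKernel_pos (S := S₁) h0 h1 t s)
  have hf₂ := fun t s => (fanoKernel_pos (S := S₂) h0 h1 t s)
  have hprod₁ : ∀ (t s : Fin n → S₁), 0 < ∏ i, fanoKernel δ (t i) (s i) :=
    fun t s => Finset.prod_pos fun i _ => hf₁ _ _
  have hprod₂ : ∀ (t s : Fin n → S₂), 0 < ∏ i, fanoKernel δ (t i) (s i) :=
    fun t s => Finset.prod_pos fun i _ => hf₂ _ _
  -- Gibbs' inequality with a product kernel centred at the decoder's output: only the expected
  -- number of wrong letters enters, not the probability of a block error.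
  refine (condEntropy_le_sum (K := fun y s => (∏ i, fanoKernel δ (c.dec₁ y i) (s.1 i)) *
    ∏ i, fanoKernel δ (c.dec₂ y i) (s.2 i)) hJ
    (fun y s => (mul_pos (hprod₁ (c.dec₁ y) s.1) (hprod₂ (c.dec₂ y) s.2)).le)
    (fun y => le_of_eq ?_) fun ω _ => mul_pos (hprod₁ (c.dec₁ ω.2) (sourceBlocks ω.1).1)
      (hprod₂ (c.dec₂ ω.2) (sourceBlocks ω.1).2)).trans ?_
  · rw [Fintype.sum_prod_type]
    simp only [← Finset.mul_sum]
    rw [sum_prod_eq_one (q := fun i => fanoKernel δ (c.dec₂ y i)) fun i => sum_fanoKernel δ _]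
    simp only [mul_one]
    exact sum_prod_eq_one (q := fun i => fanoKernel δ (c.dec₁ y i)) fun i => sum_fanoKernel δ _
  · rw [errorCount₁, errorCount₂, Finset.mul_sum, Finset.mul_sum,
      show (n : ℝ) * (2 * -Real.log (1 - δ)) =
        ∑ ω, codeLaw mac c r ω * (n * (2 * -Real.log (1 - δ))) by
        rw [← Finset.sum_mul, sum_codeLaw hmac hr, one_mul],
      ← Finset.sum_add_distrib, ← Finset.sum_add_distrib]
    refine Finset.sum_le_sum fun ω _ => ?_
    rw [Real.log_mul (hprod₁ (c.dec₁ ω.2) _).ne' (hprod₂ (c.dec₂ ω.2) _).ne', Real.log_prod fun i _ => (hf₁ _ _).ne',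
      Real.log_prod fun i _ => (hf₂ _ _).ne']
    have e1 := Finset.sum_le_sum fun i (_ : i ∈ Finset.univ) =>
      neg_log_fanoKernel_le h0 h1 (c.dec₁ ω.2 i) (ω.1 i).1
    have e2 := Finset.sum_le_sum fun i (_ : i ∈ Finset.univ) =>
      neg_log_fanoKernel_le h0 h1 (c.dec₂ ω.2 i) (ω.1 i).2.1
    rw [Finset.sum_add_distrib, ← Finset.mul_sum, Finset.sum_neg_distrib] at e1 e2
    simp only [Finset.sum_const, Finset.card_univ, Fintype.card_fin, nsmul_eq_mul] at e1 e2
    have := mul_le_mul_of_nonneg_left (add_le_add e1 e2) (hJ ω)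
    simp only [sourceBlocks]
    linarith

end Fano

end Converse

/-! ### Codes as points of the outer bound. -/

section Converse

variable {S₁ S₂ 𝓤 X₁ X₂ Y : Type*} [Fintype S₁] [Fintype S₂] [Fintype 𝓤] [Fintype Y] {n : ℕ} {mac : X₁ → X₂ → Y → ℝ} {p : S₁ × S₂ → ℝ} {pU : S₁ × S₂ → 𝓤 → ℝ}

/-- The single-letter variables of a code at a time index. -/
def timePoint (c : Code S₁ S₂ X₁ X₂ Y S₁ S₂ n) (ω : Fin n × (Fin n → S₁ × S₂ × 𝓤) × (Fin n → Y)) :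
    OuterSpace n (Fin n) S₁ S₂ 𝓤 X₁ X₂ Y :=
  (ω.1, (sourceBlocks ω.2.1).1, (sourceBlocks ω.2.1).2, fun i => (ω.2.1 i).2.2,
    c.enc₁ (sourceBlocks ω.2.1).1 ω.1, c.enc₂ (sourceBlocks ω.2.1).2 ω.1, ω.2.2 ω.1)

open Classical in
/-- The kernel of a deterministic encoder. -/
def encoderKernel {S X : Type*} (enc : (Fin n → S) → Fin n → X) (v : (Fin n → S) × Fin n) (x : X) :
    ℝ :=
  if enc v.1 v.2 = x then 1 else 0

theorem isCondPMF_encoderKernel {S X : Type*} [Fintype X] (enc : (Fin n → S) → Fin n → X) :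
    IsCondPMF (encoderKernel enc) := fun v =>
  ⟨fun x => by rw [encoderKernel]; positivity, (Finset.sum_eq_single (enc v.1 v.2)
    (fun _ _ h => if_neg h.symm) (by simp)).trans (if_pos rfl)⟩

theorem sourceLaw_mem (hp : p ∈ stdSimplex ℝ (S₁ × S₂)) (hU : IsCondPMF pU) :
    sourceLaw p pU ∈ stdSimplex ℝ (S₁ × S₂ × 𝓤) := by
  refine ⟨fun s => mul_nonneg (hp.1 _) ((hU _).1 _), ?_⟩
  rw [← hp.2]
  simp only [Fintype.sum_prod_type, sourceLaw, ← Finset.mul_sum, (hU _).2, mul_one]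

theorem law_sourceLaw (hU : IsCondPMF pU) : law (sourceLaw p pU) (fun s => (s.1, s.2.1)) = p := by
  classical
  ext ⟨s₁, s₂⟩
  rw [law, Fintype.sum_prod_type, Finset.sum_eq_single s₁ _ (by simp), Fintype.sum_prod_type,
    Finset.sum_eq_single s₂ _ (by simp)]
  · simp [sourceLaw, ← Finset.mul_sum, (hU _).2]
  · intro s₂' _ h
    simp [h]
  · intro s₁' _ h
    simp [h]

/-- A code evaluated at a uniform time is an instance of the outer law: Q is the time and the
encoders are deterministic kernels. -/
theorem outerLaw_code (hmac : ∀ x₁ x₂, mac x₁ x₂ ∈ stdSimplex ℝ Y)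
    (c : Code S₁ S₂ X₁ X₂ Y S₁ S₂ n) :
    outerLaw mac p pU (fun _ => (n : ℝ)⁻¹) (encoderKernel c.enc₁) (encoderKernel c.enc₂) =
      law (timeLaw mac c (sourceLaw p pU)) (timePoint c) := by
  classical
  ext ⟨q, s₁, s₂, u, x₁, x₂, y⟩
  have h := law_law (timeLaw mac c (sourceLaw p pU)) (fun ω => ((ω.1, ω.2.1), ω.2.2 ω.1))
    fun ω => ((ω.1.1, (sourceBlocks ω.1.2).1, (sourceBlocks ω.1.2).2, fun i => (ω.1.2 i).2.2,
      c.enc₁ (sourceBlocks ω.1.2).1 ω.1.1, c.enc₂ (sourceBlocks ω.1.2).2 ω.1.1, ω.2) :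
        OuterSpace n (Fin n) S₁ S₂ 𝓤 X₁ X₂ Y)
  refine Eq.trans ?_ (congrFun h _)
  rw [law, Finset.sum_eq_single ((q, fun i => (s₁ i, s₂ i, u i)), y)]
  · rw [law_timeLaw hmac]
    simp only [outerLaw, encoderKernel, sourceBlocks, piLaw, Prod.mk.injEq]
    by_cases h1 : c.enc₁ s₁ q = x₁
    · by_cases h2 : c.enc₂ s₂ q = x₂
      · simp [h1, h2]
      · simp [h2]
    · simp [h1]
  · rintro ⟨⟨q', s⟩, y'⟩ - hne
    refine if_neg fun h' => hne ?_
    simp only [sourceBlocks, Prod.mk.injEq] at h' ⊢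
    refine ⟨⟨h'.1, funext fun i => ?_⟩, h'.2.2.2.2.2.2⟩
    rw [← h'.2.1, ← h'.2.2.1, ← h'.2.2.2.1]
  · simp

/-- The common form of the seven inequalities. By `hZ`, the conditioning Z carries the same
information as (T, βⁿ), any input it contains being determined by these; by `hg`, V and Z together
reveal both inputs, so H(Y|V,Z) is at most the noise term. -/
theorem condEntropy_le_condMutualInfo_outerLaw {A B C D : Type*} [Fintype X₁] [Fintype X₂] [Fintype A] [Fintype B]
    [Fintype C] [Fintype D] (hn : 0 < n) (hmac : ∀ x₁ x₂, mac x₁ x₂ ∈ stdSimplex ℝ Y)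
    (hp : p ∈ stdSimplex ℝ (S₁ × S₂)) (hU : IsCondPMF pU)
    (c : Code S₁ S₂ X₁ X₂ Y S₁ S₂ n) {ε : ℝ}
    (hε : condEntropy (codeLaw mac c (sourceLaw p pU)) (fun ω => sourceBlocks ω.1)
      (fun ω => ω.2) ≤ n * ε)
    (α : S₁ × S₂ × 𝓤 → A) (β : S₁ × S₂ × 𝓤 → B)
    (hα : ∀ s s', s.1 = s'.1 → s.2.1 = s'.2.1 → α s = α s')
    (hαβ : ∀ s s', α s = α s' → β s = β s' → s.1 = s'.1 ∧ s.2.1 = s'.2.1)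
    (V : OuterSpace n (Fin n) S₁ S₂ 𝓤 X₁ X₂ Y → D)
    (Z : OuterSpace n (Fin n) S₁ S₂ 𝓤 X₁ X₂ Y → C)
    (hZ : ∀ ω ω', Z (timePoint c ω) = Z (timePoint c ω') ↔
      ω.1 = ω'.1 ∧ ∀ i, β (ω.2.1 i) = β (ω'.2.1 i))
    (g : D × C → X₁ × X₂) (hg : ∀ ω, g (V ω, Z ω) = (ω.2.2.2.2.1, ω.2.2.2.2.2.1)) :
    condEntropy (sourceLaw p pU) α β ≤
      condMutualInfo (outerLaw mac p pU (fun _ => (n : ℝ)⁻¹) (encoderKernel c.enc₁)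
        (encoderKernel c.enc₂)) V (fun (_, _, _, _, _, _, y) => y) Z + ε := by
  have hr := sourceLaw_mem hp hU
  have h1 := condEntropy_le_of_code (c := c) hn hmac hr α β hα
    (fun s s' h => hαβ s s' (Prod.mk.inj h).1 (Prod.mk.inj h).2) (fun ω => Z (timePoint c ω)) hZ
  rw [outerLaw_code hmac, condMutualInfo_law, condMutualInfo_eq]
  have h2 := condEntropy_le_of_imp (timeLaw_nonneg (c := c) hmac hr) (fun ω => ω.2.2 ω.1)
    (fun ω => (V (timePoint c ω), Z (timePoint c ω))) g
  simp only [hg] at h2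
  have h3 : (0 : ℝ) < n := by positivity
  refine le_of_mul_le_mul_left ?_ h3
  have h4 := mul_le_mul_of_nonneg_left h2 h3.le
  simp only [timePoint] at h1 h2 h4 ⊢
  linarith

/-! ### Distortions and error counts -/

open Classical in
theorem distortion₁_eq (hmac : ∀ x₁ x₂, mac x₁ x₂ ∈ stdSimplex ℝ Y)
    (hp : p ∈ stdSimplex ℝ (S₁ × S₂)) (c : Code S₁ S₂ X₁ X₂ Y S₁ S₂ n) (hn : 0 < n) :
    distortion₁ mac p hamming c = ENNReal.ofReal ((n : ℝ)⁻¹ * ∑ s, blockSource p (Fin n) s *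
      ∑ y, codeChannel mac c s y * ∑ t, if s.1 t = c.dec₁ y t then 0 else 1) := by
  have hB : ∀ s y, 0 ≤ blockSource p (Fin n) s * codeChannel mac c s y := fun s y =>
    mul_nonneg ((blockSource_mem hp).1 s) ((isCondPMF_codeChannel hmac s).1 y)
  rw [distortion₁, ENNReal.ofReal_mul (by positivity), ENNReal.ofReal_inv_of_pos (by positivity),
    ENNReal.ofReal_natCast]
  congr 1
  have h : ∑ s, blockSource p (Fin n) s *
      ∑ y, codeChannel mac c s y * ∑ t, (if s.1 t = c.dec₁ y t then (0 : ℝ) else 1) =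
      ∑ t, ∑ s₁, ∑ s₂, ∑ y, blockSource p (Fin n) (s₁, s₂) * codeChannel mac c (s₁, s₂) y *
        if s₁ t = c.dec₁ y t then 0 else 1 := by
    simp only [Finset.mul_sum, Fintype.sum_prod_type, mul_assoc]
    rw [Finset.sum_comm (s := (Finset.univ : Finset (Fin n)))]
    refine Finset.sum_congr rfl fun s₁ _ => ?_
    rw [Finset.sum_comm (s := (Finset.univ : Finset (Fin n)))]
    refine Finset.sum_congr rfl fun s₂ _ => ?_
    rw [Finset.sum_comm (s := (Finset.univ : Finset (Fin n)))]
  rw [h, ENNReal.ofReal_sum_of_nonneg]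
  swap
  · exact fun t _ => Finset.sum_nonneg fun s₁ _ => Finset.sum_nonneg fun s₂ _ =>
      Finset.sum_nonneg fun y _ => mul_nonneg (hB _ _) (by positivity)
  refine Finset.sum_congr rfl fun t _ => ?_
  rw [ENNReal.ofReal_sum_of_nonneg]
  swap
  · exact fun s₁ _ => Finset.sum_nonneg fun s₂ _ =>
      Finset.sum_nonneg fun y _ => mul_nonneg (hB _ _) (by positivity)
  refine Finset.sum_congr rfl fun s₁ _ => ?_
  rw [ENNReal.ofReal_sum_of_nonneg]
  swap
  · exact fun s₂ _ => Finset.sum_nonneg fun y _ => mul_nonneg (hB _ _) (by positivity)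
  refine Finset.sum_congr rfl fun s₂ _ => ?_
  rw [ENNReal.ofReal_sum_of_nonneg]
  swap
  · exact fun y _ => mul_nonneg (hB _ _) (by positivity)
  refine Finset.sum_congr rfl fun y _ => ?_
  rw [ENNReal.ofReal_mul (hB _ _)]
  congr 1
  rw [hamming]
  split_ifs <;> simp

/-- Exchange of the roles of the two sources. -/
def Code.swap (c : Code S₁ S₂ X₁ X₂ Y S₁ S₂ n) : Code S₂ S₁ X₂ X₁ Y S₂ S₁ n :=
  ⟨c.enc₂, c.enc₁, c.dec₂, c.dec₁⟩

theorem distortion₂_eq_swap (c : Code S₁ S₂ X₁ X₂ Y S₁ S₂ n) :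
    distortion₂ mac p hamming c =
      distortion₁ (fun x₂ x₁ => mac x₁ x₂) (fun s => p s.swap) hamming c.swap := by
  rw [distortion₁, distortion₂]
  congr 1
  refine Finset.sum_congr rfl fun t _ => ?_
  rw [Finset.sum_comm]
  rfl

theorem swap_mem_stdSimplex (hp : p ∈ stdSimplex ℝ (S₁ × S₂)) :
    (fun s : S₂ × S₁ => p s.swap) ∈ stdSimplex ℝ (S₂ × S₁) :=
  ⟨fun _ => hp.1 _, by rw [← hp.2]; exact (Equiv.prodComm S₂ S₁).sum_comp p⟩

open Classical in
theorem distortion₂_eq (hmac : ∀ x₁ x₂, mac x₁ x₂ ∈ stdSimplex ℝ Y)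
    (hp : p ∈ stdSimplex ℝ (S₁ × S₂)) (c : Code S₁ S₂ X₁ X₂ Y S₁ S₂ n) (hn : 0 < n) :
    distortion₂ mac p hamming c = ENNReal.ofReal ((n : ℝ)⁻¹ * ∑ s, blockSource p (Fin n) s *
      ∑ y, codeChannel mac c s y * ∑ t, if s.2 t = c.dec₂ y t then 0 else 1) := by
  rw [distortion₂_eq_swap, distortion₁_eq (fun x₂ x₁ => hmac x₁ x₂) (swap_mem_stdSimplex hp) _ hn,
    ← (Equiv.prodComm (Fin n → S₁) (Fin n → S₂)).sum_comp]
  rfl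

theorem sum_codeLaw_mul (hU : IsCondPMF pU) (c : Code S₁ S₂ X₁ X₂ Y S₁ S₂ n)
    (g : (Fin n → S₁) × (Fin n → S₂) → (Fin n → Y) → ℝ) :
    ∑ ω, codeLaw mac c (sourceLaw p pU) ω * g (sourceBlocks ω.1) ω.2 =
      ∑ s, blockSource p (Fin n) s * ∑ y, codeChannel mac c s y * g s y := by
  rw [sum_blockSource_mul, Fintype.sum_prod_type]
  have h := sum_law_mul (piLaw (Fin n) (sourceLaw p pU)) (fun s i => ((s i).1, (s i).2.1))
    fun s => ∑ y, codeChannel mac c (fun i => (s i).1, fun i => (s i).2) y *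
      g (fun i => (s i).1, fun i => (s i).2) y
  have h2 := law_piLaw (ι := Fin n) (sourceLaw p pU) fun s => (s.1, s.2.1)
  rw [h2, law_sourceLaw hU] at h
  refine Eq.trans ?_ h.symm
  simp only [codeLaw, Finset.mul_sum, mul_assoc, sourceBlocks]

theorem errorCount₁_eq (hmac : ∀ x₁ x₂, mac x₁ x₂ ∈ stdSimplex ℝ Y)
    (hp : p ∈ stdSimplex ℝ (S₁ × S₂)) (hU : IsCondPMF pU)
    (c : Code S₁ S₂ X₁ X₂ Y S₁ S₂ n) (hn : 0 < n) :
    distortion₁ mac p hamming c =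
      ENNReal.ofReal ((n : ℝ)⁻¹ * errorCount₁ mac c (sourceLaw p pU)) := by
  classical
  rw [distortion₁_eq hmac hp c hn, ← sum_codeLaw_mul hU c fun s y => ∑ t, if s.1 t = c.dec₁ y t
    then 0 else 1]
  rfl

theorem errorCount₂_eq (hmac : ∀ x₁ x₂, mac x₁ x₂ ∈ stdSimplex ℝ Y)
    (hp : p ∈ stdSimplex ℝ (S₁ × S₂)) (hU : IsCondPMF pU)
    (c : Code S₁ S₂ X₁ X₂ Y S₁ S₂ n) (hn : 0 < n) :
    distortion₂ mac p hamming c =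
      ENNReal.ofReal ((n : ℝ)⁻¹ * errorCount₂ mac c (sourceLaw p pU)) := by
  classical
  rw [distortion₂_eq hmac hp c hn, ← sum_codeLaw_mul hU c fun s y => ∑ t, if s.2 t = c.dec₂ y t
    then 0 else 1]
  rfl

theorem exists_code_of_mem_admissibleRegion (hmac : ∀ x₁ x₂, mac x₁ x₂ ∈ stdSimplex ℝ Y)
    (hp : p ∈ stdSimplex ℝ (S₁ × S₂)) (hU : IsCondPMF pU)
    (h : p ∈ admissibleRegion S₁ S₂ mac) {ε : ℝ} (hε : 0 < ε) :
    ∃ (n : ℕ) (c : Code S₁ S₂ X₁ X₂ Y S₁ S₂ n), 0 < n ∧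
      condEntropy (codeLaw mac c (sourceLaw p pU)) (fun ω => sourceBlocks ω.1)
        (fun ω => ω.2) ≤ n * ε := by
  obtain ⟨c, h1, h2⟩ := h
  -- The budget in Fano's inequality is ε/2 for the term -2 log(1 - δ), which δ = 1 - exp(-ε/4)
  -- meets exactly, and ε/4 for each of the two error counts.
  obtain ⟨δ, hδ0, hδ1, hδ⟩ : ∃ δ : ℝ, 0 < δ ∧ δ < 1 ∧ 2 * -Real.log (1 - δ) ≤ ε / 2 := by
    refine ⟨1 - Real.exp (-(ε / 4)), ?_, ?_, ?_⟩
    · have := Real.exp_lt_exp.2 (show -(ε / 4) < 0 by linarith)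
      rw [Real.exp_zero] at this
      linarith
    · linarith [Real.exp_pos (-(ε / 4))]
    · rw [sub_sub_cancel, Real.log_exp]
      linarith
  set L₁ := |Real.log (Fintype.card S₁ / δ)|
  set L₂ := |Real.log (Fintype.card S₂ / δ)|
  -- η bounds the per-letter error rates. The logarithmic factors depend on δ only, so δ is fixed
  -- before η.
  obtain ⟨η, hη, hη1, hη2⟩ : ∃ η : ℝ, 0 < η ∧ L₁ * η ≤ ε / 4 ∧ L₂ * η ≤ ε / 4 := by
    have p1 : 0 ≤ L₁ := abs_nonneg _
    have p2 : 0 ≤ L₂ := abs_nonneg _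
    refine ⟨ε / 4 / (L₁ + L₂ + 1), by positivity, ?_, ?_⟩
    · rw [mul_div_assoc', div_le_iff₀ (by positivity)]
      nlinarith
    · rw [mul_div_assoc', div_le_iff₀ (by positivity)]
      nlinarith
  have hη' : 0 < ENNReal.ofReal η := ENNReal.ofReal_pos.2 hη
  have e1 := eventually_lt_of_limsup_lt (lt_of_le_of_lt h1 hη')
  have e2 := eventually_lt_of_limsup_lt (lt_of_le_of_lt h2 hη')
  obtain ⟨n, h1, h2, hn⟩ := (e1.and (e2.and (eventually_gt_atTop 0))).exists
  refine ⟨n, c n, hn, (condEntropy_sourceBlocks_le hmac (sourceLaw_mem hp hU) hδ0 hδ1).trans ?_⟩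
  rw [errorCount₁_eq hmac hp hU _ hn, ENNReal.ofReal_lt_ofReal_iff hη] at h1
  rw [errorCount₂_eq hmac hp hU _ hn, ENNReal.ofReal_lt_ofReal_iff hη] at h2
  have hn' : (0 : ℝ) < n := by positivity
  rw [inv_mul_lt_iff₀ hn'] at h1 h2
  have b : ∀ {x L E : ℝ}, 0 ≤ E → E < n * η → |x| = L → L * η ≤ ε / 4 → x * E ≤ n * (ε / 4) := by
    intro x L E hE0 hE hx hL
    have h1 : x ≤ L := hx ▸ le_abs_self x
    have h2 : 0 ≤ L := hx ▸ abs_nonneg x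
    calc x * E ≤ L * E := mul_le_mul_of_nonneg_right h1 hE0
      _ ≤ L * (n * η) := mul_le_mul_of_nonneg_left hE.le h2
      _ = n * (L * η) := by ring
      _ ≤ n * (ε / 4) := mul_le_mul_of_nonneg_left hL hn'.le
  have n1 : 0 ≤ errorCount₁ mac (c n) (sourceLaw p pU) := Finset.sum_nonneg fun ω _ =>
    mul_nonneg (codeLaw_nonneg hmac (sourceLaw_mem hp hU) ω)
      (Finset.sum_nonneg fun t _ => by positivity)
  have n2 : 0 ≤ errorCount₂ mac (c n) (sourceLaw p pU) := Finset.sum_nonneg fun ω _ =>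
    mul_nonneg (codeLaw_nonneg hmac (sourceLaw_mem hp hU) ω)
      (Finset.sum_nonneg fun t _ => by positivity)
  have b1 := b n1 h1 rfl hη1
  have b2 := b n2 h2 rfl hη2
  have b3 := mul_le_mul_of_nonneg_left hδ hn'.le
  linarith

omit [Fintype S₁] [Fintype S₂] [Fintype 𝓤] [Fintype Y] in
theorem condEntropy_unit {Ω A : Type*} [Fintype Ω] [Fintype A] {P : Ω → ℝ}
    (hP : P ∈ stdSimplex ℝ Ω) (X : Ω → A) : condEntropy P X (fun _ => ()) = entropy P X := by
  have h1 : entropy P (fun ω => (X ω, ())) = entropy P X := entropy_congr fun _ _ _ _ => by simp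
  have h2 : entropy P (fun _ => ()) = 0 := by simp [entropy, law, hP.2]
  rw [condEntropy, h1, h2, sub_zero]

set_option linter.unusedSimpArgs false in
-- One code serves all seven inequalities: the side information β is successively trivial, S₂, S₁,
-- S₀, (S₀,U), (S₂,U), (S₁,U).
theorem mem_outerBound_of_mem_admissibleRegion {S₀ : Type*} [Fintype X₁] [Fintype X₂] [Fintype S₀]
    (hmac : ∀ x₁ x₂, mac x₁ x₂ ∈ stdSimplex ℝ Y)
    (hp : p ∈ stdSimplex ℝ (S₁ × S₂)) (f₁ : S₁ → S₀)
    (h : p ∈ admissibleRegion S₁ S₂ mac) : p ∈ outerBound mac f₁ := by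
  intro l pU hU _ ε hε
  obtain ⟨n, c, hn, hc⟩ := exists_code_of_mem_admissibleRegion hmac hp hU h hε
  have hn' : (n : ℝ) ≠ 0 := by positivity
  refine ⟨n, n, fun _ => (n : ℝ)⁻¹, encoderKernel c.enc₁, encoderKernel c.enc₂, hn,
    ⟨fun _ => by positivity, by simp [hn']⟩, isCondPMF_encoderKernel _, isCondPMF_encoderKernel _,
    ?_, ?_, ?_, ?_, ?_, ?_, ?_⟩
  · rw [← condEntropy_unit (sourceLaw_mem hp hU)]
    exact condEntropy_le_condMutualInfo_outerLaw hn hmac hp hU c hc _ _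
      (by rintro ⟨⟩ ⟨⟩; simp +contextual) (by rintro ⟨⟩ ⟨⟩; simp +contextual) _ _
      (fun ω ω' => ⟨fun h => by
        simp only [timePoint, sourceBlocks, Function.comp_def, Prod.mk.injEq, funext_iff] at h
        simp [h], fun h => by
        have h2 := h.2
        simp only [Prod.mk.injEq, forall_and, ← funext_iff] at h2
        simp [timePoint, sourceBlocks, Function.comp_def, h.1, h2]⟩) (fun z => z.1) (fun _ => rfl)
  · exact condEntropy_le_condMutualInfo_outerLaw hn hmac hp hU c hc _ _
      (by rintro ⟨⟩ ⟨⟩; simp +contextual) (by rintro ⟨⟩ ⟨⟩; simp +contextual) _ _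
      (fun ω ω' => ⟨fun h => by
        simp only [timePoint, sourceBlocks, Function.comp_def, Prod.mk.injEq, funext_iff] at h
        simp [h], fun h => by
        have h2 := h.2
        simp only [Prod.mk.injEq, forall_and, ← funext_iff] at h2
        simp [timePoint, sourceBlocks, Function.comp_def, h.1, h2]⟩) (fun z => (z.1, z.2.1)) (fun _ => rfl)
  · exact condEntropy_le_condMutualInfo_outerLaw hn hmac hp hU c hc _ _
      (by rintro ⟨⟩ ⟨⟩; simp +contextual) (by rintro ⟨⟩ ⟨⟩; simp +contextual) _ _
      (fun ω ω' => ⟨fun h => by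
        simp only [timePoint, sourceBlocks, Function.comp_def, Prod.mk.injEq, funext_iff] at h
        simp [h], fun h => by
        have h2 := h.2
        simp only [Prod.mk.injEq, forall_and, ← funext_iff] at h2
        simp [timePoint, sourceBlocks, Function.comp_def, h.1, h2]⟩) (fun z => (z.2.1, z.1)) (fun _ => rfl)
  · exact condEntropy_le_condMutualInfo_outerLaw hn hmac hp hU c hc _ _
      (by rintro ⟨⟩ ⟨⟩; simp +contextual) (by rintro ⟨⟩ ⟨⟩; simp +contextual) _ _
      (fun ω ω' => ⟨fun h => by
        simp only [timePoint, sourceBlocks, Function.comp_def, Prod.mk.injEq, funext_iff] at h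
        simp [h], fun h => by
        have h2 := h.2
        simp only [Prod.mk.injEq, forall_and, ← funext_iff] at h2
        simp [timePoint, sourceBlocks, Function.comp_def, h.1, h2]⟩) (fun z => z.1) (fun _ => rfl)
  · exact condEntropy_le_condMutualInfo_outerLaw hn hmac hp hU c hc _ _
      (by rintro ⟨⟩ ⟨⟩; simp +contextual) (by rintro ⟨⟩ ⟨⟩; simp +contextual) _ _
      (fun ω ω' => ⟨fun h => by
        simp only [timePoint, sourceBlocks, Function.comp_def, Prod.mk.injEq, funext_iff] at h
        simp [h], fun h => by
        have h2 := h.2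
        simp only [Prod.mk.injEq, forall_and, ← funext_iff] at h2
        simp [timePoint, sourceBlocks, Function.comp_def, h.1, h2]⟩) (fun z => z.1) (fun _ => rfl)
  · exact condEntropy_le_condMutualInfo_outerLaw hn hmac hp hU c hc _ _
      (by rintro ⟨⟩ ⟨⟩; simp +contextual) (by rintro ⟨⟩ ⟨⟩; simp +contextual) _ _
      (fun ω ω' => ⟨fun h => by
        simp only [timePoint, sourceBlocks, Function.comp_def, Prod.mk.injEq, funext_iff] at h
        simp [h], fun h => by
        have h2 := h.2
        simp only [Prod.mk.injEq, forall_and, ← funext_iff] at h2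
        simp [timePoint, sourceBlocks, Function.comp_def, h.1, h2]⟩) (fun z => (z.1, z.2.1)) (fun _ => rfl)
  · exact condEntropy_le_condMutualInfo_outerLaw hn hmac hp hU c hc _ _
      (by rintro ⟨⟩ ⟨⟩; simp +contextual) (by rintro ⟨⟩ ⟨⟩; simp +contextual) _ _
      (fun ω ω' => ⟨fun h => by
        simp only [timePoint, sourceBlocks, Function.comp_def, Prod.mk.injEq, funext_iff] at h
        simp [h], fun h => by
        have h2 := h.2
        simp only [Prod.mk.injEq, forall_and, ← funext_iff] at h2
        simp [timePoint, sourceBlocks, Function.comp_def, h.1, h2]⟩) (fun z => (z.2.1, z.1)) (fun _ => rfl)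

end Converse

/-! ### Random coding for a single use of a multiple access channel -/

section OneShot

theorem exists_le_of_sum_mul_le {Ω : Type*} [Fintype Ω] {w e : Ω → ℝ} {t : ℝ}
    (hw : w ∈ stdSimplex ℝ Ω) (h : ∑ ω, w ω * e ω ≤ t) : ∃ ω, e ω ≤ t := by
  by_contra! hlt
  obtain ⟨ω₀, -, hω₀⟩ := Finset.exists_ne_zero_of_sum_ne_zero (hw.2.trans_ne one_ne_zero)
  have h1 : ∑ ω, w ω * t < ∑ ω, w ω * e ω :=
    Finset.sum_lt_sum (fun ω _ => mul_le_mul_of_nonneg_left (hlt ω).le (hw.1 ω))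
      ⟨ω₀, Finset.mem_univ _, mul_lt_mul_of_pos_left (hlt ω₀) (lt_of_le_of_ne (hw.1 _) hω₀.symm)⟩
  rw [← Finset.sum_mul, hw.2, one_mul] at h1
  linarith

open Classical in
-- A change of measure. With z transmitted and z' an independent competitor, y follows the averaged
-- output law; wherever z' is accepted, the test bounds this law by q/γ times the output law of z',
-- which has total mass 1.
theorem sum_pair_le {Z Y : Type*} [Fintype Z] [Fintype Y] {μ : Z → ℝ} (hμ : μ ∈ stdSimplex ℝ Z)
    {ρ : Z → Y → ℝ} (hρ : IsCondPMF ρ) {q γ : ℝ} (hq : 0 ≤ q) (hγ : 0 < γ) {G : Z → Y → Prop}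
    (hG : ∀ z y, G z y → γ * ∑ z', μ z' * ρ z' y ≤ q * ρ z y) :
    ∑ z, ∑ z', μ z * μ z' * ∑ y, ρ z y * (if G z' y then 1 else 0) ≤ q / γ := by
  calc ∑ z, ∑ z', μ z * μ z' * ∑ y, ρ z y * (if G z' y then 1 else 0)
      = ∑ z', μ z' * ∑ y, (∑ z, μ z * ρ z y) * (if G z' y then 1 else 0) := by
        rw [Finset.sum_comm]
        refine Finset.sum_congr rfl fun z' _ => ?_
        simp only [Finset.mul_sum, Finset.sum_mul]
        rw [Finset.sum_comm]
        exact Finset.sum_congr rfl fun y _ => Finset.sum_congr rfl fun z _ => by ring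
    _ ≤ ∑ z', μ z' * ∑ y, q / γ * ρ z' y := by
        refine Finset.sum_le_sum fun z' _ => mul_le_mul_of_nonneg_left ?_ (hμ.1 z')
        refine Finset.sum_le_sum fun y _ => ?_
        split_ifs with h
        · have := hG z' y h
          rw [mul_one, div_mul_eq_mul_div, le_div_iff₀ hγ]
          linarith
        · rw [mul_zero]
          exact mul_nonneg (by positivity) ((hρ _).1 _)
    _ = q / γ := by simp [← Finset.mul_sum, (hρ _).2, ← Finset.sum_mul, hμ.2]

variable {S₀ S₁ S₂ V X₁ X₂ Y : Type*} [Fintype S₀] [Fintype S₁] [Fintype S₂] [Fintype V]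
  [Fintype X₁] [Fintype X₂] [Fintype Y] [DecidableEq S₀] [DecidableEq S₁] [DecidableEq S₂]

/-- The law of the output given the auxiliary variable and the second input, the auxiliary variable
and the first input, the auxiliary variable, and nothing. -/
def outputGiven (r : X₁ → X₂ → Y → ℝ) (w : V → ℝ) (a : V → X₁ → ℝ) (b : V → X₂ → ℝ) :
    Fin 4 → V → X₁ → X₂ → Y → ℝ
  | 0, v, _, x₂, y => ∑ x₁, a v x₁ * r x₁ x₂ y
  | 1, v, x₁, _, y => ∑ x₂, b v x₂ * r x₁ x₂ y
  | 2, v, _, _, y => outputLaw r (a v) (b v) y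
  | 3, _, _, _, y => ∑ v, w v * outputLaw r (a v) (b v) y

/-- The ways in which a pair of source values can be confused with another one. -/
def Confusable (F₁ : S₁ → S₀) : Fin 4 → S₁ × S₂ → S₁ × S₂ → Prop
  | 0, s, s' => s' ≠ s ∧ s'.2 = s.2
  | 1, s, s' => s' ≠ s ∧ s'.1 = s.1
  | 2, s, s' => s' ≠ s ∧ F₁ s'.1 = F₁ s.1
  | 3, s, s' => s' ≠ s

/-- The threshold test of the decoder. -/
def Accepts (r : X₁ → X₂ → Y → ℝ) (w : V → ℝ) (a : V → X₁ → ℝ) (b : V → X₂ → ℝ) (F₁ : S₁ → S₀)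
    (F₂ : S₂ → S₀) (Q : Fin 4 → S₁ × S₂ → ℝ) (γ : Fin 4 → ℝ) (s : S₁ × S₂) (v : V) (x₁ : X₁)
    (x₂ : X₂) (y : Y) : Prop :=
  F₁ s.1 = F₂ s.2 ∧ ∀ j, γ j * outputGiven r w a b j v x₁ x₂ y ≤ Q j s * r x₁ x₂ y

/-- The probability of a random codebook. -/
def codebookLaw (w : V → ℝ) (a : V → X₁ → ℝ) (b : V → X₂ → ℝ) (F₁ : S₁ → S₀)
    (F₂ : S₂ → S₀) : (S₀ → V) × (S₁ → X₁) × (S₂ → X₂) → ℝ :=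
  fun c => (∏ s₀, w (c.1 s₀)) *
    ((∏ s₁, a (c.1 (F₁ s₁)) (c.2.1 s₁)) * ∏ s₂, b (c.1 (F₂ s₂)) (c.2.2 s₂))

variable {r : X₁ → X₂ → Y → ℝ} {w : V → ℝ} {a : V → X₁ → ℝ} {b : V → X₂ → ℝ} {F₁ : S₁ → S₀}
  {F₂ : S₂ → S₀} {Q : Fin 4 → S₁ × S₂ → ℝ} {γ : Fin 4 → ℝ}

theorem sum_codebookLaw_mul (g : (S₀ → V) × (S₁ → X₁) × (S₂ → X₂) → ℝ) :
    ∑ c, codebookLaw w a b F₁ F₂ c * g c = ∑ cV : S₀ → V, (∏ s₀, w (cV s₀)) *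
      ∑ c₁ : S₁ → X₁, (∏ s₁, a (cV (F₁ s₁)) (c₁ s₁)) *
        ∑ c₂ : S₂ → X₂, (∏ s₂, b (cV (F₂ s₂)) (c₂ s₂)) * g (cV, c₁, c₂) := by
  simp only [Fintype.sum_prod_type, codebookLaw, Finset.mul_sum, mul_assoc]

theorem sum_codebookLaw_mul' (g : (S₀ → V) × (S₁ → X₁) × (S₂ → X₂) → ℝ) :
    ∑ c, codebookLaw w a b F₁ F₂ c * g c = ∑ cV : S₀ → V, (∏ s₀, w (cV s₀)) *
      ∑ c₂ : S₂ → X₂, (∏ s₂, b (cV (F₂ s₂)) (c₂ s₂)) *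
        ∑ c₁ : S₁ → X₁, (∏ s₁, a (cV (F₁ s₁)) (c₁ s₁)) * g (cV, c₁, c₂) := by
  rw [sum_codebookLaw_mul]
  refine Finset.sum_congr rfl fun cV _ => ?_
  congr 1
  simp only [Finset.mul_sum]
  rw [Finset.sum_comm]
  exact Finset.sum_congr rfl fun c₂ _ => Finset.sum_congr rfl fun c₁ _ => by ring

theorem sum_mul_le_of_le {Ω : Type*} [Fintype Ω] {μ g : Ω → ℝ} {t : ℝ}
    (hμ : μ ∈ stdSimplex ℝ Ω) (h : ∀ ω, g ω ≤ t) : ∑ ω, μ ω * g ω ≤ t := by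
  calc ∑ ω, μ ω * g ω ≤ ∑ ω, μ ω * t :=
        Finset.sum_le_sum fun ω _ => mul_le_mul_of_nonneg_left (h ω) (hμ.1 ω)
    _ = t := by rw [← Finset.sum_mul, hμ.2, one_mul]

theorem prod_mem_stdSimplex {ι A : Type*} [Fintype ι] [DecidableEq ι] [Fintype A] {q : ι → A → ℝ}
    (hq : ∀ i, q i ∈ stdSimplex ℝ A) : (fun c : ι → A => ∏ i, q i (c i)) ∈ stdSimplex ℝ (ι → A) :=
  ⟨fun _ => Finset.prod_nonneg fun i _ => (hq i).1 _, sum_prod_eq_one fun i => (hq i).2⟩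

theorem codebookLaw_mem (hw : w ∈ stdSimplex ℝ V) (ha : IsCondPMF a) (hb : IsCondPMF b) :
    codebookLaw w a b F₁ F₂ ∈ stdSimplex ℝ ((S₀ → V) × (S₁ → X₁) × (S₂ → X₂)) := by
  refine ⟨fun c => mul_nonneg (Finset.prod_nonneg fun _ _ => hw.1 _)
    (mul_nonneg (Finset.prod_nonneg fun _ _ => (ha _).1 _)
      (Finset.prod_nonneg fun _ _ => (hb _).1 _)), ?_⟩
  have h := sum_codebookLaw_mul (w := w) (a := a) (b := b) (F₁ := F₁) (F₂ := F₂) fun _ => 1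
  simp only [mul_one] at h
  rw [h]
  have h1 : ∀ cV : S₀ → V, ∑ c₂ : S₂ → X₂, (∏ s₂, b (cV (F₂ s₂)) (c₂ s₂)) = 1 := fun cV =>
    sum_prod_eq_one (q := fun s₂ => b (cV (F₂ s₂))) fun _ => (hb _).2
  have h2 : ∀ cV : S₀ → V, ∑ c₁ : S₁ → X₁, (∏ s₁, a (cV (F₁ s₁)) (c₁ s₁)) = 1 := fun cV =>
    sum_prod_eq_one (q := fun s₁ => a (cV (F₁ s₁))) fun _ => (ha _).2
  simp only [h1, h2, mul_one]
  exact sum_prod_eq_one fun _ => hw.2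

/-- The expectation over the codebook of a function of the codewords of one source pair. -/
theorem sum_codebookLaw_apply (hw : w ∈ stdSimplex ℝ V) (ha : IsCondPMF a) (hb : IsCondPMF b)
    {s : S₁ × S₂} (hs : F₁ s.1 = F₂ s.2) (φ : V → X₁ → X₂ → ℝ) :
    ∑ c, codebookLaw w a b F₁ F₂ c * φ (c.1 (F₁ s.1)) (c.2.1 s.1) (c.2.2 s.2) =
      ∑ v, w v * ∑ x₁, a v x₁ * ∑ x₂, b v x₂ * φ v x₁ x₂ := by
  rw [sum_codebookLaw_mul, ← sum_prod_mul_apply (q := fun _ : S₀ => w) (fun _ => hw.2) (F₁ s.1)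
    fun v => ∑ x₁, a v x₁ * ∑ x₂, b v x₂ * φ v x₁ x₂]
  refine Finset.sum_congr rfl fun cV _ => ?_
  congr 1
  rw [← sum_prod_mul_apply (q := fun s₁ => a (cV (F₁ s₁))) (fun _ => (ha _).2) s.1
    fun x₁ => ∑ x₂, b (cV (F₁ s.1)) x₂ * φ (cV (F₁ s.1)) x₁ x₂]
  refine Finset.sum_congr rfl fun c₁ _ => ?_
  congr 1
  rw [hs, ← sum_prod_mul_apply (q := fun s₂ => b (cV (F₂ s₂))) (fun _ => (hb _).2) s.2]

open Classical in
/-- The probability that the decoder accepts `s'` when `s` has been sent. -/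
def acceptMass (r : X₁ → X₂ → Y → ℝ) (w : V → ℝ) (a : V → X₁ → ℝ) (b : V → X₂ → ℝ) (F₁ : S₁ → S₀)
    (F₂ : S₂ → S₀) (Q : Fin 4 → S₁ × S₂ → ℝ) (γ : Fin 4 → ℝ) (s s' : S₁ × S₂)
    (c : (S₀ → V) × (S₁ → X₁) × (S₂ → X₂)) : ℝ :=
  ∑ y, r (c.2.1 s.1) (c.2.2 s.2) y *
    if Accepts r w a b F₁ F₂ Q γ s' (c.1 (F₁ s'.1)) (c.2.1 s'.1) (c.2.2 s'.2) y then 1 else 0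

/-- The two source pairs share the second codeword and the auxiliary symbol. Given these, the
codewords of the two first components are independent, and test 0 compares with exactly this
conditioning. -/
theorem sum_acceptMass_le₀ (hr : ∀ x₁ x₂, r x₁ x₂ ∈ stdSimplex ℝ Y) (hw : w ∈ stdSimplex ℝ V)
    (ha : IsCondPMF a) (hb : IsCondPMF b) (hQ : ∀ j s, 0 ≤ Q j s) (hγ : ∀ j, 0 < γ j)
    {s s' : S₁ × S₂} (hF : F₁ s.1 = F₁ s'.1) (h2 : s'.2 = s.2) (h1 : s'.1 ≠ s.1) :
    ∑ c, codebookLaw w a b F₁ F₂ c * acceptMass r w a b F₁ F₂ Q γ s s' c ≤ Q 0 s' / γ 0 := by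
  classical
  rw [sum_codebookLaw_mul']
  refine sum_mul_le_of_le (prod_mem_stdSimplex fun _ => hw) fun cV => ?_
  refine sum_mul_le_of_le (prod_mem_stdSimplex fun _ => hb _) fun c₂ => ?_
  simp only [acceptMass, h2, ← hF]
  rw [sum_prod_mul_apply₂ (q := fun s₁ => a (cV (F₁ s₁))) (fun _ => (ha _).2) h1.symm
    fun x₁ x₁' => ∑ y, r x₁ (c₂ s.2) y * if Accepts r w a b F₁ F₂ Q γ s' (cV (F₁ s.1)) x₁'
      (c₂ s.2) y then 1 else 0, ← hF]
  exact sum_pair_le (ha _) (ρ := fun x₁ => r x₁ (c₂ s.2)) (fun _ => hr _ _) (hQ _ _) (hγ _)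
    fun x₁ y h => h.2 0

theorem sum_acceptMass_le₁ (hr : ∀ x₁ x₂, r x₁ x₂ ∈ stdSimplex ℝ Y) (hw : w ∈ stdSimplex ℝ V)
    (ha : IsCondPMF a) (hb : IsCondPMF b) (hQ : ∀ j s, 0 ≤ Q j s) (hγ : ∀ j, 0 < γ j)
    {s s' : S₁ × S₂} (hs : F₁ s.1 = F₂ s.2) (hs' : F₁ s'.1 = F₂ s'.2) (h1 : s'.1 = s.1)
    (h2 : s'.2 ≠ s.2) :
    ∑ c, codebookLaw w a b F₁ F₂ c * acceptMass r w a b F₁ F₂ Q γ s s' c ≤ Q 1 s' / γ 1 := by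
  classical
  rw [sum_codebookLaw_mul]
  refine sum_mul_le_of_le (prod_mem_stdSimplex fun _ => hw) fun cV => ?_
  refine sum_mul_le_of_le (prod_mem_stdSimplex fun _ => ha _) fun c₁ => ?_
  simp only [acceptMass, h1]
  rw [sum_prod_mul_apply₂ (q := fun s₂ => b (cV (F₂ s₂))) (fun _ => (hb _).2) h2.symm
    fun x₂ x₂' => ∑ y, r (c₁ s.1) x₂ y * if Accepts r w a b F₁ F₂ Q γ s' (cV (F₁ s.1)) (c₁ s.1)
      x₂' y then 1 else 0, ← hs', h1, ← hs]
  exact sum_pair_le (hb _) (ρ := fun x₂ => r (c₁ s.1) x₂) (fun _ => hr _ _) (hQ _ _) (hγ _)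
    fun x₂ y h => h.2 1

omit [Fintype S₀] [Fintype V] [DecidableEq S₀] in
-- When both components differ, the transmitted pair of codewords and the competing pair are
-- independent given the auxiliary symbols.
theorem sum_acceptMass_inner (ha : IsCondPMF a) (hb : IsCondPMF b) {s s' : S₁ × S₂}
    (h1 : s'.1 ≠ s.1) (h2 : s'.2 ≠ s.2) (cV : S₀ → V) (φ : X₁ × X₂ → X₁ × X₂ → ℝ) :
    ∑ c₁ : S₁ → X₁, (∏ s₁, a (cV (F₁ s₁)) (c₁ s₁)) *
        ∑ c₂ : S₂ → X₂, (∏ s₂, b (cV (F₂ s₂)) (c₂ s₂)) *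
          φ (c₁ s.1, c₂ s.2) (c₁ s'.1, c₂ s'.2) =
      ∑ z : X₁ × X₂, ∑ z' : X₁ × X₂, a (cV (F₁ s.1)) z.1 * b (cV (F₂ s.2)) z.2 *
        (a (cV (F₁ s'.1)) z'.1 * b (cV (F₂ s'.2)) z'.2) * φ z z' := by
  have e : ∀ c₁ : S₁ → X₁, ∑ c₂ : S₂ → X₂, (∏ s₂, b (cV (F₂ s₂)) (c₂ s₂)) *
      φ (c₁ s.1, c₂ s.2) (c₁ s'.1, c₂ s'.2) = ∑ x₂, ∑ x₂', b (cV (F₂ s.2)) x₂ *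
        b (cV (F₂ s'.2)) x₂' * φ (c₁ s.1, x₂) (c₁ s'.1, x₂') := fun c₁ =>
    sum_prod_mul_apply₂ (q := fun s₂ => b (cV (F₂ s₂))) (fun _ => (hb _).2) h2.symm
      fun x₂ x₂' => φ (c₁ s.1, x₂) (c₁ s'.1, x₂')
  simp only [e]
  rw [sum_prod_mul_apply₂ (q := fun s₁ => a (cV (F₁ s₁))) (fun _ => (ha _).2) h1.symm
    fun x₁ x₁' => ∑ x₂, ∑ x₂', b (cV (F₂ s.2)) x₂ * b (cV (F₂ s'.2)) x₂' * φ (x₁, x₂) (x₁', x₂')]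
  simp only [Fintype.sum_prod_type, Finset.mul_sum]
  refine Finset.sum_congr rfl fun x₁ _ => ?_
  rw [Finset.sum_comm]
  exact Finset.sum_congr rfl fun x₂ _ => Finset.sum_congr rfl fun x₁' _ =>
    Finset.sum_congr rfl fun x₂' _ => by ring

theorem mul_mem_stdSimplex {A B : Type*} [Fintype A] [Fintype B] {μ : A → ℝ} {ν : A → B → ℝ}
    (hμ : μ ∈ stdSimplex ℝ A) (hν : IsCondPMF ν) :
    (fun z : A × B => μ z.1 * ν z.1 z.2) ∈ stdSimplex ℝ (A × B) :=
  ⟨fun z => mul_nonneg (hμ.1 _) ((hν _).1 _), by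
    simp [Fintype.sum_prod_type, ← Finset.mul_sum, (hν _).2, hμ.2]⟩

/-- The two source pairs have the same common part, hence the same auxiliary symbol; only the two
inputs are drawn afresh, which is the situation of test 2. -/
theorem sum_acceptMass_le₂ (hr : ∀ x₁ x₂, r x₁ x₂ ∈ stdSimplex ℝ Y) (hw : w ∈ stdSimplex ℝ V)
    (ha : IsCondPMF a) (hb : IsCondPMF b) (hQ : ∀ j s, 0 ≤ Q j s) (hγ : ∀ j, 0 < γ j)
    {s s' : S₁ × S₂} (hs : F₁ s.1 = F₂ s.2) (hs' : F₁ s'.1 = F₂ s'.2) (hF : F₁ s'.1 = F₁ s.1)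
    (h1 : s'.1 ≠ s.1) (h2 : s'.2 ≠ s.2) :
    ∑ c, codebookLaw w a b F₁ F₂ c * acceptMass r w a b F₁ F₂ Q γ s s' c ≤ Q 2 s' / γ 2 := by
  classical
  rw [sum_codebookLaw_mul]
  refine sum_mul_le_of_le (prod_mem_stdSimplex fun _ => hw) fun cV => ?_
  simp only [acceptMass]
  rw [sum_acceptMass_inner ha hb h1 h2 cV fun z z' => ∑ y, r z.1 z.2 y *
    if Accepts r w a b F₁ F₂ Q γ s' (cV (F₁ s'.1)) z'.1 z'.2 y then 1 else 0, ← hs', hF, ← hs]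
  refine sum_pair_le (mul_mem_stdSimplex (ha _) fun _ => hb _) (ρ := fun z => r z.1 z.2)
    (fun _ => hr _ _) (hQ _ _) (hγ _) fun z y h => ?_
  have := h.2 2
  simpa only [outputGiven, outputLaw, Fintype.sum_prod_type] using this

/-- Different common parts force both components to differ and have independent auxiliary symbols,
so the competitor is wholly independent of what is sent. Test 3 compares with the unconditional
output law. -/
theorem sum_acceptMass_le₃ (hr : ∀ x₁ x₂, r x₁ x₂ ∈ stdSimplex ℝ Y) (hw : w ∈ stdSimplex ℝ V)
    (ha : IsCondPMF a) (hb : IsCondPMF b) (hQ : ∀ j s, 0 ≤ Q j s) (hγ : ∀ j, 0 < γ j)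
    {s s' : S₁ × S₂} (hs : F₁ s.1 = F₂ s.2) (hs' : F₁ s'.1 = F₂ s'.2) (hF : F₁ s'.1 ≠ F₁ s.1) :
    ∑ c, codebookLaw w a b F₁ F₂ c * acceptMass r w a b F₁ F₂ Q γ s s' c ≤ Q 3 s' / γ 3 := by
  classical
  have h1 : s'.1 ≠ s.1 := fun h => hF (by rw [h])
  have h2 : s'.2 ≠ s.2 := fun h => hF (by rw [hs, hs', h])
  rw [sum_codebookLaw_mul]
  simp only [acceptMass]
  have e : ∀ cV : S₀ → V, _ := fun cV =>
    sum_acceptMass_inner (F₁ := F₁) (F₂ := F₂) ha hb h1 h2 cV fun z z' => ∑ y, r z.1 z.2 y *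
      if Accepts r w a b F₁ F₂ Q γ s' (cV (F₁ s'.1)) z'.1 z'.2 y then 1 else 0
  simp only [e]
  simp only [← hs, ← hs']
  rw [sum_prod_mul_apply₂ (q := fun _ : S₀ => w) (fun _ => hw.2) hF.symm fun v v' =>
    ∑ z : X₁ × X₂, ∑ z' : X₁ × X₂, a v z.1 * b v z.2 *
        (a v' z'.1 * b v' z'.2) * ∑ y, r z.1 z.2 y *
      if Accepts r w a b F₁ F₂ Q γ s' v' z'.1 z'.2 y then 1 else 0]
  have hm := mul_mem_stdSimplex hw fun v => mul_mem_stdSimplex (ha v) fun _ => hb v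
  have := sum_pair_le hm (ρ := fun z => r z.2.1 z.2.2)
    (fun _ => hr _ _) (hQ 3 s') (hγ 3)
    (G := fun z y => Accepts r w a b F₁ F₂ Q γ s' z.1 z.2.1 z.2.2 y) fun z y h => by
      have := h.2 3
      simpa only [outputGiven, outputLaw, Fintype.sum_prod_type, Finset.mul_sum, mul_assoc] using this
  refine le_trans (le_of_eq ?_) this
  rw [Fintype.sum_prod_type]
  refine Finset.sum_congr rfl fun v _ => ?_
  simp only [Finset.mul_sum]
  rw [Finset.sum_comm]
  refine Finset.sum_congr rfl fun z _ => ?_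
  rw [Fintype.sum_prod_type]
  exact Finset.sum_congr rfl fun v' _ => Finset.sum_congr rfl fun z' _ =>
    Finset.sum_congr rfl fun y _ => by ring

open Classical in
-- Each competitor falls into one of the four cases above; the other confusion terms on the right
-- are nonnegative.
theorem sum_acceptMass_le (hr : ∀ x₁ x₂, r x₁ x₂ ∈ stdSimplex ℝ Y) (hw : w ∈ stdSimplex ℝ V)
    (ha : IsCondPMF a) (hb : IsCondPMF b) (hQ : ∀ j s, 0 ≤ Q j s) (hγ : ∀ j, 0 < γ j)
    {s s' : S₁ × S₂} (hs : F₁ s.1 = F₂ s.2) (hs' : F₁ s'.1 = F₂ s'.2) (hne : s' ≠ s) :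
    ∑ c, codebookLaw w a b F₁ F₂ c * acceptMass r w a b F₁ F₂ Q γ s s' c ≤
      ∑ j, if Confusable F₁ j s s' then Q j s' / γ j else 0 := by
  have key : ∀ j, Confusable F₁ j s s' → Q j s' / γ j ≤
      ∑ j, if Confusable F₁ j s s' then Q j s' / γ j else 0 := fun j hj => by
    have := Finset.single_le_sum (f := fun j => if Confusable F₁ j s s' then Q j s' / γ j else 0)
      (fun j _ => by
        have := div_nonneg (hQ j s') (hγ j).le
        split_ifs <;> simp [this]) (Finset.mem_univ j)
    simpa only [hj, if_true] using this
  by_cases h2 : s'.2 = s.2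
  · have h1 : s'.1 ≠ s.1 := fun h1 => hne (Prod.ext h1 h2)
    exact (sum_acceptMass_le₀ hr hw ha hb hQ hγ (by rw [hs, hs', h2]) h2 h1).trans
      (key 0 ⟨hne, h2⟩)
  by_cases h1 : s'.1 = s.1
  · exact (sum_acceptMass_le₁ hr hw ha hb hQ hγ hs hs' h1 h2).trans (key 1 ⟨hne, h1⟩)
  by_cases hF : F₁ s'.1 = F₁ s.1
  · exact (sum_acceptMass_le₂ hr hw ha hb hQ hγ hs hs' hF h1 h2).trans (key 2 ⟨hne, hF⟩)
  · exact (sum_acceptMass_le₃ hr hw ha hb hQ hγ hs hs' hF).trans (key 3 hne)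

open Classical in
/-- The decoder that looks for a source pair passing the threshold test. -/
def thresholdDecoder (r : X₁ → X₂ → Y → ℝ) (w : V → ℝ) (a : V → X₁ → ℝ) (b : V → X₂ → ℝ)
    (F₁ : S₁ → S₀) (F₂ : S₂ → S₀) (Q : Fin 4 → S₁ × S₂ → ℝ) (γ : Fin 4 → ℝ) (s₀ : S₁ × S₂)
    (c : (S₀ → V) × (S₁ → X₁) × (S₂ → X₂)) (y : Y) : S₁ × S₂ :=
  if h : ∃ s : S₁ × S₂, Accepts r w a b F₁ F₂ Q γ s (c.1 (F₁ s.1)) (c.2.1 s.1) (c.2.2 s.2) y then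
    h.choose else s₀

omit [Fintype S₀] in
open Classical in
-- A wrong decision means that the true pair fails the test or that some other pair passes it.
-- Passing includes agreement of the common parts, so other competitors need not be counted.
theorem decoderError_le (hr : ∀ x₁ x₂, r x₁ x₂ ∈ stdSimplex ℝ Y) (s₀ s : S₁ × S₂)
    (c : (S₀ → V) × (S₁ → X₁) × (S₂ → X₂)) :
    ∑ y, r (c.2.1 s.1) (c.2.2 s.2) y *
      (if thresholdDecoder r w a b F₁ F₂ Q γ s₀ c y = s then 0 else 1) ≤
    ∑ y, r (c.2.1 s.1) (c.2.2 s.2) y *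
      (if Accepts r w a b F₁ F₂ Q γ s (c.1 (F₁ s.1)) (c.2.1 s.1) (c.2.2 s.2) y then 0 else 1) +
    ∑ s', if s' ≠ s ∧ F₁ s'.1 = F₂ s'.2 then acceptMass r w a b F₁ F₂ Q γ s s' c else 0 := by
  have e : (∑ s', if s' ≠ s ∧ F₁ s'.1 = F₂ s'.2 then acceptMass r w a b F₁ F₂ Q γ s s' c else 0) =
      ∑ y, r (c.2.1 s.1) (c.2.2 s.2) y * ∑ s' : S₁ × S₂, if s' ≠ s ∧ F₁ s'.1 = F₂ s'.2 then
        (if Accepts r w a b F₁ F₂ Q γ s' (c.1 (F₁ s'.1)) (c.2.1 s'.1) (c.2.2 s'.2) y then (1 : ℝ)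
          else 0) else 0 := by
    simp only [Finset.mul_sum]
    rw [Finset.sum_comm]
    refine Finset.sum_congr rfl fun s' _ => ?_
    split_ifs
    · rfl
    · simp
  rw [e, ← Finset.sum_add_distrib]
  refine Finset.sum_le_sum fun y _ => ?_
  rw [← mul_add]
  refine mul_le_mul_of_nonneg_left ?_ ((hr _ _).1 _)
  have hnn : ∀ s' : S₁ × S₂, (0 : ℝ) ≤ if s' ≠ s ∧ F₁ s'.1 = F₂ s'.2 then
        (if Accepts r w a b F₁ F₂ Q γ s' (c.1 (F₁ s'.1)) (c.2.1 s'.1) (c.2.2 s'.2) y then (1 : ℝ)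
          else 0) else 0 := fun s' => by positivity
  have hsum := Finset.sum_nonneg fun s' (_ : s' ∈ Finset.univ) => hnn s'
  by_cases hA : Accepts r w a b F₁ F₂ Q γ s (c.1 (F₁ s.1)) (c.2.1 s.1) (c.2.2 s.2) y
  · by_cases hd : thresholdDecoder r w a b F₁ F₂ Q γ s₀ c y = s
    · rw [if_pos hd, if_pos hA]
      linarith
    · have hex : ∃ s : S₁ × S₂,
          Accepts r w a b F₁ F₂ Q γ s (c.1 (F₁ s.1)) (c.2.1 s.1) (c.2.2 s.2) y := ⟨s, hA⟩
      have hdec : thresholdDecoder r w a b F₁ F₂ Q γ s₀ c y = hex.choose := dif_pos hex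
      have h1 := Finset.single_le_sum (fun s' _ => hnn s') (Finset.mem_univ hex.choose)
      rw [hdec] at hd ⊢
      rw [if_pos ⟨hd, hex.choose_spec.1⟩, if_pos hex.choose_spec] at h1
      rw [if_neg hd, if_pos hA]
      linarith
  · rw [if_neg hA]
    split_ifs
    · linarith
    · linarith

open Classical in
/-- Random coding: there is a code whose error probability is at most the probability that the
threshold test fails, plus the contributions of the four kinds of confusion. -/
theorem exists_code_error_le {P : S₁ × S₂ → ℝ} (hP : P ∈ stdSimplex ℝ (S₁ × S₂))
    (hF : IsCommonPart P F₁ F₂) (hr : ∀ x₁ x₂, r x₁ x₂ ∈ stdSimplex ℝ Y)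
    (hw : w ∈ stdSimplex ℝ V) (ha : IsCondPMF a) (hb : IsCondPMF b) (hQ : ∀ j s, 0 ≤ Q j s)
    (hγ : ∀ j, 0 < γ j) {M : Fin 4 → ℝ}
    (hM : ∀ j s, P s ≠ 0 → ∑ s', (if Confusable F₁ j s s' then Q j s' else 0) ≤ M j) :
    ∃ (e₁ : S₁ → X₁) (e₂ : S₂ → X₂) (dec : Y → S₁ × S₂),
      ∑ s, P s * ∑ y, r (e₁ s.1) (e₂ s.2) y * (if dec y = s then 0 else 1) ≤
      ∑ s, P s * ∑ v, w v * ∑ x₁, a v x₁ * ∑ x₂, b v x₂ * ∑ y, r x₁ x₂ y *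
        (if Accepts r w a b F₁ F₂ Q γ s v x₁ x₂ y then 0 else 1) + ∑ j, M j / γ j := by
  obtain ⟨s₀, -, -⟩ := Finset.exists_ne_zero_of_sum_ne_zero (hP.2.trans_ne one_ne_zero)
  set fail : S₁ × S₂ → ℝ := fun s => ∑ v, w v * ∑ x₁, a v x₁ * ∑ x₂, b v x₂ * ∑ y, r x₁ x₂ y *
        (if Accepts r w a b F₁ F₂ Q γ s v x₁ x₂ y then 0 else 1) with hfail
  have hL := codebookLaw_mem (F₁ := F₁) (F₂ := F₂) hw ha hb
  have main : ∀ s, P s ≠ 0 → ∑ c, codebookLaw w a b F₁ F₂ c * ∑ y, r (c.2.1 s.1) (c.2.2 s.2) y *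
      (if thresholdDecoder r w a b F₁ F₂ Q γ s₀ c y = s then 0 else 1) ≤
      fail s + ∑ j, M j / γ j := by
    intro s hs
    have hFs : F₁ s.1 = F₂ s.2 := hF s.1 s.2 hs
    refine (Finset.sum_le_sum fun c _ =>
      mul_le_mul_of_nonneg_left (decoderError_le hr s₀ s c) (hL.1 c)).trans ?_
    simp only [mul_add]
    rw [Finset.sum_add_distrib]
    refine add_le_add (le_of_eq ?_) ?_
    · exact sum_codebookLaw_apply hw ha hb hFs fun v x₁ x₂ => ∑ y, r x₁ x₂ y *
        if Accepts r w a b F₁ F₂ Q γ s v x₁ x₂ y then 0 else 1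
    · calc ∑ c, codebookLaw w a b F₁ F₂ c * ∑ s', (if s' ≠ s ∧ F₁ s'.1 = F₂ s'.2 then
              acceptMass r w a b F₁ F₂ Q γ s s' c else 0)
          = ∑ s', if s' ≠ s ∧ F₁ s'.1 = F₂ s'.2 then ∑ c, codebookLaw w a b F₁ F₂ c *
              acceptMass r w a b F₁ F₂ Q γ s s' c else 0 := by
            simp only [Finset.mul_sum]
            rw [Finset.sum_comm]
            refine Finset.sum_congr rfl fun s' _ => ?_
            split_ifs <;> simp
        _ ≤ ∑ s', ∑ j, if Confusable F₁ j s s' then Q j s' / γ j else 0 := by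
            refine Finset.sum_le_sum fun s' _ => ?_
            split_ifs with h
            · exact sum_acceptMass_le hr hw ha hb hQ hγ hFs h.2 h.1
            · refine Finset.sum_nonneg fun j _ => ?_
              have := div_nonneg (hQ j s') (hγ j).le
              split_ifs <;> simp [this]
        _ = ∑ j, (∑ s', if Confusable F₁ j s s' then Q j s' else 0) / γ j := by
            rw [Finset.sum_comm]
            refine Finset.sum_congr rfl fun j _ => ?_
            rw [Finset.sum_div]
            refine Finset.sum_congr rfl fun s' _ => ?_
            split_ifs <;> simp
        _ ≤ ∑ j, M j / γ j := Finset.sum_le_sum fun j _ =>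
            div_le_div_of_nonneg_right (hM j s hs) (hγ j).le
  -- The mean over codebooks of the error probability; some codebook does at least as well as the
  -- mean.
  have avg : ∑ c, codebookLaw w a b F₁ F₂ c * ∑ s, P s * ∑ y, r (c.2.1 s.1) (c.2.2 s.2) y *
      (if thresholdDecoder r w a b F₁ F₂ Q γ s₀ c y = s then 0 else 1) ≤
      ∑ s, P s * fail s + ∑ j, M j / γ j := by
    calc _ = ∑ s, P s * ∑ c, codebookLaw w a b F₁ F₂ c * ∑ y, r (c.2.1 s.1) (c.2.2 s.2) y *
          (if thresholdDecoder r w a b F₁ F₂ Q γ s₀ c y = s then 0 else 1) := by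
          simp only [Finset.mul_sum (ι := S₁ × S₂)]
          rw [Finset.sum_comm]
          refine Finset.sum_congr rfl fun s _ => ?_
          rw [Finset.mul_sum]
          exact Finset.sum_congr rfl fun c _ => by ring
      _ ≤ ∑ s, P s * (fail s + ∑ j, M j / γ j) := by
          refine Finset.sum_le_sum fun s _ => ?_
          by_cases hs : P s = 0
          · simp [hs]
          · exact mul_le_mul_of_nonneg_left (main s hs) (hP.1 s)
      _ = _ := by
          simp only [mul_add]
          rw [Finset.sum_add_distrib, ← Finset.sum_mul, hP.2, one_mul]
  obtain ⟨c, hc⟩ := exists_le_of_sum_mul_le hL avg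
  exact ⟨c.2.1, c.2.2, thresholdDecoder r w a b F₁ F₂ Q γ s₀ c, hc⟩

end OneShot

/-! ### Large deviations -/

section Chernoff

variable {Ω Ω' : Type*} [Fintype Ω] [Fintype Ω']

/-- After centring f at its mean, exp u ≤ 1 + u + u² for |u| ≤ 1; the linear term averages to zero
and 1 + x ≤ exp x restores an exponential. -/
theorem exists_sum_exp_le {μ : Ω → ℝ} (hμ : μ ∈ stdSimplex ℝ Ω) (f : Ω → ℝ) :
    ∃ C l : ℝ, 0 ≤ C ∧ 0 < l ∧ ∀ t, 0 ≤ t → t ≤ l →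
      ∑ ω, μ ω * Real.exp (-(t * f ω)) ≤ Real.exp (-(t * ∑ ω, μ ω * f ω) + C * t ^ 2) := by
  set m := ∑ ω, μ ω * f ω with hm
  set B := ∑ ω, |f ω - m| with hB
  have hB0 : 0 ≤ B := Finset.sum_nonneg fun _ _ => abs_nonneg _
  have hle : ∀ ω, |f ω - m| ≤ B := fun ω =>
    Finset.single_le_sum (f := fun ω => |f ω - m|) (fun _ _ => abs_nonneg _) (Finset.mem_univ ω)
  -- B bounds all deviations from the mean, and t ≤ 1/(B + 1) keeps the exponent in [-1, 1].
  refine ⟨B ^ 2, 1 / (B + 1), by positivity, by positivity, fun t ht0 ht => ?_⟩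
  rw [le_div_iff₀ (by positivity)] at ht
  have h1 : ∀ ω, Real.exp (-(t * f ω)) ≤
      Real.exp (-(t * m)) * (1 - t * (f ω - m) + B ^ 2 * t ^ 2) := by
    intro ω
    have e : -(t * f ω) = -(t * m) + -(t * (f ω - m)) := by ring
    rw [e, Real.exp_add]
    refine mul_le_mul_of_nonneg_left ?_ (Real.exp_pos _).le
    have h2 : |-(t * (f ω - m))| ≤ t * B := by
      rw [abs_neg, abs_mul, abs_of_nonneg ht0]
      exact mul_le_mul_of_nonneg_left (hle ω) ht0
    have h3 := (abs_le.1 (Real.abs_exp_sub_one_sub_id_le (x := -(t * (f ω - m)))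
      (h2.trans (by linarith)))).2
    have h4 : (-(t * (f ω - m))) ^ 2 ≤ (t * B) ^ 2 := sq_le_sq.2 (h2.trans (le_abs_self _))
    nlinarith
  calc ∑ ω, μ ω * Real.exp (-(t * f ω))
      ≤ ∑ ω, μ ω * (Real.exp (-(t * m)) * (1 - t * (f ω - m) + B ^ 2 * t ^ 2)) :=
        Finset.sum_le_sum fun ω _ => mul_le_mul_of_nonneg_left (h1 ω) (hμ.1 ω)
    _ = Real.exp (-(t * m)) * (1 + B ^ 2 * t ^ 2) := by
        have h5 : ∀ ω, μ ω * (Real.exp (-(t * m)) * (1 - t * (f ω - m) + B ^ 2 * t ^ 2)) =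
            Real.exp (-(t * m)) * ((1 + t * m + B ^ 2 * t ^ 2) * μ ω - t * (μ ω * f ω)) :=
          fun ω => by ring
        simp only [h5]
        rw [← Finset.mul_sum, Finset.sum_sub_distrib, ← Finset.mul_sum, ← Finset.mul_sum, hμ.2,
          ← hm]
        ring
    _ ≤ _ := by
        rw [Real.exp_add]
        refine mul_le_mul_of_nonneg_left ?_ (Real.exp_pos _).le
        linarith [Real.add_one_le_exp (B ^ 2 * t ^ 2)]

theorem sum_piLaw_mul_exp {ι : Type*} [Fintype ι] [DecidableEq ι] (μ f : Ω → ℝ) (t : ℝ) :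
    ∑ s, piLaw ι μ s * Real.exp (-(t * ∑ i, f (s i))) =
      (∑ ω, μ ω * Real.exp (-(t * f ω))) ^ Fintype.card ι := by
  have h : ∀ s : ι → Ω, piLaw ι μ s * Real.exp (-(t * ∑ i, f (s i))) =
      ∏ i, μ (s i) * Real.exp (-(t * f (s i))) := fun s => by
    rw [Finset.prod_mul_distrib, piLaw, Finset.mul_sum, ← Finset.sum_neg_distrib, Real.exp_sum]
  simp only [h]
  rw [sum_prod_eq_prod_sum fun _ ω => μ ω * Real.exp (-(t * f ω))]
  simp

open Classical in
/-- The lower tail of a sum of two independent sums of independent variables decays exponentially. -/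
theorem exists_tail_le {μ : Ω → ℝ} (hμ : μ ∈ stdSimplex ℝ Ω) (f : Ω → ℝ) {ν : Ω' → ℝ}
    (hν : ν ∈ stdSimplex ℝ Ω') (g : Ω' → ℝ) {c : ℝ} (hc : 0 < c) :
    ∃ τ : ℝ, 0 < τ ∧ ∀ (k n : ℕ) (L : ℝ), k ≤ n →
      n * c ≤ n * ∑ ω, ν ω * g ω + k * ∑ ω, μ ω * f ω - L →
      ∑ s, piLaw (Fin k) μ s * ∑ t, piLaw (Fin n) ν t *
        (if ∑ i, f (s i) + ∑ i, g (t i) < L then 1 else 0) ≤ Real.exp (-(n * τ)) := by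
  obtain ⟨C, l, hC, hl, h1⟩ := exists_sum_exp_le hμ f
  obtain ⟨C', l', hC', hl', h2⟩ := exists_sum_exp_le hν g
  -- Such t makes the quadratic terms use at most half of the gap c per letter, and the other half
  -- gives the exponent `t * (c / 2)`. The hypothesis k ≤ n lets n bound both numbers of letters.
  obtain ⟨t, ht0, htl, htl', htc⟩ : ∃ t : ℝ, 0 < t ∧ t ≤ l ∧ t ≤ l' ∧ (C + C') * t ≤ c / 2 := by
    refine ⟨min (min l l') (c / 2 / (C + C' + 1)), by positivity, ?_, ?_, ?_⟩
    · exact (min_le_left _ _).trans (min_le_left _ _)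
    · exact (min_le_left _ _).trans (min_le_right _ _)
    · refine (mul_le_mul_of_nonneg_left (min_le_right _ _) (by positivity)).trans ?_
      rw [mul_div_assoc', div_le_iff₀ (by positivity)]
      nlinarith
  refine ⟨t * (c / 2), by positivity, fun k n L hkn hL => ?_⟩
  have h3 := h1 t ht0.le htl
  have h4 := h2 t ht0.le htl'
  set m := ∑ ω, μ ω * f ω
  set m' := ∑ ω, ν ω * g ω
  calc ∑ s, piLaw (Fin k) μ s * ∑ t, piLaw (Fin n) ν t *
        (if ∑ i, f (s i) + ∑ i, g (t i) < L then 1 else 0)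
      ≤ ∑ s, piLaw (Fin k) μ s * ∑ u, piLaw (Fin n) ν u *
          (Real.exp (t * L) * Real.exp (-(t * ∑ i, f (s i))) * Real.exp (-(t * ∑ i, g (u i)))) := by
        refine Finset.sum_le_sum fun s _ => mul_le_mul_of_nonneg_left ?_ ((piLaw_mem hμ).1 s)
        refine Finset.sum_le_sum fun u _ => mul_le_mul_of_nonneg_left ?_ ((piLaw_mem hν).1 u)
        -- Chernoff's bound: the indicator of a total below L is at most exp(t(L - total)).
        rw [← Real.exp_add, ← Real.exp_add]
        split_ifs with h
        · refine Real.one_le_exp ?_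
          nlinarith
        · exact (Real.exp_pos _).le
    _ = Real.exp (t * L) * (∑ ω, μ ω * Real.exp (-(t * f ω))) ^ k *
          (∑ ω, ν ω * Real.exp (-(t * g ω))) ^ n := by
        have e1 := sum_piLaw_mul_exp (ι := Fin k) μ f t
        have e2 := sum_piLaw_mul_exp (ι := Fin n) ν g t
        rw [Fintype.card_fin] at e1 e2
        rw [← e1, ← e2, mul_assoc, Finset.sum_mul_sum]
        simp only [Finset.mul_sum (ι := Fin k → Ω), Finset.mul_sum (ι := Fin n → Ω')]
        refine Finset.sum_congr rfl fun s _ => ?_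
        exact Finset.sum_congr rfl fun u _ => by ring
    _ ≤ Real.exp (t * L) * Real.exp (-(t * m) + C * t ^ 2) ^ k *
          Real.exp (-(t * m') + C' * t ^ 2) ^ n := by
        have p1 : 0 ≤ ∑ ω, μ ω * Real.exp (-(t * f ω)) :=
          Finset.sum_nonneg fun ω _ => mul_nonneg (hμ.1 ω) (Real.exp_pos _).le
        have p2 : 0 ≤ ∑ ω, ν ω * Real.exp (-(t * g ω)) :=
          Finset.sum_nonneg fun ω _ => mul_nonneg (hν.1 ω) (Real.exp_pos _).le
        gcongr
    _ ≤ Real.exp (-(n * (t * (c / 2)))) := by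
        rw [← Real.exp_nat_mul, ← Real.exp_nat_mul, ← Real.exp_add, ← Real.exp_add]
        refine Real.exp_le_exp.2 ?_
        have hk : (k : ℝ) ≤ n := by exact_mod_cast hkn
        have q1 : (k : ℝ) * (C * t ^ 2) ≤ n * (C * t ^ 2) :=
          mul_le_mul_of_nonneg_right hk (by positivity)
        have q2 := mul_le_mul_of_nonneg_left hL ht0.le
        have q3 := mul_le_mul_of_nonneg_left htc (show (0 : ℝ) ≤ n * t by positivity)
        nlinarith

end Chernoff

/-! ### The letters of the random code -/

section Letters

variable {S₀ S₁ S₂ : Type*} [Fintype S₀] [Fintype S₁] [Fintype S₂]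

/-- The knowledge about a source letter that is available in the four kinds of confusion. -/
def SameClass (f₁ : S₁ → S₀) : Fin 4 → S₁ × S₂ → S₁ × S₂ → Prop
  | 0, s, s' => s'.2 = s.2
  | 1, s, s' => s'.1 = s.1
  | 2, s, s' => f₁ s'.1 = f₁ s.1
  | 3, _, _ => True

open Classical in
/-- The probability of the class of a source letter. -/
def classMass (p : S₁ × S₂ → ℝ) (f₁ : S₁ → S₀) (j : Fin 4) (s : S₁ × S₂) : ℝ :=
  ∑ s', if SameClass f₁ j s s' then p s' else 0

/-- The conditional probability of a source letter given its class. -/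
def classProb (p : S₁ × S₂ → ℝ) (f₁ : S₁ → S₀) (j : Fin 4) (s : S₁ × S₂) : ℝ :=
  p s / classMass p f₁ j s

/-- The four entropies of the source. -/
def sourceEntropy (p : S₁ × S₂ → ℝ) (f₁ : S₁ → S₀) : Fin 4 → ℝ
  | 0 => condEntropy p (fun (s₁, _) => s₁) (fun (_, s₂) => s₂)
  | 1 => condEntropy p (fun (_, s₂) => s₂) (fun (s₁, _) => s₁)
  | 2 => condEntropy p (fun (s₁, s₂) => (s₁, s₂)) (fun (s₁, _) => f₁ s₁)
  | 3 => entropy p (fun (s₁, s₂) => (s₁, s₂))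

variable {p : S₁ × S₂ → ℝ} {f₁ : S₁ → S₀}

omit [Fintype S₀] [Fintype S₁] [Fintype S₂] in
theorem SameClass.refl (j : Fin 4) (s : S₁ × S₂) : SameClass f₁ j s s := by
  fin_cases j <;> simp [SameClass]

omit [Fintype S₀] [Fintype S₁] [Fintype S₂] in
theorem SameClass.congr {j : Fin 4} {s s' : S₁ × S₂} (h : SameClass f₁ j s s') (t : S₁ × S₂) :
    SameClass f₁ j s t ↔ SameClass f₁ j s' t := by
  fin_cases j <;> simp_all [SameClass]

omit [Fintype S₀] in
theorem classMass_congr {j : Fin 4} {s s' : S₁ × S₂} (h : SameClass f₁ j s s') :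
    classMass p f₁ j s = classMass p f₁ j s' := by
  classical
  exact Finset.sum_congr rfl fun t _ => by simp only [h.congr t]

omit [Fintype S₀] in
theorem le_classMass (hp : p ∈ stdSimplex ℝ (S₁ × S₂)) (j : Fin 4) (s : S₁ × S₂) :
    p s ≤ classMass p f₁ j s := by
  classical
  have := Finset.single_le_sum (f := fun s' => if SameClass f₁ j s s' then p s' else 0)
    (fun s' _ => by
      have := hp.1 s'
      split_ifs <;> simp [this]) (Finset.mem_univ s)
  simpa [SameClass.refl, classMass] using this

omit [Fintype S₀] in
theorem classMass_nonneg (hp : p ∈ stdSimplex ℝ (S₁ × S₂)) (j : Fin 4) (s : S₁ × S₂) :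
    0 ≤ classMass p f₁ j s :=
  (hp.1 s).trans (le_classMass hp j s)

omit [Fintype S₀] in
theorem classProb_nonneg (hp : p ∈ stdSimplex ℝ (S₁ × S₂)) (j : Fin 4) (s : S₁ × S₂) :
    0 ≤ classProb p f₁ j s :=
  div_nonneg (hp.1 s) (classMass_nonneg hp j s)

omit [Fintype S₀] in
theorem classProb_pos (hp : p ∈ stdSimplex ℝ (S₁ × S₂)) (j : Fin 4) {s : S₁ × S₂} (hs : p s ≠ 0) :
    0 < classProb p f₁ j s :=
  have h : 0 < p s := lt_of_le_of_ne (hp.1 s) hs.symm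
  div_pos h (h.trans_le (le_classMass hp j s))

omit [Fintype S₀] in
open Classical in
theorem sum_classProb_le (j : Fin 4) (s : S₁ × S₂) :
    ∑ s', (if SameClass f₁ j s s' then classProb p f₁ j s' else 0) ≤ 1 := by
  have h : ∀ s', (if SameClass f₁ j s s' then classProb p f₁ j s' else 0) =
      (if SameClass f₁ j s s' then p s' else 0) / classMass p f₁ j s := fun s' => by
    split_ifs with h
    · rw [classProb, classMass_congr h]
    · simp
  simp only [h]
  rw [← Finset.sum_div]
  exact div_self_le_one _

theorem condEntropy_eq_sum_div {Ω A C : Type*} [Fintype Ω] [Fintype A] [Fintype C] {P : Ω → ℝ}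
    (hP : ∀ ω, 0 ≤ P ω) {X : Ω → A} {Z : Ω → C}
    (hinj : ∀ ω ω', X ω = X ω' → Z ω = Z ω' → ω = ω') :
    condEntropy P X Z = ∑ ω, P ω * -Real.log (P ω / law P Z (Z ω)) := by
  rw [condEntropy_eq_sum]
  refine Finset.sum_congr rfl fun ω _ => ?_
  by_cases h0 : P ω = 0
  · simp [h0]
  have h1 : law P (fun ω => (X ω, Z ω)) (X ω, Z ω) = P ω := by
    have := congrFun (law_id P) ω
    rw [← this]
    exact law_eq_law_of_iff fun ω' _ =>
      ⟨fun h => hinj _ _ (Prod.mk.inj h).1 (Prod.mk.inj h).2, fun h => by rw [h]⟩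
  rw [h1, Real.log_div h0 (law_pos hP Z h0).ne']
  ring

theorem sourceEntropy_eq_sum (hp : p ∈ stdSimplex ℝ (S₁ × S₂)) (j : Fin 4) :
    sourceEntropy p f₁ j = ∑ s, p s * -Real.log (classProb p f₁ j s) := by
  fin_cases j
  · exact condEntropy_eq_sum_div hp.1 fun s s' h h' => Prod.ext h h'
  · exact condEntropy_eq_sum_div hp.1 fun s s' h h' => Prod.ext h' h
  · exact condEntropy_eq_sum_div hp.1 fun s s' h _ => h
  · refine (condEntropy_unit hp _).symm.trans ((condEntropy_eq_sum_div hp.1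
      fun s s' h _ => h).trans ?_)
    simp [classProb, classMass, SameClass, law]

theorem sourceEntropy_nonneg (hp : p ∈ stdSimplex ℝ (S₁ × S₂)) (j : Fin 4) :
    0 ≤ sourceEntropy p f₁ j := by
  rw [sourceEntropy_eq_sum hp]
  exact Finset.sum_nonneg fun s _ => mul_nonneg (hp.1 s) (neg_nonneg.2
    (Real.log_nonpos (classProb_nonneg hp j s)
      (div_le_one_of_le₀ (le_classMass hp j s) (classMass_nonneg hp j s))))

/-- Zero entropy forces conditional probability 1 for every letter of the support given its class,
so nothing else in the class has mass. This handles the entropies for which shortening the source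
block gains no slack. -/
theorem eq_zero_of_sourceEntropy_eq_zero (hp : p ∈ stdSimplex ℝ (S₁ × S₂)) {j : Fin 4}
    (h : sourceEntropy p f₁ j = 0) {s s' : S₁ × S₂} (hs : p s ≠ 0) (hss' : SameClass f₁ j s s')
    (hne : s' ≠ s) : p s' = 0 := by
  classical
  rw [sourceEntropy_eq_sum hp, Finset.sum_eq_zero_iff_of_nonneg fun s _ => mul_nonneg (hp.1 s)
    (neg_nonneg.2 (Real.log_nonpos (classProb_nonneg hp j s)
      (div_le_one_of_le₀ (le_classMass hp j s) (classMass_nonneg hp j s))))] at h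
  have h1 : Real.log (classProb p f₁ j s) = 0 := by simpa [hs] using h s (Finset.mem_univ s)
  have h2 := Real.eq_one_of_pos_of_log_eq_zero (classProb_pos hp j hs) h1
  have h3 : p s = classMass p f₁ j s := by
    rw [classProb, div_eq_one_iff_eq] at h2
    · exact h2
    · intro h0
      rw [h0, div_zero] at h2
      exact zero_ne_one h2
  have h4 := Finset.sum_le_sum_of_subset_of_nonneg (Finset.subset_univ ({s, s'} : Finset (S₁ × S₂)))
    (f := fun s' => if SameClass f₁ j s s' then p s' else 0) fun s' _ _ => by
      have := hp.1 s'
      split_ifs <;> simp [this]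
  rw [Finset.sum_pair hne.symm, if_pos (SameClass.refl j s), if_pos hss'] at h4
  have h5 : p s + p s' ≤ p s := h4.trans h3.ge
  exact le_antisymm (by linarith) (hp.1 s')

end Letters

/-! ### Information densities -/

section Density

variable {V X₁ X₂ Y : Type*} [Fintype V] [Fintype X₁] [Fintype X₂] [Fintype Y]

/-- The joint pmf of the auxiliary variable, the inputs and the output. -/
def transmitLaw (r : X₁ → X₂ → Y → ℝ) (w : V → ℝ) (a : V → X₁ → ℝ) (b : V → X₂ → ℝ) :
    V × X₁ × X₂ × Y → ℝ :=
  fun t => w t.1 * (a t.1 t.2.1 * (b t.1 t.2.2.1 * r t.2.1 t.2.2.1 t.2.2.2))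

/-- The four information densities. -/
def infoDensity (r : X₁ → X₂ → Y → ℝ) (w : V → ℝ) (a : V → X₁ → ℝ) (b : V → X₂ → ℝ) (j : Fin 4)
    (t : V × X₁ × X₂ × Y) : ℝ :=
  Real.log (r t.2.1 t.2.2.1 t.2.2.2) -
    Real.log (outputGiven r w a b j t.1 t.2.1 t.2.2.1 t.2.2.2)

/-- The four informations. -/
def transmitInfo (r : X₁ → X₂ → Y → ℝ) (w : V → ℝ) (a : V → X₁ → ℝ) (b : V → X₂ → ℝ) : Fin 4 → ℝ
  | 0 => ∑ v, w v * inputInfo₁ r (a v) (b v)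
  | 1 => ∑ v, w v * inputInfo₂ r (a v) (b v)
  | 2 => ∑ v, w v * inputInfo₁₂ r (a v) (b v)
  | 3 => mixedInfo r w a b

variable {r : X₁ → X₂ → Y → ℝ} {w : V → ℝ} {a : V → X₁ → ℝ} {b : V → X₂ → ℝ}

theorem sum_transmitLaw_mul (g : V × X₁ × X₂ × Y → ℝ) :
    ∑ t, transmitLaw r w a b t * g t =
      ∑ v, w v * ∑ x₁, a v x₁ * ∑ x₂, b v x₂ * ∑ y, r x₁ x₂ y * g (v, x₁, x₂, y) := by
  simp only [Fintype.sum_prod_type, transmitLaw, Finset.mul_sum, mul_assoc]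

theorem transmitLaw_mem (hr : ∀ x₁ x₂, r x₁ x₂ ∈ stdSimplex ℝ Y) (hw : w ∈ stdSimplex ℝ V)
    (ha : IsCondPMF a) (hb : IsCondPMF b) :
    transmitLaw r w a b ∈ stdSimplex ℝ (V × X₁ × X₂ × Y) := by
  refine ⟨fun t => mul_nonneg (hw.1 _) (mul_nonneg ((ha _).1 _)
    (mul_nonneg ((hb _).1 _) ((hr _ _).1 _))), ?_⟩
  have := sum_transmitLaw_mul (r := r) (w := w) (a := a) (b := b) fun _ => 1
  simpa [(hr _ _).2, (ha _).2, (hb _).2, hw.2] using this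

omit [Fintype Y] in
theorem outputLaw_eq_sum (α : X₁ → ℝ) (β : X₂ → ℝ) (y : Y) :
    outputLaw r α β y = ∑ x₁, α x₁ * ∑ x₂, β x₂ * r x₁ x₂ y := by
  simp only [outputLaw, Finset.mul_sum, mul_assoc]

theorem outputGiven_pos (hr : ∀ x₁ x₂, r x₁ x₂ ∈ stdSimplex ℝ Y) (hw : w ∈ stdSimplex ℝ V)
    (ha : IsCondPMF a) (hb : IsCondPMF b) (j : Fin 4) {t : V × X₁ × X₂ × Y}
    (ht : transmitLaw r w a b t ≠ 0) :
    0 < outputGiven r w a b j t.1 t.2.1 t.2.2.1 t.2.2.2 := by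
  obtain ⟨v, x₁, x₂, y⟩ := t
  simp only [transmitLaw, ne_eq, mul_eq_zero, not_or] at ht
  have h1 : 0 < w v := lt_of_le_of_ne (hw.1 v) (Ne.symm ht.1)
  have h2 : 0 < a v x₁ := lt_of_le_of_ne ((ha v).1 x₁) (Ne.symm ht.2.1)
  have h3 : 0 < b v x₂ := lt_of_le_of_ne ((hb v).1 x₂) (Ne.symm ht.2.2.1)
  have h4 : 0 < r x₁ x₂ y := lt_of_le_of_ne ((hr _ _).1 _) (Ne.symm ht.2.2.2)
  have n2 : ∀ v x, 0 ≤ a v x := fun v x => (ha v).1 x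
  have n3 : ∀ v x, 0 ≤ b v x := fun v x => (hb v).1 x
  have n4 : ∀ x x' y, 0 ≤ r x x' y := fun x x' y => (hr x x').1 y
  have n5 : ∀ v x₁ y, 0 ≤ ∑ x₂, b v x₂ * r x₁ x₂ y := fun v x₁ y =>
    Finset.sum_nonneg fun x₂ _ => mul_nonneg (n3 _ _) (n4 _ _ _)
  have p5 : 0 < ∑ x₂, b v x₂ * r x₁ x₂ y :=
    Finset.sum_pos' (fun x₂ _ => mul_nonneg (n3 _ _) (n4 _ _ _))
      ⟨x₂, Finset.mem_univ _, mul_pos h3 h4⟩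
  have p6 : 0 < outputLaw r (a v) (b v) y := by
    rw [outputLaw_eq_sum]
    exact Finset.sum_pos' (fun x₁ _ => mul_nonneg (n2 _ _) (n5 _ _ _))
      ⟨x₁, Finset.mem_univ _, mul_pos h2 p5⟩
  fin_cases j
  · exact Finset.sum_pos' (fun x₁ _ => mul_nonneg (n2 _ _) (n4 _ _ _))
      ⟨x₁, Finset.mem_univ _, mul_pos h2 h4⟩
  · exact p5
  · exact p6
  · refine Finset.sum_pos' (fun v' _ => mul_nonneg (hw.1 _) ?_)
      ⟨v, Finset.mem_univ _, mul_pos h1 p6⟩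
    rw [outputLaw_eq_sum]
    exact Finset.sum_nonneg fun x₁ _ => mul_nonneg (n2 _ _) (n5 _ _ _)

theorem sum_transmitLaw_mul_log :
    ∑ t, transmitLaw r w a b t * Real.log (r t.2.1 t.2.2.1 t.2.2.2) =
      -∑ v, w v * noiseEntropy r (a v) (b v) := by
  rw [sum_transmitLaw_mul fun t => Real.log (r t.2.1 t.2.2.1 t.2.2.2)]
  simp only [noiseEntropy, Real.negMulLog, Finset.mul_sum, neg_mul, mul_neg,
    Finset.sum_neg_distrib, neg_neg, mul_assoc]

theorem sum_mul_sum_mul {A B : Type*} [Fintype A] [Fintype B] (c : A → ℝ) (ρ : A → B → ℝ) (l : B → ℝ) :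
    ∑ x, c x * ∑ y, ρ x y * l y = ∑ y, (∑ x, c x * ρ x y) * l y := by
  simp only [Finset.mul_sum, Finset.sum_mul, mul_assoc]
  exact Finset.sum_comm

theorem sum_mul_log {A : Type*} [Fintype A] (o : A → ℝ) :
    ∑ y, o y * Real.log (o y) = -∑ y, Real.negMulLog (o y) := by
  simp only [Real.negMulLog, neg_mul, Finset.sum_neg_distrib, neg_neg]

theorem sum_transmitLaw_mul_log_outputGiven (j : Fin 4) :
    ∑ t, transmitLaw r w a b t *
        Real.log (outputGiven r w a b j t.1 t.2.1 t.2.2.1 t.2.2.2) =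
      -(transmitInfo r w a b j + ∑ v, w v * noiseEntropy r (a v) (b v)) := by
  rw [sum_transmitLaw_mul fun t => Real.log (outputGiven r w a b j t.1 t.2.1 t.2.2.1 t.2.2.2)]
  fin_cases j <;>
  simp only [transmitInfo, inputInfo₁, inputInfo₂, inputInfo₁₂, mixedInfo, mul_sub,
    Finset.sum_sub_distrib, sub_add_cancel, outputGiven, ← Finset.sum_neg_distrib, ← mul_neg]
  · refine Finset.sum_congr rfl fun v _ => congrArg _ ?_
    simp only [← sum_mul_log, Finset.sum_neg_distrib]
    have h : ∀ x₂, ∑ y, (∑ x₁, a v x₁ * r x₁ x₂ y) * Real.log (∑ x₁, a v x₁ * r x₁ x₂ y) =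
        ∑ x₁, a v x₁ * ∑ y, r x₁ x₂ y * Real.log (∑ x₁, a v x₁ * r x₁ x₂ y) :=
      fun x₂ => (sum_mul_sum_mul _ _ _).symm
    simp only [h]
    simp only [Finset.mul_sum]
    rw [Finset.sum_comm]
    refine Finset.sum_congr rfl fun x₂ _ => Finset.sum_congr rfl fun x₁ _ =>
      Finset.sum_congr rfl fun y _ => by ring
  · refine Finset.sum_congr rfl fun v _ => congrArg _ (Finset.sum_congr rfl fun x₁ _ =>
      congrArg _ ?_)
    rw [sum_mul_sum_mul, sum_mul_log, Finset.sum_neg_distrib]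
  · refine Finset.sum_congr rfl fun v _ => congrArg _ ?_
    simp only [sum_mul_sum_mul, ← outputLaw_eq_sum]
    rw [sum_mul_log, Finset.sum_neg_distrib]
  · simp only [sum_mul_sum_mul, ← outputLaw_eq_sum]
    rw [sum_mul_log, Finset.sum_neg_distrib]

/-- The informations are the means of the densities, which supplies the centre for the tail bound.
-/
theorem sum_transmitLaw_mul_infoDensity (j : Fin 4) :
    ∑ t, transmitLaw r w a b t * infoDensity r w a b j t = transmitInfo r w a b j := by
  simp only [infoDensity, mul_sub, Finset.sum_sub_distrib]
  rw [sum_transmitLaw_mul_log, sum_transmitLaw_mul_log_outputGiven]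
  ring

omit [Fintype Y] in
-- The output laws tensorize, so the one-shot tests applied to blocks become statements about sums
-- of independent densities.
theorem outputGiven_pi {ι : Type*} [Fintype ι] [DecidableEq ι] (j : Fin 4) (v : ι → V) (x₁ : ι → X₁)
    (x₂ : ι → X₂) (y : ι → Y) :
    outputGiven (fun x₁ x₂ y => ∏ i, r (x₁ i) (x₂ i) (y i)) (fun v => ∏ i, w (v i))
      (fun (v : ι → V) (x : ι → X₁) => ∏ i, a (v i) (x i))
      (fun (v : ι → V) (x : ι → X₂) => ∏ i, b (v i) (x i)) j v x₁ x₂ y =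
      ∏ i, outputGiven r w a b j (v i) (x₁ i) (x₂ i) (y i) := by
  have h2 : ∀ (v : ι → V) (x₁ : ι → X₁), ∑ x₂ : ι → X₂, (∏ i, b (v i) (x₂ i)) *
      ∏ i, r (x₁ i) (x₂ i) (y i) = ∏ i, ∑ x₂, b (v i) x₂ * r (x₁ i) x₂ (y i) := fun v x₁ => by
    rw [← sum_prod_eq_prod_sum fun i x => b (v i) x * r (x₁ i) x (y i)]
    simp only [Finset.prod_mul_distrib]
  have h3 : ∀ v : ι → V, outputLaw (fun x₁ x₂ y => ∏ i, r (x₁ i) (x₂ i) (y i))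
      (fun x : ι → X₁ => ∏ i, a (v i) (x i)) (fun x : ι → X₂ => ∏ i, b (v i) (x i)) y =
      ∏ i, outputLaw r (a (v i)) (b (v i)) (y i) := fun v => by
    simp only [outputLaw_eq_sum, h2]
    rw [← sum_prod_eq_prod_sum fun i x => a (v i) x * ∑ x₂, b (v i) x₂ * r x x₂ (y i)]
    simp only [Finset.prod_mul_distrib]
  fin_cases j <;> simp only [outputGiven]
  · rw [← sum_prod_eq_prod_sum fun i x => a (v i) x * r x (x₂ i) (y i)]
    simp only [Finset.prod_mul_distrib]
  · exact h2 v x₁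
  · exact h3 v
  · simp only [h3]
    rw [← sum_prod_eq_prod_sum fun i v => w v * outputLaw r (a v) (b v) (y i)]
    simp only [Finset.prod_mul_distrib]

theorem sum_pi_eq_sum_piLaw {ι : Type*} [Fintype ι] [DecidableEq ι]
    (g : (ι → V) → (ι → X₁) → (ι → X₂) → (ι → Y) → ℝ) :
    ∑ v : ι → V, (∏ i, w (v i)) * ∑ x₁ : ι → X₁, (∏ i, a (v i) (x₁ i)) *
      ∑ x₂ : ι → X₂, (∏ i, b (v i) (x₂ i)) *
        ∑ y : ι → Y, (∏ i, r (x₁ i) (x₂ i) (y i)) * g v x₁ x₂ y =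
      ∑ t, piLaw ι (transmitLaw r w a b) t * g (fun i => (t i).1) (fun i => (t i).2.1)
        (fun i => (t i).2.2.1) (fun i => (t i).2.2.2) := by
  let e : (ι → V) × (ι → X₁) × (ι → X₂) × (ι → Y) ≃ (ι → V × X₁ × X₂ × Y) :=
    ⟨fun d i => (d.1 i, d.2.1 i, d.2.2.1 i, d.2.2.2 i), fun t => (fun i => (t i).1,
      fun i => (t i).2.1, fun i => (t i).2.2.1, fun i => (t i).2.2.2), fun _ => rfl, fun _ => rfl⟩
  rw [← e.sum_comp]
  simp only [Fintype.sum_prod_type, piLaw, transmitLaw, Finset.mul_sum, e, Equiv.coe_fn_mk,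
    Finset.prod_mul_distrib, mul_assoc]

end Density

/-! ### Random coding for blocks -/

section Block

variable {S₀ S₁ S₂ : Type*} [Fintype S₀] [Fintype S₁] [Fintype S₂] {p : S₁ × S₂ → ℝ} {f₁ : S₁ → S₀}
  {ι : Type*} [Fintype ι] [DecidableEq ι]

omit [Fintype S₀] [Fintype S₁] [Fintype S₂] [Fintype ι] [DecidableEq ι] in
theorem Confusable.sameClass {j : Fin 4} {s s' : (ι → S₁) × (ι → S₂)}
    (h : Confusable (fun s => f₁ ∘ s) j s s') (i : ι) :
    SameClass f₁ j (s.1 i, s.2 i) (s'.1 i, s'.2 i) := by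
  fin_cases j
  · exact congrFun h.2 i
  · exact congrFun h.2 i
  · exact congrFun h.2 i
  · trivial

omit [Fintype S₀] [Fintype S₁] [Fintype S₂] [Fintype ι] [DecidableEq ι] in
theorem Confusable.ne {j : Fin 4} {s s' : (ι → S₁) × (ι → S₂)}
    (h : Confusable (fun s => f₁ ∘ s) j s s') : s' ≠ s := by
  fin_cases j
  · exact h.1
  · exact h.1
  · exact h.1
  · exact h

omit [Fintype S₀] in
open Classical in
-- Confusable blocks agree in class at every letter. Dropping the requirement that the blocks differ
-- leaves a product of single-letter sums, each at most 1.
theorem sum_confusable_le_one (hp : p ∈ stdSimplex ℝ (S₁ × S₂)) (j : Fin 4)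
    (s : (ι → S₁) × (ι → S₂)) :
    ∑ s' : (ι → S₁) × (ι → S₂), (if Confusable (fun s => f₁ ∘ s) j s s' then
      ∏ i, classProb p f₁ j (s'.1 i, s'.2 i) else 0) ≤ 1 := by
  have h0 : ∀ i s', 0 ≤ (if SameClass f₁ j (s.1 i, s.2 i) s' then classProb p f₁ j s' else 0) :=
    fun i s' => by
      split_ifs
      · exact classProb_nonneg hp _ _
      · exact le_rfl
  calc ∑ s' : (ι → S₁) × (ι → S₂), (if Confusable (fun s => f₁ ∘ s) j s s' then
      ∏ i, classProb p f₁ j (s'.1 i, s'.2 i) else 0)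
      ≤ ∑ s' : (ι → S₁) × (ι → S₂), ∏ i, (if SameClass f₁ j (s.1 i, s.2 i) (s'.1 i, s'.2 i) then
          classProb p f₁ j (s'.1 i, s'.2 i) else 0) := by
        refine Finset.sum_le_sum fun s' _ => ?_
        split_ifs with h
        · exact le_of_eq (Finset.prod_congr rfl fun i _ => (if_pos (h.sameClass i)).symm)
        · exact Finset.prod_nonneg fun i _ => h0 i _
    _ = ∏ i, ∑ s', (if SameClass f₁ j (s.1 i, s.2 i) s' then classProb p f₁ j s' else 0) := by
        rw [← sum_prod_eq_prod_sum fun i s' =>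
          if SameClass f₁ j (s.1 i, s.2 i) s' then classProb p f₁ j s' else 0,
          ← (Equiv.arrowProdEquivProdArrow ι (fun _ => S₁) (fun _ => S₂)).sum_comp]
        rfl
    _ ≤ 1 := Finset.prod_le_one (fun i _ => Finset.sum_nonneg fun s' _ => h0 i s')
        fun i _ => sum_classProb_le j _

omit [Fintype S₀] in
open Classical in
-- A different block differs in some letter, and that letter lies in the class of a letter of the
-- support, hence has mass zero.
theorem sum_confusable_eq_zero {j : Fin 4}
    (h : ∀ s s', p s ≠ 0 → SameClass f₁ j s s' → s' ≠ s → p s' = 0)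
    {s : (ι → S₁) × (ι → S₂)} (hs : blockSource p ι s ≠ 0) :
    ∑ s' : (ι → S₁) × (ι → S₂), (if Confusable (fun s => f₁ ∘ s) j s s' then
      ∏ i, classProb p f₁ j (s'.1 i, s'.2 i) else 0) = 0 := by
  refine Finset.sum_eq_zero fun s' _ => ?_
  split_ifs with hc
  · have : ∃ i, (s'.1 i, s'.2 i) ≠ (s.1 i, s.2 i) := by
      by_contra! hall
      exact hc.ne (Prod.ext (funext fun i => (Prod.mk.inj (hall i)).1)
        (funext fun i => (Prod.mk.inj (hall i)).2))
    obtain ⟨i, hi⟩ := this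
    refine Finset.prod_eq_zero (Finset.mem_univ i) ?_
    rw [classProb, h _ _ (Finset.prod_ne_zero_iff.1 hs i (Finset.mem_univ i)) (hc.sameClass i) hi,
      zero_div]
  · rfl

end Block

/-! ### Error probability of random block codes. -/

section BlockCode

variable {S₀ S₁ S₂ V X₁ X₂ Y : Type*} [Fintype S₀] [Fintype S₁] [Fintype S₂] [Fintype V]
  [Fintype X₁] [Fintype X₂] [Fintype Y] {r : X₁ → X₂ → Y → ℝ} {w : V → ℝ} {a : V → X₁ → ℝ}
  {b : V → X₂ → ℝ} {p : S₁ × S₂ → ℝ} {f₁ : S₁ → S₀} {f₂ : S₂ → S₀}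

omit [Fintype S₀] in
-- On the support every factor is positive, so the logarithm turns each test into a comparison of L
-- with a sum of source log-probabilities and information densities.
theorem accepts_of_le (hr : ∀ x₁ x₂, r x₁ x₂ ∈ stdSimplex ℝ Y) (hp : p ∈ stdSimplex ℝ (S₁ × S₂))
    (hS₀ : IsCommonPart p f₁ f₂) (hw : w ∈ stdSimplex ℝ V) (ha : IsCondPMF a) (hb : IsCondPMF b)
    {k n : ℕ} {L : Fin 4 → ℝ} {s : Fin k → S₁ × S₂} {t : Fin n → V × X₁ × X₂ × Y}
    (hs : ∀ i, p (s i) ≠ 0) (ht : ∀ i, transmitLaw r w a b (t i) ≠ 0)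
    (hL : ∀ j, L j ≤ ∑ i, Real.log (classProb p f₁ j (s i)) + ∑ i, infoDensity r w a b j (t i)) :
    Accepts (fun x₁ x₂ y => ∏ i, r (x₁ i) (x₂ i) (y i)) (fun v => ∏ i, w (v i))
      (fun (v : Fin n → V) (x : Fin n → X₁) => ∏ i, a (v i) (x i))
      (fun (v : Fin n → V) (x : Fin n → X₂) => ∏ i, b (v i) (x i))
      (fun (s : Fin k → S₁) => f₁ ∘ s) (fun (s : Fin k → S₂) => f₂ ∘ s)
      (fun j s => ∏ i, classProb p f₁ j (s.1 i, s.2 i)) (fun j => Real.exp (L j))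
      (fun i => (s i).1, fun i => (s i).2) (fun i => (t i).1) (fun i => (t i).2.1)
      (fun i => (t i).2.2.1) (fun i => (t i).2.2.2) := by
  refine ⟨funext fun i => hS₀ _ _ (hs i), fun j => ?_⟩
  have h1 : ∀ i, 0 < classProb p f₁ j (s i) := fun i => classProb_pos hp j (hs i)
  have h2 := fun i => outputGiven_pos hr hw ha hb j (ht i)
  have h3 : ∀ i, 0 < r (t i).2.1 (t i).2.2.1 (t i).2.2.2 := fun i => by
    refine lt_of_le_of_ne ((hr _ _).1 _) fun h => ht i ?_
    simp [transmitLaw, ← h]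
  rw [outputGiven_pi]
  have e : ∀ {m : ℕ} (g : Fin m → ℝ), (∀ i, 0 < g i) →
      ∏ i, g i = Real.exp (∑ i, Real.log (g i)) := fun g hg => by
    rw [Real.exp_sum]
    exact Finset.prod_congr rfl fun i _ => (Real.exp_log (hg i)).symm
  dsimp only
  rw [e _ h1, e _ h2, e _ h3, ← Real.exp_add, ← Real.exp_add]
  refine Real.exp_le_exp.2 ?_
  have := hL j
  simp only [infoDensity, Finset.sum_sub_distrib] at this
  linarith

omit [Fintype S₀] in
open Classical in
theorem sum_not_accepts_le (hr : ∀ x₁ x₂, r x₁ x₂ ∈ stdSimplex ℝ Y)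
    (hp : p ∈ stdSimplex ℝ (S₁ × S₂)) (hS₀ : IsCommonPart p f₁ f₂) (hw : w ∈ stdSimplex ℝ V)
    (ha : IsCondPMF a) (hb : IsCondPMF b) (k n : ℕ) (L : Fin 4 → ℝ) :
    ∑ s, blockSource p (Fin k) s * ∑ v : Fin n → V, (∏ i, w (v i)) *
      ∑ x₁ : Fin n → X₁, (∏ i, a (v i) (x₁ i)) * ∑ x₂ : Fin n → X₂, (∏ i, b (v i) (x₂ i)) *
        ∑ y : Fin n → Y, (∏ i, r (x₁ i) (x₂ i) (y i)) *
          (if Accepts (fun x₁ x₂ y => ∏ i, r (x₁ i) (x₂ i) (y i)) (fun v => ∏ i, w (v i))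
            (fun (v : Fin n → V) (x : Fin n → X₁) => ∏ i, a (v i) (x i))
            (fun (v : Fin n → V) (x : Fin n → X₂) => ∏ i, b (v i) (x i))
            (fun (s : Fin k → S₁) => f₁ ∘ s) (fun (s : Fin k → S₂) => f₂ ∘ s)
            (fun j s => ∏ i, classProb p f₁ j (s.1 i, s.2 i)) (fun j => Real.exp (L j))
            s v x₁ x₂ y then 0 else 1) ≤
      ∑ j, ∑ s, piLaw (Fin k) p s * ∑ t, piLaw (Fin n) (transmitLaw r w a b) t *
        (if ∑ i, Real.log (classProb p f₁ j (s i)) + ∑ i, infoDensity r w a b j (t i) < L j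
          then 1 else 0) := by
  rw [sum_blockSource_mul]
  simp only [sum_pi_eq_sum_piLaw]
  rw [Finset.sum_comm]
  refine Finset.sum_le_sum fun s _ => ?_
  change piLaw (Fin k) p s * _ ≤ _
  rw [← Finset.mul_sum]
  by_cases hs : piLaw (Fin k) p s = 0
  · simp [hs]
  refine mul_le_mul_of_nonneg_left ?_ ((piLaw_mem hp).1 s)
  rw [Finset.sum_comm]
  refine Finset.sum_le_sum fun t _ => ?_
  rw [← Finset.mul_sum]
  by_cases ht : piLaw (Fin n) (transmitLaw r w a b) t = 0
  · simp [ht]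
  refine mul_le_mul_of_nonneg_left ?_ ((piLaw_mem (transmitLaw_mem hr hw ha hb)).1 t)
  -- Union bound: a rejected pair fails at least one of the four tests.
  have h0 : ∀ j : Fin 4, 0 ≤ (if ∑ i, Real.log (classProb p f₁ j (s i)) +
      ∑ i, infoDensity r w a b j (t i) < L j then (1 : ℝ) else 0) := fun j => by
    split_ifs <;> simp
  split_ifs with hacc
  · exact Finset.sum_nonneg fun j _ => h0 j
  by_cases hall : ∀ j, L j ≤ ∑ i, Real.log (classProb p f₁ j (s i)) +
      ∑ i, infoDensity r w a b j (t i)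
  · exact absurd (accepts_of_le hr hp hS₀ hw ha hb
      (fun i => Finset.prod_ne_zero_iff.1 hs i (Finset.mem_univ i))
      (fun i => Finset.prod_ne_zero_iff.1 ht i (Finset.mem_univ i)) hall) hacc
  · push Not at hall
    obtain ⟨j, hj⟩ := hall
    refine le_trans ?_ (Finset.single_le_sum (fun j _ => h0 j) (Finset.mem_univ j))
    rw [if_pos hj]

open Classical in
theorem exists_blockCode_error_le (hr : ∀ x₁ x₂, r x₁ x₂ ∈ stdSimplex ℝ Y)
    (hp : p ∈ stdSimplex ℝ (S₁ × S₂)) (hS₀ : IsCommonPart p f₁ f₂) (hw : w ∈ stdSimplex ℝ V)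
    (ha : IsCondPMF a) (hb : IsCondPMF b)
    (hle : ∀ j, sourceEntropy p f₁ j ≤ transmitInfo r w a b j) {η : ℝ} (hη : 0 < η) :
    ∃ B : ℕ → ℝ, Tendsto B atTop (nhds 0) ∧ ∀ n k : ℕ, (k : ℝ) ≤ (1 - η) * n →
      ∃ (e₁ : (Fin k → S₁) → Fin n → X₁) (e₂ : (Fin k → S₂) → Fin n → X₂)
        (dec : (Fin n → Y) → (Fin k → S₁) × (Fin k → S₂)),
        ∑ s, blockSource p (Fin k) s * ∑ y : Fin n → Y,
          (∏ i, r (e₁ s.1 i) (e₂ s.2 i) (y i)) * (if dec y = s then 0 else 1) ≤ B n := by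
  have hT := transmitLaw_mem hr hw ha hb
  set h := sourceEntropy p f₁ with hh
  have hh0 : ∀ j, 0 ≤ h j := fun j => sourceEntropy_nonneg hp j
  -- Since k ≤ (1 - η)n, the mean of test j is at least nηH. Half of this goes to the threshold
  -- exponent `n * δ j`, which makes `M j / γ j` vanish, and half to the gap `c j` of the tail
  -- bound. If H = 0 there are no confusions to pay for, so M is 0 and the threshold can be lowered
  -- to exp(-n), which yields the gap 1.
  set δ : Fin 4 → ℝ := fun j => if h j = 0 then -1 else η * h j / 2 with hδ
  set M : Fin 4 → ℝ := fun j => if h j = 0 then 0 else 1 with hM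
  set c : Fin 4 → ℝ := fun j => if h j = 0 then 1 else η * h j / 2 with hc
  have hpos : ∀ j, h j ≠ 0 → 0 < η * h j / 2 := fun j hj => by
    have : 0 < h j := lt_of_le_of_ne (hh0 j) hj.symm
    positivity
  have hc0 : ∀ j, 0 < c j := fun j => by
    simp only [hc]
    split_ifs with hj
    · exact one_pos
    · exact hpos j hj
  choose τ hτ htail using fun j => exists_tail_le hp (fun s => Real.log (classProb p f₁ j s)) hT
    (infoDensity r w a b j) (hc0 j)
  refine ⟨fun n => ∑ j, Real.exp (-(n * τ j)) + ∑ j, M j / Real.exp (n * δ j), ?_,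
    fun n k hk => ?_⟩
  · have hexp : ∀ t : ℝ, 0 < t → Tendsto (fun n : ℕ => Real.exp (-(n * t))) atTop (nhds 0) :=
      fun t ht => (Real.tendsto_exp_neg_atTop_nhds_zero).comp
        (tendsto_natCast_atTop_atTop.atTop_mul_const ht)
    have h1 : Tendsto (fun n : ℕ => ∑ j, Real.exp (-(n * τ j))) atTop (nhds (∑ j : Fin 4, 0)) :=
      tendsto_finsetSum _ fun j _ => hexp _ (hτ j)
    have h2 : Tendsto (fun n : ℕ => ∑ j, M j / Real.exp (n * δ j)) atTop
        (nhds (∑ j : Fin 4, 0)) := by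
      refine tendsto_finsetSum _ fun j _ => ?_
      by_cases hj : h j = 0
      · simp [hM, hj]
      · have := hexp _ (hpos j hj)
        simpa only [hM, hδ, hj, if_false, one_div, Real.exp_neg] using this
    simpa using h1.add h2
  · have hkn : k ≤ n := by
      have : (k : ℝ) ≤ n := by nlinarith [show (0 : ℝ) ≤ n from Nat.cast_nonneg n]
      exact_mod_cast this
    obtain ⟨e₁, e₂, dec, he⟩ := exists_code_error_le (P := blockSource p (Fin k))
      (F₁ := fun s => f₁ ∘ s) (F₂ := fun s => f₂ ∘ s)
      (r := fun (x₁ : Fin n → X₁) (x₂ : Fin n → X₂) (y : Fin n → Y) => ∏ i, r (x₁ i) (x₂ i) (y i))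
      (w := fun v : Fin n → V => ∏ i, w (v i))
      (a := fun (v : Fin n → V) (x : Fin n → X₁) => ∏ i, a (v i) (x i))
      (b := fun (v : Fin n → V) (x : Fin n → X₂) => ∏ i, b (v i) (x i))
      (Q := fun j s => ∏ i, classProb p f₁ j (s.1 i, s.2 i)) (γ := fun j => Real.exp (n * δ j))
      (M := M) (blockSource_mem hp)
      (fun s₁ s₂ hs => funext fun i =>
        hS₀ _ _ (Finset.prod_ne_zero_iff.1 hs i (Finset.mem_univ i)))
      (fun x₁ x₂ => prod_mem_stdSimplex fun i => hr (x₁ i) (x₂ i)) (pi_mem_stdSimplex hw)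
      (isCondPMF_pi ha) (isCondPMF_pi hb)
      (fun j s => Finset.prod_nonneg fun i _ => classProb_nonneg hp j _)
      (fun j => Real.exp_pos _) (fun j s hs => by
        by_cases hj : h j = 0
        · simp only [hM, if_pos hj]
          exact (sum_confusable_eq_zero
            (fun s s' => eq_zero_of_sourceEntropy_eq_zero hp hj) hs).le
        · simp only [hM, if_neg hj]
          exact sum_confusable_le_one hp j s)
    refine ⟨e₁, e₂, dec, he.trans (add_le_add ?_ le_rfl)⟩
    refine (sum_not_accepts_le hr hp hS₀ hw ha hb k n fun j => n * δ j).trans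
      (Finset.sum_le_sum fun j _ => htail j k n _ hkn ?_)
    rw [sum_transmitLaw_mul_infoDensity]
    have h1 : ∑ s, p s * Real.log (classProb p f₁ j s) = -h j := by
      rw [hh, sourceEntropy_eq_sum hp]
      simp
    rw [h1]
    have h2 : (n : ℝ) * h j ≤ n * transmitInfo r w a b j :=
      mul_le_mul_of_nonneg_left (hle j) (Nat.cast_nonneg n)
    by_cases hj : h j = 0
    · simp only [hc, hδ, if_pos hj]
      rw [hj] at h2 ⊢
      linarith
    · simp only [hc, hδ, if_neg hj]
      have := mul_le_mul_of_nonneg_right hk (hh0 j)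
      linarith

end BlockCode

/-! ### Achievability -/

section Achievability

variable {S₀ S₁ S₂ X₁ X₂ Y : Type*} [Fintype S₀] [Fintype S₁] [Fintype S₂]
  [Fintype X₁] [Fintype X₂] [Fintype Y] {mac : X₁ → X₂ → Y → ℝ} {p : S₁ × S₂ → ℝ} {f₁ : S₁ → S₀}
  {f₂ : S₂ → S₀}

theorem sum_blockSource_castAdd (hp : p ∈ stdSimplex ℝ (S₁ × S₂)) (k m : ℕ)
    (g : (Fin k → S₁) × (Fin k → S₂) → ℝ) :
    ∑ s, blockSource p (Fin (k + m)) s *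
      g (fun i => s.1 (Fin.castAdd m i), fun i => s.2 (Fin.castAdd m i)) =
      ∑ s, blockSource p (Fin k) s * g s := by
  rw [sum_blockSource_mul p fun s : (Fin (k + m) → S₁) × (Fin (k + m) → S₂) =>
    g (fun i => s.1 (Fin.castAdd m i), fun i => s.2 (Fin.castAdd m i)), sum_blockSource_mul,
    ← (Fin.appendEquiv k m).sum_comp, Fintype.sum_prod_type]
  refine Finset.sum_congr rfl fun s _ => ?_
  simp only [Fin.appendEquiv, Equiv.coe_fn_mk, Fin.prod_univ_add, Fin.append_left,
    Fin.append_right]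
  have := sum_prod_eq_one (q := fun (_ : Fin m) => p) fun _ => hp.2
  rw [← Finset.sum_mul, ← Finset.mul_sum, this, mul_one]

open Classical in
-- A block error costs at most all k encoded letters, and the guessed tail at most its m letters.
theorem sum_ne_addCases_le {S : Type*} {k m : ℕ} (s : Fin (k + m) → S) (d : Fin k → S)
    (d' : Fin m → S) :
    ∑ t, (if s t = Fin.addCases d d' t then (0 : ℝ) else 1) ≤
      k * (if d = (fun i => s (Fin.castAdd m i)) then 0 else 1) + m := by
  rw [Fin.sum_univ_add]
  simp only [Fin.addCases_left, Fin.addCases_right]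
  refine add_le_add ?_ ?_
  · split_ifs with h
    · simp [h]
    · refine (Finset.sum_le_sum fun i _ => (?_ : _ ≤ (1 : ℝ))).trans (by simp)
      split_ifs <;> simp
  · refine (Finset.sum_le_sum fun i _ => (?_ : _ ≤ (1 : ℝ))).trans (by simp)
    split_ifs <;> simp

omit [Fintype X₁] [Fintype X₂] in
open Classical in
/-- A code for the first `k` letters gives a code for all `k + m` letters. -/
theorem exists_code_distortion_le (hmac : ∀ x₁ x₂, mac x₁ x₂ ∈ stdSimplex ℝ Y)
    (hp : p ∈ stdSimplex ℝ (S₁ × S₂)) {k m : ℕ} (hn : 0 < k + m)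
    (e₁ : (Fin k → S₁) → Fin (k + m) → X₁) (e₂ : (Fin k → S₂) → Fin (k + m) → X₂)
    (dec : (Fin (k + m) → Y) → (Fin k → S₁) × (Fin k → S₂)) :
    ∃ c : Code S₁ S₂ X₁ X₂ Y S₁ S₂ (k + m), ∀ ε : ℝ,
      ∑ s, blockSource p (Fin k) s * ∑ y : Fin (k + m) → Y,
        (∏ i, mac (e₁ s.1 i) (e₂ s.2 i) (y i)) * (if dec y = s then 0 else 1) ≤ ε →
      distortion₁ mac p hamming c ≤ ENNReal.ofReal (ε + m / (k + m : ℕ)) ∧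
      distortion₂ mac p hamming c ≤ ENNReal.ofReal (ε + m / (k + m : ℕ)) := by
  obtain ⟨⟨z₁, z₂⟩, -, -⟩ := Finset.exists_ne_zero_of_sum_ne_zero (hp.2.trans_ne one_ne_zero)
  let c : Code S₁ S₂ X₁ X₂ Y S₁ S₂ (k + m) :=
    ⟨fun s => e₁ fun i => s (Fin.castAdd m i), fun s => e₂ fun i => s (Fin.castAdd m i),
      fun y t => Fin.addCases (dec y).1 (fun _ => z₁) t,
      fun y t => Fin.addCases (dec y).2 (fun _ => z₂) t⟩
  have key : ∀ (ε : ℝ) (N : (Fin (k + m) → S₁) × (Fin (k + m) → S₂) → (Fin (k + m) → Y) → ℝ),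
      (∀ s y, N s y ≤ k * (if dec y = (fun i => s.1 (Fin.castAdd m i),
        fun i => s.2 (Fin.castAdd m i)) then 0 else 1) + m) →
      ∑ s, blockSource p (Fin k) s * ∑ y : Fin (k + m) → Y,
        (∏ i, mac (e₁ s.1 i) (e₂ s.2 i) (y i)) * (if dec y = s then 0 else 1) ≤ ε →
      ((k + m : ℕ) : ℝ)⁻¹ * ∑ s, blockSource p (Fin (k + m)) s *
        ∑ y, codeChannel mac c s y * N s y ≤ ε + m / (k + m : ℕ) := by
    intro ε N hN hε
    have h1 : ∑ s, blockSource p (Fin (k + m)) s * ∑ y, codeChannel mac c s y * N s y ≤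
        k * ε + m := by
      calc ∑ s, blockSource p (Fin (k + m)) s * ∑ y, codeChannel mac c s y * N s y
          ≤ ∑ s, blockSource p (Fin (k + m)) s * (k * ∑ y, codeChannel mac c s y *
              (if dec y = (fun i => s.1 (Fin.castAdd m i),
                fun i => s.2 (Fin.castAdd m i)) then 0 else 1) + m) := by
            refine Finset.sum_le_sum fun s _ =>
              mul_le_mul_of_nonneg_left ?_ ((blockSource_mem hp).1 s)
            refine (Finset.sum_le_sum fun y _ => mul_le_mul_of_nonneg_left (hN s y)
              ((isCondPMF_codeChannel hmac s).1 y)).trans (le_of_eq ?_)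
            simp only [mul_add, Finset.sum_add_distrib]
            rw [← Finset.sum_mul, (isCondPMF_codeChannel hmac s).2, one_mul, Finset.mul_sum]
            congr 1
            exact Finset.sum_congr rfl fun y _ => by ring
        _ = k * ∑ s, blockSource p (Fin k) s * ∑ y : Fin (k + m) → Y,
              (∏ i, mac (e₁ s.1 i) (e₂ s.2 i) (y i)) * (if dec y = s then 0 else 1) + m := by
            simp only [mul_add, Finset.sum_add_distrib]
            rw [← Finset.sum_mul, (blockSource_mem hp).2, one_mul,
              ← sum_blockSource_castAdd hp k m, Finset.mul_sum]
            congr 1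
            exact Finset.sum_congr rfl fun s _ => mul_left_comm _ _ _
        _ ≤ k * ε + m := by gcongr
    -- The sign of ε is needed to bound kε/(k + m) by ε.
    have hε0 : 0 ≤ ε := by
      refine le_trans (Finset.sum_nonneg fun s _ => mul_nonneg ((blockSource_mem hp).1 s)
        (Finset.sum_nonneg fun y _ => mul_nonneg
          (Finset.prod_nonneg fun i _ => (hmac _ _).1 _) ?_)) hε
      split_ifs <;> simp
    have hn' : (0 : ℝ) < (k + m : ℕ) := by exact_mod_cast hn
    rw [inv_mul_le_iff₀ hn', mul_add, mul_div_cancel₀ _ hn'.ne']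
    refine h1.trans ?_
    push_cast
    nlinarith [show (0 : ℝ) ≤ m from Nat.cast_nonneg m]
  refine ⟨c, fun ε hε => ?_⟩
  rw [distortion₁_eq hmac hp c hn, distortion₂_eq hmac hp c hn]
  constructor
  · refine ENNReal.ofReal_le_ofReal (key ε _ (fun s y => (sum_ne_addCases_le s.1 (dec y).1
      fun _ => z₁).trans ?_) hε)
    gcongr ?_ * ?_ + _
    split_ifs with h1 h2 h2
    · exact le_rfl
    · exact zero_le_one
    · exact absurd (congrArg Prod.fst h2) h1
    · exact le_rfl
  · refine ENNReal.ofReal_le_ofReal (key ε _ (fun s y => (sum_ne_addCases_le s.2 (dec y).2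
      fun _ => z₂).trans ?_) hε)
    gcongr ?_ * ?_ + _
    split_ifs with h1 h2 h2
    · exact le_rfl
    · exact zero_le_one
    · exact absurd (congrArg Prod.snd h2) h1
    · exact le_rfl

theorem eventually_exists_code_distortion_le (hmac : ∀ x₁ x₂, mac x₁ x₂ ∈ stdSimplex ℝ Y)
    (hp : p ∈ stdSimplex ℝ (S₁ × S₂)) (hS₀ : IsCommonPart p f₁ f₂)
    (h : EntropiesSupported mac p f₁) {ε : ℝ} (hε : 0 < ε) :
    ∀ᶠ n in atTop, ∃ c : Code S₁ S₂ X₁ X₂ Y S₁ S₂ n,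
      distortion₁ mac p hamming c ≤ ENNReal.ofReal ε ∧
      distortion₂ mac p hamming c ≤ ENNReal.ofReal ε := by
  obtain ⟨l, w, a, b, hs⟩ := h
  -- With k = ⌊(1 - η)n⌋ the tail has m ≤ ηn + 1 letters. For n ≥ 3/ε its share of the distortion is
  -- at most 2ε/3, which leaves ε/3 for the block error.
  set η : ℝ := min (ε / 3) 1 with hη
  have hη0 : 0 < η := by positivity
  have hη1 : η ≤ 1 := min_le_right _ _
  have hη3 : η ≤ ε / 3 := min_le_left _ _
  obtain ⟨B, hB, hcode⟩ := exists_blockCode_error_le (f₁ := f₁) (f₂ := f₂) hmac hp hS₀ hs.mem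
    hs.isCond₁ hs.isCond₂ (fun j => by
      fin_cases j
      · exact hs.le₁
      · exact hs.le₂
      · exact hs.le₁₂
      · exact hs.le_mixed) hη0
  filter_upwards [hB.eventually_lt_const (show (0 : ℝ) < ε / 3 by positivity), eventually_gt_atTop 0,
    tendsto_natCast_atTop_atTop.eventually_ge_atTop (3 / ε)] with n hBn hn hn3
  have hx : 0 ≤ (1 - η) * n := mul_nonneg (by linarith) (Nat.cast_nonneg n)
  obtain ⟨e₁, e₂, dec, he⟩ := hcode n ⌊(1 - η) * n⌋₊ (Nat.floor_le hx)
  have hfl := Nat.lt_floor_add_one ((1 - η) * n)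
  have hle : ⌊(1 - η) * n⌋₊ ≤ n := by
    have h1 := Nat.floor_le hx
    have : ((⌊(1 - η) * n⌋₊ : ℕ) : ℝ) ≤ n := by
      nlinarith [show (0 : ℝ) ≤ n from Nat.cast_nonneg n]
    exact_mod_cast this
  generalize ⌊(1 - η) * n⌋₊ = k at *
  obtain ⟨m, rfl⟩ := Nat.exists_eq_add_of_le hle
  obtain ⟨c, hc⟩ := exists_code_distortion_le hmac hp hn e₁ e₂ dec
  have hn' : (0 : ℝ) < (k + m : ℕ) := by exact_mod_cast hn
  have hbound : B (k + m) + m / (k + m : ℕ) ≤ ε := by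
    have h1 : (m : ℝ) / (k + m : ℕ) ≤ 2 * (ε / 3) := by
      rw [div_le_iff₀ hn']
      rw [div_le_iff₀ hε] at hn3
      have h2 := mul_le_mul_of_nonneg_right hη3 hn'.le
      push_cast at *
      nlinarith
    linarith
  obtain ⟨h1, h2⟩ := hc _ he
  exact ⟨c, h1.trans (ENNReal.ofReal_le_ofReal hbound), h2.trans (ENNReal.ofReal_le_ofReal hbound)⟩

/-- The codes found so far depend on ε. There are finitely many codes of each length, so taking the
best one at every length gives a single sequence without a diagonal argument. -/
theorem mem_admissibleRegion_of_entropiesSupported (hmac : ∀ x₁ x₂, mac x₁ x₂ ∈ stdSimplex ℝ Y)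
    (hp : p ∈ stdSimplex ℝ (S₁ × S₂)) (hS₀ : IsCommonPart p f₁ f₂)
    (h : EntropiesSupported mac p f₁) : p ∈ admissibleRegion S₁ S₂ mac := by
  obtain ⟨⟨z₁, z₂⟩, -, -⟩ := Finset.exists_ne_zero_of_sum_ne_zero (hp.2.trans_ne one_ne_zero)
  -- A code must exist at every length, including those where the random coding bound says nothing.
  -- The supported pmfs guarantee nonempty input alphabets.
  have hne : Nonempty X₁ ∧ Nonempty X₂ := by
    obtain ⟨l, w, a, b, hs⟩ := h
    obtain ⟨v, -, -⟩ := Finset.exists_ne_zero_of_sum_ne_zero (hs.mem.2.trans_ne one_ne_zero)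
    obtain ⟨x₁, -, -⟩ := Finset.exists_ne_zero_of_sum_ne_zero
      ((hs.isCond₁ v).2.trans_ne one_ne_zero)
    obtain ⟨x₂, -, -⟩ := Finset.exists_ne_zero_of_sum_ne_zero
      ((hs.isCond₂ v).2.trans_ne one_ne_zero)
    exact ⟨⟨x₁⟩, ⟨x₂⟩⟩
  obtain ⟨⟨x₁⟩, ⟨x₂⟩⟩ := hne
  let d : (n : ℕ) → Code S₁ S₂ X₁ X₂ Y S₁ S₂ n → ℝ≥0∞ := fun n c =>
    max (distortion₁ mac p hamming c) (distortion₂ mac p hamming c)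
  have hex : ∀ n, ∃ c : Code S₁ S₂ X₁ X₂ Y S₁ S₂ n, ∀ c', d n c ≤ d n c' := fun n => by
    have hf : Finite (Code S₁ S₂ X₁ X₂ Y S₁ S₂ n) :=
      Finite.of_injective (fun c : Code S₁ S₂ X₁ X₂ Y S₁ S₂ n => (c.enc₁, c.enc₂, c.dec₁, c.dec₂))
        fun c c' hcc => by
          cases c
          cases c'
          simp_all
    have : Nonempty (Code S₁ S₂ X₁ X₂ Y S₁ S₂ n) :=
      ⟨⟨fun _ _ => x₁, fun _ _ => x₂, fun _ _ => z₁, fun _ _ => z₂⟩⟩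
    exact Finite.exists_min (d n)
  choose c hc using hex
  have hlim : Tendsto (fun n => d n (c n)) atTop (nhds 0) := by
    rw [ENNReal.tendsto_nhds_zero]
    intro ε hε
    obtain ⟨δ, hδ0, hδ⟩ := ENNReal.lt_iff_exists_nnreal_btwn.1 hε
    filter_upwards [eventually_exists_code_distortion_le hmac hp hS₀ h
      (ε := δ) (by exact_mod_cast hδ0)] with n ⟨c', h1, h2⟩
    refine (hc n c').trans ((max_le h1 h2).trans ?_)
    rw [ENNReal.ofReal_coe_nnreal]
    exact hδ.le
  refine ⟨c, ?_, ?_⟩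
  · exact (tendsto_of_tendsto_of_tendsto_of_le_of_le tendsto_const_nhds hlim
      (fun _ => zero_le) fun n => le_max_left _ _).limsup_eq.le
  · exact (tendsto_of_tendsto_of_tendsto_of_le_of_le tendsto_const_nhds hlim
      (fun _ => zero_le) fun n => le_max_right _ _).limsup_eq.le

end Achievability

end

end MacSource

theorem mainTheorem2 {S₀ S₁ S₂ X₁ X₂ Y : Type*} [Fintype S₀] [Fintype S₁] [Fintype S₂]
    [Fintype X₁] [Fintype X₂] [Fintype Y]
    (mac : X₁ → X₂ → Y → ℝ) (hmac : ∀ x₁ x₂, mac x₁ x₂ ∈ stdSimplex ℝ Y)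
    (p : S₁ × S₂ → ℝ) (hp : p ∈ stdSimplex ℝ (S₁ × S₂))
    (f₁ : S₁ → S₀) (f₂ : S₂ → S₀) (hS₀ : MacSource.IsCommonPart p f₁ f₂)
    (hMarkov : MacSource.IsMarkov p (fun (s₁, _) => s₁) (fun (s₁, _) => f₁ s₁)
      (fun (_, s₂) => s₂)) :
    (p ∈ MacSource.admissibleRegion S₁ S₂ mac ↔ p ∈ MacSource.innerBound mac f₁) ∧
    (p ∈ MacSource.innerBound mac f₁ ↔ p ∈ MacSource.outerBound mac f₁) ∧
    (p ∈ MacSource.outerBound mac f₁ ↔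
      ∃ (m : ℕ) (pW : Fin m → ℝ) (pX₁ : S₁ × Fin m → X₁ → ℝ) (pX₂ : S₂ × Fin m → X₂ → ℝ),
        pW ∈ stdSimplex ℝ (Fin m) ∧ MacSource.IsCondPMF pX₁ ∧ MacSource.IsCondPMF pX₂ ∧
        MacSource.condEntropy p (fun (s₁, _) => s₁) (fun (_, s₂) => s₂) ≤
          MacSource.condMutualInfo (MacSource.innerLaw mac p pW pX₁ pX₂)
            (fun (_, _, _, x₁, _, _) => x₁) (fun (_, _, _, _, _, y) => y)
            (fun (_, s₂, w, _, x₂, _) => (x₂, s₂, w)) ∧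
        MacSource.condEntropy p (fun (_, s₂) => s₂) (fun (s₁, _) => s₁) ≤
          MacSource.condMutualInfo (MacSource.innerLaw mac p pW pX₁ pX₂)
            (fun (_, _, _, _, x₂, _) => x₂) (fun (_, _, _, _, _, y) => y)
            (fun (s₁, _, w, x₁, _, _) => (x₁, s₁, w)) ∧
        MacSource.condEntropy p (fun (s₁, s₂) => (s₁, s₂)) (fun (s₁, _) => f₁ s₁) ≤
          MacSource.condMutualInfo (MacSource.innerLaw mac p pW pX₁ pX₂)
            (fun (_, _, _, x₁, x₂, _) => (x₁, x₂)) (fun (_, _, _, _, _, y) => y)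
            (fun (s₁, _, w, _, _, _) => (f₁ s₁, w)) ∧
        MacSource.entropy p (fun (s₁, s₂) => (s₁, s₂)) ≤
          MacSource.mutualInfo (MacSource.innerLaw mac p pW pX₁ pX₂)
            (fun (_, _, _, x₁, x₂, _) => (x₁, x₂)) (fun (_, _, _, _, _, y) => y)) := by
  have hi := MacSource.mem_innerBound_iff hmac hp hS₀ hMarkov
  have ho : p ∈ MacSource.outerBound mac f₁ → p ∈ MacSource.innerBound mac f₁ := fun h =>
    hi.2 (MacSource.entropiesSupported_of_mem_outerBound hmac hp hS₀ hMarkov h)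
  have ha : p ∈ MacSource.innerBound mac f₁ → p ∈ MacSource.admissibleRegion S₁ S₂ mac := fun h =>
    MacSource.mem_admissibleRegion_of_entropiesSupported hmac hp hS₀ (hi.1 h)
  have hc : p ∈ MacSource.admissibleRegion S₁ S₂ mac → p ∈ MacSource.outerBound mac f₁ :=
    MacSource.mem_outerBound_of_mem_admissibleRegion hmac hp f₁
  -- The cycle inner, admissible, outer, inner closes all equivalences; the last condition is the
  -- definition of the inner bound unfolded.
  exact ⟨⟨fun h => ho (hc h), ha⟩, ⟨fun h => hc (ha h), ho⟩, ⟨ho, fun h => hc (ha h)⟩⟩
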